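/- Let $d\ge 1$ and $p\in[1,2]$, and let $h=h_p$, where $h_p(z)=\frac{|z|^p-1}{p-1}$ for $p\in(1,2]$ and $h_1(z)=z\log z$. For finite positive measures $\lambda,\mu$ on $\mathbb R^d$ of equal mass, absolutely continuous with respect to Lebesgue measure, put $P=\lambda\otimes\mu$ and let $\Pi(\lambda,\mu)$ be the set of couplings of $\lambda$ and $\mu$. For $\varepsilon>0$ consider the problem $$\min_{\pi\in\Pi(\lambda,\mu)}\ \int|x-y|^2\,\mathrm d\pi+\varepsilon^2\int h\Big(\frac{\mathrm d\pi}{\mathrm dP}\Big)\,\mathrm dP,\qquad(\ast)$$ where the functional is $+\infty$ if $\pi\not\ll P$; a minimiser is understood to have finite value. For a coupling $\pi\ll P$ and $R>0$ set $$E(\pi,R)=R^{-(d+2)}\int_{B_R\times\mathbb R^d}|y-x|^2\,\mathrm d\pi,\qquad T_\varepsilon(x)=\frac{\int y\, w\big(\frac{\mathrm d\pi}{\mathrm dP}(x,y)\big)\,\mathrm d\mu(y)}{\int w\big(\frac{\mathrm d\pi}{\mathrm dP}(x,y)\big)\,\mathrm d\mu(y)},$$ where $B_R$ is the open ball of radius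 $R$ centred at $0$, $w(z)=1/h''(z)$ for $z>0$ and $w(0)=0$. The map $T_\varepsilon$ is determined up to $\lambda$-null sets. There are $\varepsilon_1>0$ and $C_0>0$, depending only on $p$ and $d$, such that for all $0<m\le M$ there is $\delta>0$, depending only on $p,d,m,M$, such that for every $C\ge C_0$ there is $K<\infty$, depending only on $p,d,m,M,C$, with the following property. Let $0<\varepsilon\le\varepsilon_1$ and $r=C\varepsilon^{\frac{2}{d(p-1)+2}}$, let $\lambda,\mu$ be as above with Lebesgue densities that lie in $[m,M]$ almost everywhere on $B_r$, and let $\pi$ be a minimiser of $(\ast)$ with $E(\pi,r)\le\delta$. Then for almost every $x\in B_{r/3}$ the two integrals defining $T_\varepsilon(x)$ converge and the denominator is positive, and $T_\varepsilon$ agrees almost everywhere on $B_{r/3}$ with a $K$-Lipschitz map; in particular $$\operatorname*{ess\,sup}_{x\in B_{r/3}}|\nabla T_\varepsilon(x)|\le K .$$ If $p<2$, this representative of $T_\varepsilon$ is continuously differentiable on $B_{r/3}$ and $\sup_{x\in B_{r/3}}|\nabla T_\varepsilon(x)|\le K$. -/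

import Mathlib

open MeasureTheory Set Metric
open scoped NNReal ENNReal

noncomputable section

/-- The space `ℝᵈ` with its Euclidean norm and Lebesgue measure. -/
abbrev Rn (d : ℕ) : Type := EuclideanSpace ℝ (Fin d)

/-- The regularisation `h_p`: `(|z|^p - 1) / (p - 1)` for `p ≠ 1`, and `z log z` for `p = 1`. -/
def hReg (p : ℝ) (z : ℝ) : ℝ :=
  if p = 1 then z * Real.log z else (|z| ^ p - 1) / (p - 1)

/-- `π` is a coupling of `lam` and `mu`. -/
def IsCoupling {d : ℕ} (lam mu : Measure (Rn d)) (π : Measure (Rn d × Rn d)) : Prop :=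
  π.map Prod.fst = lam ∧ π.map Prod.snd = mu

/-- The Radon-Nikodym density `dπ / d(lam ⊗ mu)`. -/
def planDensity {d : ℕ} (lam mu : Measure (Rn d)) (π : Measure (Rn d × Rn d))
    (z : Rn d × Rn d) : ℝ :=
  (π.rnDeriv (lam.prod mu) z).toReal

/-- The regularised transport functional is finite at `π`.  It is understood to be `+∞` at
couplings that are not absolutely continuous with respect to `lam ⊗ mu`. -/
def HasFiniteCost {d : ℕ} (h : ℝ → ℝ) (lam mu : Measure (Rn d))
    (π : Measure (Rn d × Rn d)) : Prop :=
  π ≪ lam.prod mu ∧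
  Integrable (fun z : Rn d × Rn d => ‖z.1 - z.2‖ ^ 2) π ∧
  Integrable (fun z : Rn d × Rn d => h (planDensity lam mu π z)) (lam.prod mu)

/-- The regularised transport functional
`∫ |x - y|² dπ + ε² ∫ h (dπ / d(lam ⊗ mu)) d(lam ⊗ mu)`, used where `HasFiniteCost` holds. -/
def regCost {d : ℕ} (h : ℝ → ℝ) (ε : ℝ) (lam mu : Measure (Rn d))
    (π : Measure (Rn d × Rn d)) : ℝ :=
  (∫ z, ‖z.1 - z.2‖ ^ 2 ∂π) + ε ^ 2 * ∫ z, h (planDensity lam mu π z) ∂(lam.prod mu)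

/-- `π` minimises the regularised transport functional among all couplings of `lam` and `mu`,
the minimum being finite (couplings at which the functional is `+∞` impose no condition). -/
def IsRegMinimiser {d : ℕ} (h : ℝ → ℝ) (ε : ℝ) (lam mu : Measure (Rn d))
    (π : Measure (Rn d × Rn d)) : Prop :=
  IsCoupling lam mu π ∧ HasFiniteCost h lam mu π ∧
  ∀ π' : Measure (Rn d × Rn d), IsCoupling lam mu π' → HasFiniteCost h lam mu π' →
    regCost h ε lam mu π ≤ regCost h ε lam mu π'

/-- The excess energy `E(π, R) = R^{-(d+2)} ∫_{B_R × ℝᵈ} |y - x|² dπ`. -/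
def excessEnergy {d : ℕ} (π : Measure (Rn d × Rn d)) (R : ℝ) : ℝ :=
  (R ^ (d + 2))⁻¹ * ∫ z in (ball (0 : Rn d) R) ×ˢ (univ : Set (Rn d)), ‖z.2 - z.1‖ ^ 2 ∂π

/-- The Lebesgue density of `ν` lies between `m` and `M` almost everywhere on `B_R`. -/
def DensityBetween {d : ℕ} (ν : Measure (Rn d)) (m M R : ℝ) : Prop :=
  ∀ᵐ x ∂((volume : Measure (Rn d)).restrict (ball 0 R)),
    ENNReal.ofReal m ≤ ν.rnDeriv volume x ∧ ν.rnDeriv volume x ≤ ENNReal.ofReal M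

/-- The weight `1 / h''(z)` for `z > 0`, and `0` for `z ≤ 0`.  This is the second derivative of
the convex conjugate of `h` on `[0, ∞)`, at `h'(z)` if `z > 0`; it vanishes off the support of
the plan.  For `h = h_p` it is `z^(2-p) / p` at `z > 0`. -/
def invSecondDeriv (h : ℝ → ℝ) (z : ℝ) : ℝ :=
  if 0 < z then (deriv (deriv h) z)⁻¹ else 0

/-- The map
`T_ε(x) = (∫ (h'')⁻¹(dπ/dP)(x,y) dmu(y))⁻¹ ∫ y (h'')⁻¹(dπ/dP)(x,y) dmu(y)`, with
`P = lam ⊗ mu`.  Like `dπ/dP` it is determined up to a `lam`-null set of `x`. -/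
def transportMean {d : ℕ} (h : ℝ → ℝ) (lam mu : Measure (Rn d)) (π : Measure (Rn d × Rn d))
    (x : Rn d) : Rn d :=
  (∫ y, invSecondDeriv h (planDensity lam mu π (x, y)) ∂mu)⁻¹ •
    ∫ y, invSecondDeriv h (planDensity lam mu π (x, y)) • y ∂mu

/-- The formula for `T_ε(x)` makes sense: both integrals converge and one does not divide by
zero. -/
def TransportMeanWellDefined {d : ℕ} (h : ℝ → ℝ) (lam mu : Measure (Rn d))
    (π : Measure (Rn d × Rn d)) (x : Rn d) : Prop :=
  Integrable (fun y => invSecondDeriv h (planDensity lam mu π (x, y))) mu ∧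
  Integrable (fun y => invSecondDeriv h (planDensity lam mu π (x, y)) • y) mu ∧
  0 < ∫ y, invSecondDeriv h (planDensity lam mu π (x, y)) ∂mu

end

/-! The minimiser enters only through first-order optimality along two-cycles: moving mass from (x,
y), (x', y') to (x, y'), (x', y) cannot lower the cost to first order. For the density z of the
plan, with s = p - 1, this reads z(x,y)^s + z(x',y')^s ≤ z(x,y')^s + z(x',y)^s + b⟨x - x', y - y'⟩
on the support when p > 1 (`IsRegMinimiser.powCycle`); for p = 1 it becomes a multiplicative
identity (`IsRegMinimiser.expCycle`). In units of length ε^(2/(d(p-1)+2)) the constant b no longer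
depends on ε and the radius r becomes C, so every constant comes from a problem at a fixed scale.

Small excess energy places plan mass near the diagonal over each small ball inside B_r. Averaging
the cycle condition against that mass bounds z from above. The bound improves greatly when y is far
from x, since near-diagonal pairs around a point of the segment from x to y make the inner product
very negative (`inner_nearPairs_le`). For p > 1 this confines the plan over B_{r/3} to B_r; for p =
1 it gives an exponential tail (`exists_exp_tail`).

If p = 1, all slices z(x, ·) are exponential tilts of a single one up to constants
(`IsPlanDensity.exp_representation`). The mean is then a quotient of smooth tilted moments, and its
derivative is b times a covariance, which the tail bounds.

If p > 1, put f = z^s. Unit mass of the slices in y makes f Lipschitz in x; unit mass of the slices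
in x makes f concave in y on its support (`IsPlanDensity.pow_lipschitz`,
`IsPlanDensity.pow_concave`). The weight z^(2-p) is f^β with β = 1/s - 1 ≥ 0, which for p = 2 is the
indicator of the support, so Lipschitz continuity of f alone does not control it. Concavity does: a
slight contraction towards a point where f is large carries the union of the supports of f(x₁, ·)
and f(x₂, ·) into either of them, at a cost in volume proportional to |x₁ - x₂|
(`IsProfile.integral_max_sub_le`). Hence the integrals defining T are Lipschitz.

If moreover p < 2, the mass constraint yields ∇ₓf = b(y - T(x)) on the support
(`IsProfile.hasFDerivAt`). Truncating the weight near zero gives C¹ integrals, and the same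
contraction estimate shows that the truncation error is small in Lipschitz norm, so the limits are
C¹. -/

/-! ### First variation of the functional and optimality along two-cycles -/

theorem exists_bounded_density {α : Type*} [MeasurableSpace α] {P ν : Measure α}
    [IsFiniteMeasure P] {c : ℝ≥0∞} (hc : c ≠ ∞) (h : ν ≤ c • P) {S : Set α}
    (hS : MeasurableSet S) (hν : ν Sᶜ = 0) :
    ∃ f : α → ℝ, Measurable f ∧ (∀ x, 0 ≤ f x) ∧ (∀ x, f x ≤ c.toReal) ∧
      (∀ x, x ∉ S → f x = 0) ∧ ν = P.withDensity fun x => ENNReal.ofReal (f x) := by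
  have hac : ν ≪ P := fun s hs => by
    have := h s
    simp only [Measure.smul_apply, hs, smul_zero] at this
    simpa using this
  have hfin : IsFiniteMeasure ν := by
    refine ⟨(h univ).trans_lt ?_⟩
    simp only [Measure.smul_apply, smul_eq_mul]
    exact ENNReal.mul_lt_top hc.lt_top (measure_lt_top P univ)
  have hd := Measure.withDensity_rnDeriv_eq ν P hac
  have hle : ν.rnDeriv P ≤ᵐ[P] fun _ => c := by
    refine ae_le_of_forall_setLIntegral_le_of_sigmaFinite (Measure.measurable_rnDeriv ν P) ?_
    intro s hs _
    rw [← withDensity_apply _ hs, hd]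
    simpa using h s
  -- The derivative is bounded by `c` and supported in `S` only almost everywhere; the minimum and
  -- the indicator make both hold at every point.
  refine ⟨S.indicator fun x => (min (ν.rnDeriv P x) c).toReal, ?_, ?_, ?_, ?_, ?_⟩
  · exact (((Measure.measurable_rnDeriv ν P).min measurable_const).ennreal_toReal).indicator hS
  · exact fun x => indicator_nonneg (fun _ _ => ENNReal.toReal_nonneg) x
  · intro x
    refine indicator_le' (fun _ _ => ?_) (fun _ _ => ENNReal.toReal_nonneg) x
    exact ENNReal.toReal_mono hc (min_le_right _ _)
  · intro x hx; simp [hx]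
  · have hz : ∀ᵐ x ∂P, x ∉ S → ν.rnDeriv P x = 0 := by
      have h0 : ∫⁻ x in Sᶜ, ν.rnDeriv P x ∂P = 0 := by
        rw [← withDensity_apply _ hS.compl, hd, hν]
      rw [lintegral_eq_zero_iff (Measure.measurable_rnDeriv ν P)] at h0
      exact (ae_restrict_iff' hS.compl).1 h0
    nth_rw 1 [← hd]
    refine withDensity_congr_ae ?_
    filter_upwards [hle, hz] with x h1 h2
    by_cases hx : x ∈ S
    · simp only [hx, indicator_of_mem]
      rw [min_eq_left h1, ENNReal.ofReal_toReal (h1.trans_lt hc.lt_top).ne]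
    · simp [hx, h2 hx]

theorem map_pair_prod {d : ℕ} (lam mu : Measure (Rn d)) [IsFiniteMeasure lam]
    [IsFiniteMeasure mu] {f : Rn d × Rn d → Rn d} {g : Rn d × Rn d → Rn d}
    (hf : Measurable f) (hg : Measurable g)
    (hfm : (lam.prod lam).map f = lam univ • lam) (hgm : (mu.prod mu).map g = mu univ • mu) :
    ((lam.prod lam).prod (mu.prod mu)).map (Prod.map f g) =
      (lam univ * mu univ) • lam.prod mu := by
  rw [← Measure.map_prod_map _ _ hf hg, hfm, hgm]
  rw [Measure.prod_smul_left, Measure.prod_smul_right, smul_smul]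

theorem measurable_planDensity {d : ℕ} (lam mu : Measure (Rn d)) (π : Measure (Rn d × Rn d)) :
    Measurable (planDensity lam mu π) :=
  (Measure.measurable_rnDeriv π (lam.prod mu)).ennreal_toReal

theorem planDensity_nonneg {d : ℕ} (lam mu : Measure (Rn d)) (π : Measure (Rn d × Rn d))
    (q : Rn d × Rn d) : 0 ≤ planDensity lam mu π q := ENNReal.toReal_nonneg

theorem IsCoupling.isFiniteMeasure {d : ℕ} {lam mu : Measure (Rn d)} [IsFiniteMeasure lam]
    {π : Measure (Rn d × Rn d)} (h : IsCoupling lam mu π) : IsFiniteMeasure π := by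
  refine ⟨?_⟩
  have : π univ = lam univ := by
    rw [← h.1, Measure.map_apply measurable_fst MeasurableSet.univ, preimage_univ]
  rw [this]; exact measure_lt_top lam univ

theorem withDensity_planDensity {d : ℕ} {lam mu : Measure (Rn d)} [IsFiniteMeasure lam]
    [IsFiniteMeasure mu] {π : Measure (Rn d × Rn d)} [IsFiniteMeasure π]
    (h : π ≪ lam.prod mu) :
    (lam.prod mu).withDensity (fun q => ENNReal.ofReal (planDensity lam mu π q)) = π := by
  nth_rw 2 [← Measure.withDensity_rnDeriv_eq π (lam.prod mu) h]
  refine withDensity_congr_ae ?_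
  filter_upwards [Measure.rnDeriv_lt_top π (lam.prod mu)] with x hx
  exact ENNReal.ofReal_toReal hx.ne

theorem integrable_withDensity_ofReal_iff {α : Type*} [MeasurableSpace α] {P : Measure α}
    {f g : α → ℝ} (hf : Measurable f) (f0 : ∀ x, 0 ≤ f x) :
    Integrable g (P.withDensity fun x => ENNReal.ofReal (f x)) ↔
      Integrable (fun x => f x * g x) P := by
  rw [integrable_withDensity_iff_integrable_smul' hf.ennreal_ofReal
    (Filter.Eventually.of_forall fun _ => ENNReal.ofReal_lt_top)]
  simp only [ENNReal.toReal_ofReal (f0 _), smul_eq_mul]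

theorem integral_withDensity_ofReal {α : Type*} [MeasurableSpace α] {P : Measure α}
    {f g : α → ℝ} (hf : Measurable f) (f0 : ∀ x, 0 ≤ f x) :
    ∫ x, g x ∂(P.withDensity fun x => ENNReal.ofReal (f x)) = ∫ x, f x * g x ∂P := by
  rw [integral_withDensity_eq_integral_toReal_smul hf.ennreal_ofReal
    (Filter.Eventually.of_forall fun _ => ENNReal.ofReal_lt_top)]
  simp only [ENNReal.toReal_ofReal (f0 _), smul_eq_mul]

/-- Convexity bounds the increment of `h` by `h'` at the new point times the displacement, and
uniform continuity of `h'` on a compact interval in (0, ∞) returns to the old point at the price of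
`η`. Mass is removed only where `κ ≤ z`. It may be added where `z = 0`, where `h'` can tend to -∞,
and monotonicity then allows the value at `max z τ` as an upper bound. -/
theorem tangent_perturbation {h h' : ℝ → ℝ}
    (htan : ∀ a, 0 ≤ a → ∀ b, 0 < b → h b - h a ≤ h' b * (b - a))
    (hmono : MonotoneOn h' (Ioi 0)) {z f g t κ τ N δ₀ η : ℝ} (ht : 0 < t) (hκ : 0 < κ)
    (hτ : 0 < τ) (z0 : 0 ≤ z) (f0 : 0 ≤ f) (g0 : 0 ≤ g)
    (hu : ∀ a ∈ Icc (min κ τ / 2) (max N τ + 1), ∀ b ∈ Icc (min κ τ / 2) (max N τ + 1),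
      |a - b| < δ₀ → |h' a - h' b| < η)
    (hfδ : t * f < δ₀) (hgδ : t * g < δ₀) (hf1 : t * f ≤ 1) (hgκ : t * g ≤ κ / 2)
    (hfN : f ≠ 0 → z ≤ N) (hgN : g ≠ 0 → κ ≤ z ∧ z ≤ N) :
    0 ≤ z + t * (f - g) ∧
    h (z + t * (f - g)) - h z ≤ t * (f * (h' (max z τ) + η) - g * (h' z - η)) := by
  have tf0 : 0 ≤ t * f := by positivity
  have tg0 : 0 ≤ t * g := by positivity
  have hmk : min κ τ ≤ κ := min_le_left _ _
  have hmt : min κ τ ≤ τ := min_le_right _ _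
  have hNt : N ≤ max N τ := le_max_left _ _
  have hNt' : τ ≤ max N τ := le_max_right _ _
  have hmp : 0 < min κ τ := lt_min hκ hτ
  rcases eq_or_ne f 0 with hf | hf <;> rcases eq_or_ne g 0 with hg | hg
  · subst hf; subst hg; simp [z0]
  all_goals
    have hz' : 0 < z + t * (f - g) := by
      rcases eq_or_ne g 0 with hg' | hg'
      · first
        | exact absurd hg' hg
        | (have : 0 < t * f := mul_pos ht (lt_of_le_of_ne f0 (Ne.symm hf))
           rw [hg']; nlinarith)
      · have := (hgN hg').1
        nlinarith
    refine ⟨hz'.le, (htan z z0 _ hz').trans ?_⟩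
    have e : h' (z + t * (f - g)) * (z + t * (f - g) - z) =
      t * (f * h' (z + t * (f - g)) - g * h' (z + t * (f - g))) := by ring
    rw [e]
    refine mul_le_mul_of_nonneg_left (sub_le_sub ?_ ?_) ht.le
    · rcases eq_or_ne f 0 with hf' | hf'
      · simp [hf']
      · refine mul_le_mul_of_nonneg_left ?_ f0
        have hzN := hfN hf'
        have hzm : z ≤ max z τ := le_max_left _ _
        have hτm : τ ≤ max z τ := le_max_right _ _
        have hmm : max z τ ≤ max N τ := max_le_max_right _ hzN
        have h1 : h' (z + t * (f - g)) ≤ h' (max z τ + t * f) := by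
          refine hmono hz' (show (0 : ℝ) < _ by linarith) ?_
          nlinarith
        have h2 := hu (max z τ + t * f) ⟨by linarith, by linarith⟩ (max z τ)
          ⟨by linarith, by linarith⟩ (by rw [add_sub_cancel_left, abs_of_nonneg tf0]; exact hfδ)
        linarith [(abs_lt.1 h2).2]
    · rcases eq_or_ne g 0 with hg' | hg'
      · simp [hg']
      · refine mul_le_mul_of_nonneg_left ?_ g0
        obtain ⟨hz1, hz2⟩ := hgN hg'
        have h1 : h' (z - t * g) ≤ h' (z + t * (f - g)) := by
          refine hmono (show (0 : ℝ) < _ by linarith) hz' ?_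
          nlinarith
        have h2 := hu z ⟨by linarith, by linarith⟩ (z - t * g)
          ⟨by linarith, by linarith⟩ (by rw [sub_sub_cancel, abs_of_nonneg tg0]; exact hgδ)
        linarith [(abs_lt.1 h2).2]

/-- Compare π with the plan of density `z + t (f - g)`, a coupling because the perturbations have
equal marginals, and of finite cost because `f`, `g` are bounded and live where cost and density are
at most `N`. Dividing by `t` leaves an error proportional to `η`, which is arbitrary. -/
theorem minimiser_variation {d : ℕ} {h h' : ℝ → ℝ} {ε : ℝ} {lam mu : Measure (Rn d)}
    [IsFiniteMeasure lam] [IsFiniteMeasure mu] {π : Measure (Rn d × Rn d)}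
    (hmin : IsRegMinimiser h ε lam mu π) (hcont : ContinuousOn h (Ici 0)) (hmeas : Measurable h)
    (htan : ∀ a, 0 ≤ a → ∀ b, 0 < b → h b - h a ≤ h' b * (b - a))
    (hmono : MonotoneOn h' (Ioi 0)) (hcont' : ContinuousOn h' (Ioi 0)) (hmeas' : Measurable h')
    {f g : Rn d × Rn d → ℝ} (hf : Measurable f) (hg : Measurable g) (f0 : ∀ q, 0 ≤ f q)
    (g0 : ∀ q, 0 ≤ g q) {B κ N τ : ℝ} (fB : ∀ q, f q ≤ B) (gB : ∀ q, g q ≤ B) (hκ : 0 < κ)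
    (hτ : 0 < τ)
    (fS : ∀ q, f q ≠ 0 → planDensity lam mu π q ≤ N ∧ ‖q.1 - q.2‖ ^ 2 ≤ N)
    (gS : ∀ q, g q ≠ 0 → κ ≤ planDensity lam mu π q ∧ planDensity lam mu π q ≤ N ∧
      ‖q.1 - q.2‖ ^ 2 ≤ N)
    (hfst : ((lam.prod mu).withDensity fun q => ENNReal.ofReal (f q)).map Prod.fst =
      ((lam.prod mu).withDensity fun q => ENNReal.ofReal (g q)).map Prod.fst)
    (hsnd : ((lam.prod mu).withDensity fun q => ENNReal.ofReal (f q)).map Prod.snd =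
      ((lam.prod mu).withDensity fun q => ENNReal.ofReal (g q)).map Prod.snd) :
    Integrable (fun q => g q * (‖q.1 - q.2‖ ^ 2 + ε ^ 2 * h' (planDensity lam mu π q)))
      (lam.prod mu) ∧
    Integrable (fun q => f q * (‖q.1 - q.2‖ ^ 2 + ε ^ 2 * h' (max (planDensity lam mu π q) τ)))
      (lam.prod mu) ∧
    ∫ q, g q * (‖q.1 - q.2‖ ^ 2 + ε ^ 2 * h' (planDensity lam mu π q)) ∂(lam.prod mu) ≤
      ∫ q, f q * (‖q.1 - q.2‖ ^ 2 + ε ^ 2 * h' (max (planDensity lam mu π q) τ))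
        ∂(lam.prod mu) := by
  obtain ⟨hcoup, ⟨hac, hint1, hint2⟩, hle⟩ := hmin
  have := hcoup.isFiniteMeasure
  set z := planDensity lam mu π with hzdef
  set P := lam.prod mu with hP
  have zm : Measurable z := measurable_planDensity lam mu π
  have z0 : ∀ q, 0 ≤ z q := planDensity_nonneg lam mu π
  have hπ := withDensity_planDensity hac
  rw [← hzdef, ← hP] at hπ
  have cm : Measurable fun q : Rn d × Rn d => ‖q.1 - q.2‖ ^ 2 := by fun_prop
  have B0 : 0 ≤ B := (f0 0).trans (fB 0)
  have bdd : ∀ (u w : Rn d × Rn d → ℝ), Measurable u → Measurable w → (∀ q, 0 ≤ u q) →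
      (∀ q, u q ≤ B) → (∃ K, ∀ q, u q ≠ 0 → |w q| ≤ K) →
      Integrable (fun q => u q * w q) P := by
    rintro u w hu hw u0 uB ⟨K, hK⟩
    refine Integrable.of_bound (hu.mul hw).aestronglyMeasurable (B * |K|)
      (Filter.Eventually.of_forall fun q => ?_)
    rcases eq_or_ne (u q) 0 with h0 | h0
    · simp only [h0, zero_mul, norm_zero]; positivity
    · rw [Real.norm_eq_abs, abs_mul, abs_of_nonneg (u0 q)]
      exact mul_le_mul (uB q) ((hK q h0).trans (le_abs_self K)) (abs_nonneg _) B0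
  have absle : ∀ a b x : ℝ, a ≤ x → x ≤ b → |x| ≤ max |a| |b| := fun a b x h1 h2 =>
    abs_le_max_abs_abs h1 h2
  have if1 : Integrable f P := by
    simpa using bdd f (fun _ => 1) hf measurable_const f0 fB ⟨1, by simp⟩
  have ig1 : Integrable g P := by
    simpa using bdd g (fun _ => 1) hg measurable_const g0 gB ⟨1, by simp⟩
  have ifc : Integrable (fun q => f q * ‖q.1 - q.2‖ ^ 2) P :=
    bdd f _ hf cm f0 fB ⟨N, fun q hq => by rw [abs_of_nonneg (by positivity)]; exact (fS q hq).2⟩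
  have igc : Integrable (fun q => g q * ‖q.1 - q.2‖ ^ 2) P :=
    bdd g _ hg cm g0 gB ⟨N, fun q hq => by rw [abs_of_nonneg (by positivity)]; exact (gS q hq).2.2⟩
  have ifh : Integrable (fun q => f q * h' (max (z q) τ)) P := by
    refine bdd f _ hf (hmeas'.comp (zm.max measurable_const)) f0 fB
      ⟨max |h' τ| |h' (max N τ)|, fun q hq => absle _ _ _ ?_ ?_⟩
    · exact hmono hτ (lt_max_of_lt_right hτ) (le_max_right _ _)
    · exact hmono (lt_max_of_lt_right hτ) (lt_max_of_lt_right hτ)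
        (max_le_max_right _ (fS q hq).1)
  have igh : Integrable (fun q => g q * h' (z q)) P := by
    refine bdd g _ hg (hmeas'.comp zm) g0 gB
      ⟨max |h' κ| |h' N|, fun q hq => absle _ _ _ ?_ ?_⟩
    · exact hmono hκ (hκ.trans_le (gS q hq).1) (gS q hq).1
    · exact hmono (hκ.trans_le (gS q hq).1) (hκ.trans_le ((gS q hq).1.trans (gS q hq).2.1))
        (gS q hq).2.1
  have eF : (fun q => f q * (‖q.1 - q.2‖ ^ 2 + ε ^ 2 * h' (max (z q) τ))) =
      fun q => f q * ‖q.1 - q.2‖ ^ 2 + ε ^ 2 * (f q * h' (max (z q) τ)) := by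
    funext q; ring
  have eG : (fun q => g q * (‖q.1 - q.2‖ ^ 2 + ε ^ 2 * h' (z q))) =
      fun q => g q * ‖q.1 - q.2‖ ^ 2 + ε ^ 2 * (g q * h' (z q)) := by
    funext q; ring
  rw [eF, eG]
  refine ⟨igc.add (igh.const_mul _), ifc.add (ifh.const_mul _), ?_⟩
  rw [integral_add igc (igh.const_mul _), integral_add ifc (ifh.const_mul _),
    integral_const_mul, integral_const_mul]
  have key : ∀ η > 0, ∫ q, g q * ‖q.1 - q.2‖ ^ 2 ∂P + ε ^ 2 * ∫ q, g q * h' (z q) ∂P ≤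
      ∫ q, f q * ‖q.1 - q.2‖ ^ 2 ∂P + ε ^ 2 * ∫ q, f q * h' (max (z q) τ) ∂P
        + η * (ε ^ 2 * (∫ q, f q ∂P + ∫ q, g q ∂P)) := by
    intro η hη
    obtain ⟨δ₀, hδ₀, hu⟩ := Metric.uniformContinuousOn_iff.1
      ((isCompact_Icc (a := min κ τ / 2) (b := max N τ + 1)).uniformContinuousOn_of_continuous
        (hcont'.mono fun x hx => lt_of_lt_of_le (half_pos (lt_min hκ hτ)) hx.1)) η hη
    obtain ⟨t, ht, htB1, htB2, htB3⟩ : ∃ t : ℝ, 0 < t ∧ t * B < δ₀ ∧ t * B ≤ 1 ∧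
        t * B ≤ κ / 2 := by
      -- The three bounds serve uniform continuity, a bounded range for the new density, and its
      -- positivity. Halving `δ₀` makes the first strict, and `B + 1` avoids division by zero.
      refine ⟨min (δ₀ / 2) (min 1 (κ / 2)) / (B + 1), by positivity, ?_⟩
      have : min (δ₀ / 2) (min 1 (κ / 2)) / (B + 1) * B ≤ min (δ₀ / 2) (min 1 (κ / 2)) := by
        rw [div_mul_eq_mul_div, div_le_iff₀ (by positivity)]
        have : 0 < min (δ₀ / 2) (min 1 (κ / 2)) := by positivity
        nlinarith
      refine ⟨this.trans_lt ?_, this.trans ?_, this.trans ?_⟩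
      · exact (min_le_left _ _).trans_lt (by linarith)
      · exact (min_le_right _ _).trans (min_le_left _ _)
      · exact (min_le_right _ _).trans (min_le_right _ _)
    have tf : ∀ q, t * f q ≤ t * B := fun q => mul_le_mul_of_nonneg_left (fB q) ht.le
    have tg : ∀ q, t * g q ≤ t * B := fun q => mul_le_mul_of_nonneg_left (gB q) ht.le
    have pw := fun q => tangent_perturbation htan hmono (z := z q) (f := f q) (g := g q) ht hκ hτ
      (z0 q) (f0 q) (g0 q) (N := N) (δ₀ := δ₀) (η := η)
      (fun a ha b hb hab => by
        have := hu a ha b hb (by rwa [Real.dist_eq]); rwa [Real.dist_eq] at this)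
      ((tf q).trans_lt htB1) ((tg q).trans_lt htB1) ((tf q).trans htB2) ((tg q).trans htB3)
      (fun hq => (fS q hq).1) (fun hq => ⟨(gS q hq).1, (gS q hq).2.1⟩)
    set z' : Rn d × Rn d → ℝ := fun q => z q + t * (f q - g q) with hz'
    have zm' : Measurable z' := zm.add ((hf.sub hg).const_mul t)
    have z0' : ∀ q, 0 ≤ z' q := fun q => (pw q).1
    set π' := P.withDensity fun q => ENNReal.ofReal (z' q) with hπ'
    set νf := P.withDensity fun q => ENNReal.ofReal (f q) with hνf
    set νg := P.withDensity fun q => ENNReal.ofReal (g q) with hνg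
    have wadd : ∀ u : Rn d × Rn d → ℝ, ∀ w : Rn d × Rn d → ℝ, Measurable u → Measurable w →
        (∀ q, 0 ≤ u q) → (∀ q, 0 ≤ w q) →
        P.withDensity (fun q => ENNReal.ofReal (u q)) +
          ENNReal.ofReal t • P.withDensity (fun q => ENNReal.ofReal (w q)) =
        P.withDensity (fun q => ENNReal.ofReal (u q + t * w q)) := by
      intro u w hu hw u0 w0
      rw [← withDensity_smul _ hw.ennreal_ofReal, ← withDensity_add_left hu.ennreal_ofReal]
      congr 1
      funext q
      simp only [Pi.add_apply, Pi.smul_apply, smul_eq_mul]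
      rw [ENNReal.ofReal_add (u0 q) (mul_nonneg ht.le (w0 q)), ENNReal.ofReal_mul ht.le]
    -- The perturbation in additive form, so that no measures are subtracted; equal finite terms are
    -- then cancelled in the marginals.
    have hbal : π' + ENNReal.ofReal t • νg = π + ENNReal.ofReal t • νf := by
      rw [← hπ, wadd _ _ zm' hg z0' g0, wadd _ _ zm hf z0 f0]
      congr 1; funext q; simp only [hz']; congr 1; ring
    have : IsFiniteMeasure νg := by
      refine ⟨?_⟩
      rw [hνg, withDensity_apply _ MeasurableSet.univ, Measure.restrict_univ]
      exact ig1.lintegral_lt_top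
    have marg : ∀ F : Rn d × Rn d → Rn d, Measurable F → νf.map F = νg.map F →
        π'.map F = π.map F := by
      intro F hF hFe
      have h1 : (π' + ENNReal.ofReal t • νg).map F = (π + ENNReal.ofReal t • νf).map F := by
        rw [hbal]
      rw [Measure.map_add _ _ hF, Measure.map_add _ _ hF, Measure.map_smul, Measure.map_smul,
        hFe] at h1
      ext s hs
      have h2 := congrArg (fun m => m s) h1
      simp only [Measure.add_apply, Measure.smul_apply, smul_eq_mul] at h2
      exact (ENNReal.add_left_inj (ENNReal.mul_ne_top ENNReal.ofReal_ne_top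
        (measure_ne_top _ _))).1 h2
    have hcoup' : IsCoupling lam mu π' :=
      ⟨(marg _ measurable_fst hfst).trans hcoup.1, (marg _ measurable_snd hsnd).trans hcoup.2⟩
    have hz'e : planDensity lam mu π' =ᵐ[P] z' := by
      filter_upwards [Measure.rnDeriv_withDensity P zm'.ennreal_ofReal] with q hq
      rw [planDensity, hq, ENNReal.toReal_ofReal (z0' q)]
    have izc : Integrable (fun q => z q * ‖q.1 - q.2‖ ^ 2) P := by
      rw [← integrable_withDensity_ofReal_iff zm z0, hπ]; exact hint1
    have izc' : Integrable (fun q => z' q * ‖q.1 - q.2‖ ^ 2) P := by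
      have : (fun q => z' q * ‖q.1 - q.2‖ ^ 2) = fun q => z q * ‖q.1 - q.2‖ ^ 2 +
          t * (f q * ‖q.1 - q.2‖ ^ 2 - g q * ‖q.1 - q.2‖ ^ 2) := by
        funext q; simp only [hz']; ring
      rw [this]
      exact izc.add ((ifc.sub igc).const_mul t)
    obtain ⟨H, hH⟩ : ∃ H, ∀ a ∈ Icc (0 : ℝ) (N + 1), |h a| ≤ H := by
      obtain ⟨H, hH⟩ := (isCompact_Icc (a := (0 : ℝ)) (b := N + 1)).exists_bound_of_continuousOn
        (hcont.mono fun x hx => hx.1)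
      exact ⟨H, hH⟩
    have ihd : Integrable (fun q => h (z' q) - h (z q)) P := by
      refine Integrable.of_bound ((hmeas.comp zm').sub (hmeas.comp zm)).aestronglyMeasurable
        (|H| + |H|) (Filter.Eventually.of_forall fun q => ?_)
      by_cases hq : f q = 0 ∧ g q = 0
      · simp only [hz', hq.1, hq.2, sub_self, mul_zero, add_zero, norm_zero]; positivity
      · have hzN : z q ≤ N := by
          rcases not_and_or.1 hq with hq | hq
          · exact (fS q hq).1
          · exact (gS q hq).2.1
        have h1 := hH (z q) ⟨z0 q, by linarith⟩
        have h2 := hH (z' q) ⟨z0' q, by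
          have := (tf q).trans htB2
          have := mul_nonneg ht.le (g0 q)
          simp only [hz']; linarith⟩
        rw [Real.norm_eq_abs]
        exact (abs_sub _ _).trans (add_le_add (h2.trans (le_abs_self _)) (h1.trans (le_abs_self _)))
    have ihz' : Integrable (fun q => h (z' q)) P := by
      have : (fun q => h (z' q)) = fun q => h (z q) + (h (z' q) - h (z q)) := by funext q; ring
      rw [this]; exact hint2.add ihd
    have hfc : HasFiniteCost h lam mu π' := by
      refine ⟨withDensity_absolutelyContinuous _ _, ?_, ?_⟩
      · exact (integrable_withDensity_ofReal_iff zm' z0').2 izc'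
      · exact ihz'.congr (hz'e.mono fun q hq => by simp only [hq])
    have hJ := hle π' hcoup' hfc
    have e1 : ∫ q, ‖q.1 - q.2‖ ^ 2 ∂π = ∫ q, z q * ‖q.1 - q.2‖ ^ 2 ∂P := by
      rw [← integral_withDensity_ofReal zm z0, hπ]
    have e2 : ∫ q, ‖q.1 - q.2‖ ^ 2 ∂π' = ∫ q, z q * ‖q.1 - q.2‖ ^ 2 ∂P +
        t * (∫ q, f q * ‖q.1 - q.2‖ ^ 2 ∂P - ∫ q, g q * ‖q.1 - q.2‖ ^ 2 ∂P) := by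
      have i1 : Integrable (fun q => f q * ‖q.1 - q.2‖ ^ 2 - g q * ‖q.1 - q.2‖ ^ 2) P :=
        ifc.sub igc
      rw [hπ', integral_withDensity_ofReal zm' z0', ← integral_sub ifc igc, ← integral_const_mul,
        ← integral_add izc (i1.const_mul t)]
      refine integral_congr_ae (Filter.Eventually.of_forall fun q => ?_)
      simp only [hz']; ring
    have e3 : ∫ q, h (planDensity lam mu π' q) ∂P = ∫ q, h (z' q) ∂P :=
      integral_congr_ae (hz'e.mono fun q hq => by simp only [hq])
    have e4 : ∫ q, h (z' q) ∂P = ∫ q, h (z q) ∂P + ∫ q, (h (z' q) - h (z q)) ∂P := by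
      rw [integral_sub ihz' hint2]; ring
    have e5 : ∫ q, (h (z' q) - h (z q)) ∂P ≤ t * ((∫ q, f q * h' (max (z q) τ) ∂P +
        η * ∫ q, f q ∂P) - (∫ q, g q * h' (z q) ∂P - η * ∫ q, g q ∂P)) := by
      have i1 : Integrable (fun q => f q * h' (max (z q) τ) + η * f q) P :=
        ifh.add (if1.const_mul η)
      have i2 : Integrable (fun q => g q * h' (z q) - η * g q) P := igh.sub (ig1.const_mul η)
      rw [← integral_const_mul η, ← integral_const_mul η, ← integral_add ifh (if1.const_mul η),
        ← integral_sub igh (ig1.const_mul η), ← integral_sub i1 i2, ← integral_const_mul]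
      refine integral_mono ihd ((i1.sub i2).const_mul t) fun q => ?_
      refine (pw q).2.trans (le_of_eq ?_)
      ring
    simp only [regCost] at hJ
    rw [e1, e2, e3, e4] at hJ
    have h6 := mul_le_mul_of_nonneg_left e5 (sq_nonneg ε)
    refine le_of_mul_le_mul_left (a := t) ?_ ht
    nlinarith
  refine le_of_forall_pos_le_add fun η hη => ?_
  set I := ε ^ 2 * (∫ q, f q ∂P + ∫ q, g q ∂P) with hI
  have hI0 : 0 ≤ I := mul_nonneg (sq_nonneg _)
    (add_nonneg (integral_nonneg f0) (integral_nonneg g0))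
  refine (key (η / (I + 1)) (by positivity)).trans ?_
  have : η / (I + 1) * I ≤ η := by
    rw [div_mul_eq_mul_div, div_le_iff₀ (by positivity)]; nlinarith
  linarith

/-- Restrict the product measure on quadruples to `Q` and push it forward to the two direct pairs
and to the two crossed pairs. The direct images are removed and the crossed ones added, which
preserves both marginals. Optimality makes the integral over `Q` of direct minus crossed cost
nonpositive, although the integrand is positive there. -/
theorem two_cycle_null {d : ℕ} {h h' : ℝ → ℝ} {ε : ℝ} {lam mu : Measure (Rn d)}
    [IsFiniteMeasure lam] [IsFiniteMeasure mu] {π : Measure (Rn d × Rn d)}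
    (hmin : IsRegMinimiser h ε lam mu π) (hcont : ContinuousOn h (Ici 0)) (hmeas : Measurable h)
    (htan : ∀ a, 0 ≤ a → ∀ b, 0 < b → h b - h a ≤ h' b * (b - a))
    (hmono : MonotoneOn h' (Ioi 0)) (hcont' : ContinuousOn h' (Ioi 0)) (hmeas' : Measurable h')
    {κ N τ : ℝ} (hκ : 0 < κ) (hτ : 0 < τ) {Q : Set ((Rn d × Rn d) × (Rn d × Rn d))}
    (hQ : MeasurableSet Q)
    (h00 : ∀ q ∈ Q, κ ≤ planDensity lam mu π (q.1.1, q.2.1) ∧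
      planDensity lam mu π (q.1.1, q.2.1) ≤ N ∧ ‖q.1.1 - q.2.1‖ ^ 2 ≤ N)
    (h11 : ∀ q ∈ Q, κ ≤ planDensity lam mu π (q.1.2, q.2.2) ∧
      planDensity lam mu π (q.1.2, q.2.2) ≤ N ∧ ‖q.1.2 - q.2.2‖ ^ 2 ≤ N)
    (h01 : ∀ q ∈ Q, planDensity lam mu π (q.1.1, q.2.2) ≤ N ∧ ‖q.1.1 - q.2.2‖ ^ 2 ≤ N)
    (h10 : ∀ q ∈ Q, planDensity lam mu π (q.1.2, q.2.1) ≤ N ∧ ‖q.1.2 - q.2.1‖ ^ 2 ≤ N)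
    (hlt : ∀ q ∈ Q,
      (‖q.1.1 - q.2.2‖ ^ 2 + ε ^ 2 * h' (max (planDensity lam mu π (q.1.1, q.2.2)) τ)) +
      (‖q.1.2 - q.2.1‖ ^ 2 + ε ^ 2 * h' (max (planDensity lam mu π (q.1.2, q.2.1)) τ)) <
      (‖q.1.1 - q.2.1‖ ^ 2 + ε ^ 2 * h' (planDensity lam mu π (q.1.1, q.2.1))) +
      (‖q.1.2 - q.2.2‖ ^ 2 + ε ^ 2 * h' (planDensity lam mu π (q.1.2, q.2.2)))) :
    ((lam.prod lam).prod (mu.prod mu)) Q = 0 := by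
  set z := planDensity lam mu π with hz
  have zm : Measurable z := measurable_planDensity lam mu π
  set Λ := (lam.prod lam).prod (mu.prod mu) with hΛ
  set P := lam.prod mu with hP
  set Θ := Λ.restrict Q with hΘ
  set c : ℝ≥0∞ := lam univ * mu univ with hc
  have hcfin : c ≠ ∞ := ENNReal.mul_ne_top (measure_ne_top _ _) (measure_ne_top _ _)
  have cm : Measurable fun q : Rn d × Rn d => ‖q.1 - q.2‖ ^ 2 := by fun_prop
  have dens : ∀ F G : Rn d × Rn d → Rn d, Measurable F → Measurable G →
      (lam.prod lam).map F = lam univ • lam → (mu.prod mu).map G = mu univ • mu →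
      ∀ S : Set (Rn d × Rn d), MeasurableSet S → (∀ q ∈ Q, (F q.1, G q.2) ∈ S) →
      ∃ f : Rn d × Rn d → ℝ, Measurable f ∧ (∀ x, 0 ≤ f x) ∧ (∀ x, f x ≤ c.toReal) ∧
      (∀ x, x ∉ S → f x = 0) ∧
      Θ.map (Prod.map F G) = P.withDensity fun x => ENNReal.ofReal (f x) := by
    intro F G hF hG hFm hGm S hS hQS
    have hFG : Measurable (Prod.map F G) := hF.prodMap hG
    refine exists_bounded_density hcfin ?_ hS ?_
    · rw [← map_pair_prod lam mu hF hG hFm hGm]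
      exact Measure.map_mono Measure.restrict_le_self hFG
    · rw [Measure.map_apply hFG hS.compl, Measure.restrict_apply (hFG hS.compl)]
      convert measure_empty (μ := Λ)
      ext q
      simp only [mem_inter_iff, mem_preimage, mem_compl_iff, mem_empty_iff_false, iff_false,
        not_and]
      intro h1 h2
      exact h1 (hQS q h2)
  have l1 := Measure.map_fst_prod (μ := lam) (ν := lam)
  have l2 := Measure.map_snd_prod (μ := lam) (ν := lam)
  have m1 := Measure.map_fst_prod (μ := mu) (ν := mu)
  have m2 := Measure.map_snd_prod (μ := mu) (ν := mu)
  have hSf : MeasurableSet {q : Rn d × Rn d | z q ≤ N ∧ ‖q.1 - q.2‖ ^ 2 ≤ N} :=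
    (measurableSet_le zm measurable_const).inter (measurableSet_le cm measurable_const)
  have hSg : MeasurableSet {q : Rn d × Rn d | κ ≤ z q ∧ z q ≤ N ∧ ‖q.1 - q.2‖ ^ 2 ≤ N} :=
    (measurableSet_le measurable_const zm).inter hSf
  obtain ⟨f1, f1m, f10, f1c, f1S, f1e⟩ := dens _ _ measurable_fst measurable_snd l1 m2 _ hSf h01
  obtain ⟨f2, f2m, f20, f2c, f2S, f2e⟩ := dens _ _ measurable_snd measurable_fst l2 m1 _ hSf h10
  obtain ⟨g1, g1m, g10, g1c, g1S, g1e⟩ := dens _ _ measurable_fst measurable_fst l1 m1 _ hSg h00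
  obtain ⟨g2, g2m, g20, g2c, g2S, g2e⟩ := dens _ _ measurable_snd measurable_snd l2 m2 _ hSg h11
  have wadd : ∀ u w : Rn d × Rn d → ℝ, Measurable u → (∀ q, 0 ≤ u q) → (∀ q, 0 ≤ w q) →
      P.withDensity (fun q => ENNReal.ofReal ((u + w) q)) =
      P.withDensity (fun q => ENNReal.ofReal (u q)) +
        P.withDensity (fun q => ENNReal.ofReal (w q)) := by
    intro u w hu u0 w0
    rw [← withDensity_add_left hu.ennreal_ofReal]
    congr 1
    funext q
    simp only [Pi.add_apply]
    rw [ENNReal.ofReal_add (u0 q) (w0 q)]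
  have wf := wadd f1 f2 f1m f10 f20
  have wg := wadd g1 g2 g1m g10 g20
  rw [← f1e, ← f2e] at wf
  rw [← g1e, ← g2e] at wg
  have mm := fun (F G : Rn d × Rn d → Rn d) (hF : Measurable F) (hG : Measurable G) =>
    Measure.map_map (μ := Θ) (measurable_fst (α := Rn d) (β := Rn d)) (hF.prodMap hG)
  have mm' := fun (F G : Rn d × Rn d → Rn d) (hF : Measurable F) (hG : Measurable G) =>
    Measure.map_map (μ := Θ) (measurable_snd (α := Rn d) (β := Rn d)) (hF.prodMap hG)
  have hmain := minimiser_variation hmin hcont hmeas htan hmono hcont' hmeas' (f := f1 + f2)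
    (g := g1 + g2) (f1m.add f2m) (g1m.add g2m) (fun q => add_nonneg (f10 q) (f20 q))
    (fun q => add_nonneg (g10 q) (g20 q)) (B := c.toReal + c.toReal)
    (fun q => add_le_add (f1c q) (f2c q)) (fun q => add_le_add (g1c q) (g2c q)) hκ hτ (N := N)
    (fun q hq => by
      by_contra hS
      exact hq (by simp only [Pi.add_apply]; rw [f1S q hS, f2S q hS, add_zero]))
    (fun q hq => by
      by_contra hS
      exact hq (by simp only [Pi.add_apply]; rw [g1S q hS, g2S q hS, add_zero]))
    (by
      rw [wf, wg, Measure.map_add _ _ measurable_fst, Measure.map_add _ _ measurable_fst,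
        mm _ _ measurable_fst measurable_snd, mm _ _ measurable_snd measurable_fst,
        mm _ _ measurable_fst measurable_fst, mm _ _ measurable_snd measurable_snd]
      rfl)
    (by
      rw [wf, wg, Measure.map_add _ _ measurable_snd, Measure.map_add _ _ measurable_snd,
        mm' _ _ measurable_fst measurable_snd, mm' _ _ measurable_snd measurable_fst,
        mm' _ _ measurable_fst measurable_fst, mm' _ _ measurable_snd measurable_snd, add_comm]
      rfl)
  obtain ⟨ig, iff', hle⟩ := hmain
  have hf0 : ∀ q, 0 ≤ (f1 + f2) q := fun q => add_nonneg (f10 q) (f20 q)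
  have hg0 : ∀ q, 0 ≤ (g1 + g2) q := fun q => add_nonneg (g10 q) (g20 q)
  rw [← integrable_withDensity_ofReal_iff (g1m.add g2m) hg0, wg, integrable_add_measure] at ig
  rw [← integrable_withDensity_ofReal_iff (f1m.add f2m) hf0, wf, integrable_add_measure] at iff'
  rw [← integral_withDensity_ofReal (g1m.add g2m) hg0, wg, integral_add_measure ig.1 ig.2,
    ← integral_withDensity_ofReal (f1m.add f2m) hf0, wf, integral_add_measure iff'.1 iff'.2] at hle
  have wm1 : Measurable fun q : Rn d × Rn d => ‖q.1 - q.2‖ ^ 2 + ε ^ 2 * h' (z q) :=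
    cm.add ((hmeas'.comp zm).const_mul _)
  have wm2 : Measurable fun q : Rn d × Rn d => ‖q.1 - q.2‖ ^ 2 + ε ^ 2 * h' (max (z q) τ) :=
    cm.add ((hmeas'.comp (zm.max measurable_const)).const_mul _)
  have me := fun (F G : Rn d × Rn d → Rn d) (hF : Measurable F) (hG : Measurable G)
    (w : Rn d × Rn d → ℝ) (hw : Measurable w) =>
    show ∫ y, w y ∂(Θ.map (Prod.map F G)) = ∫ x, (w ∘ Prod.map F G) x ∂Θ from
    integral_map (μ := Θ) (hF.prodMap hG).aemeasurable hw.aestronglyMeasurable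
  have mi := fun (F G : Rn d × Rn d → Rn d) (hF : Measurable F) (hG : Measurable G)
    (w : Rn d × Rn d → ℝ) (hw : Measurable w) =>
    integrable_map_measure (μ := Θ) hw.aestronglyMeasurable (hF.prodMap hG).aemeasurable
  rw [me _ _ measurable_fst measurable_snd _ wm2, me _ _ measurable_snd measurable_fst _ wm2,
    me _ _ measurable_fst measurable_fst _ wm1, me _ _ measurable_snd measurable_snd _ wm1] at hle
  rw [mi _ _ measurable_fst measurable_snd _ wm2, mi _ _ measurable_snd measurable_fst _ wm2]
    at iff'
  rw [mi _ _ measurable_fst measurable_fst _ wm1, mi _ _ measurable_snd measurable_snd _ wm1] at ig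
  rw [← integral_add' ig.1 ig.2, ← integral_add' iff'.1 iff'.2, ← sub_nonpos,
    ← integral_sub' (ig.1.add ig.2) (iff'.1.add iff'.2)] at hle
  have hpos : ∀ᵐ q ∂Θ, 0 < (((fun q : Rn d × Rn d => ‖q.1 - q.2‖ ^ 2 + ε ^ 2 * h' (z q)) ∘
      Prod.map Prod.fst Prod.fst + (fun q : Rn d × Rn d => ‖q.1 - q.2‖ ^ 2 + ε ^ 2 * h' (z q)) ∘
      Prod.map Prod.snd Prod.snd) -
      ((fun q : Rn d × Rn d => ‖q.1 - q.2‖ ^ 2 + ε ^ 2 * h' (max (z q) τ)) ∘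
      Prod.map Prod.fst Prod.snd +
      (fun q : Rn d × Rn d => ‖q.1 - q.2‖ ^ 2 + ε ^ 2 * h' (max (z q) τ)) ∘
      Prod.map Prod.snd Prod.fst) : (Rn d × Rn d) × (Rn d × Rn d) → ℝ) q := by
    refine (ae_restrict_iff' hQ).2 (Filter.Eventually.of_forall fun q hq => ?_)
    have := hlt q hq
    simp only [Pi.sub_apply, Pi.add_apply, Function.comp, Prod.map]
    linarith
  have hzero := (integral_eq_zero_iff_of_nonneg_ae (hpos.mono fun q hq => hq.le)
    ((ig.1.add ig.2).sub (iff'.1.add iff'.2))).1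
    (le_antisymm hle (integral_nonneg_of_ae (hpos.mono fun q hq => hq.le)))
  have hfalse : ∀ᵐ q ∂Θ, False := by
    filter_upwards [hzero, hpos] with q h1 h2
    rw [h1] at h2
    exact lt_irrefl _ h2
  rw [Filter.eventually_false_iff_eq_bot, ae_eq_bot, hΘ, Measure.restrict_eq_zero] at hfalse
  exact hfalse

/-- The violating quadruples are a countable union of sets on which costs and densities are at most
n + 1 and the direct densities are at least 1/(n + 1); each is null by `two_cycle_null`. -/
theorem truncated_two_cycle {d : ℕ} {h h' : ℝ → ℝ} {ε : ℝ} {lam mu : Measure (Rn d)}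
    [IsFiniteMeasure lam] [IsFiniteMeasure mu] {π : Measure (Rn d × Rn d)}
    (hmin : IsRegMinimiser h ε lam mu π) (hcont : ContinuousOn h (Ici 0)) (hmeas : Measurable h)
    (htan : ∀ a, 0 ≤ a → ∀ b, 0 < b → h b - h a ≤ h' b * (b - a))
    (hmono : MonotoneOn h' (Ioi 0)) (hcont' : ContinuousOn h' (Ioi 0)) (hmeas' : Measurable h')
    {τ : ℝ} (hτ : 0 < τ) :
    ∀ᵐ q ∂((lam.prod lam).prod (mu.prod mu)),
      0 < planDensity lam mu π (q.1.1, q.2.1) → 0 < planDensity lam mu π (q.1.2, q.2.2) →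
      (‖q.1.1 - q.2.1‖ ^ 2 + ε ^ 2 * h' (planDensity lam mu π (q.1.1, q.2.1))) +
      (‖q.1.2 - q.2.2‖ ^ 2 + ε ^ 2 * h' (planDensity lam mu π (q.1.2, q.2.2))) ≤
      (‖q.1.1 - q.2.2‖ ^ 2 + ε ^ 2 * h' (max (planDensity lam mu π (q.1.1, q.2.2)) τ)) +
      (‖q.1.2 - q.2.1‖ ^ 2 + ε ^ 2 * h' (max (planDensity lam mu π (q.1.2, q.2.1)) τ)) := by
  set z := planDensity lam mu π with hz
  have zm : Measurable z := measurable_planDensity lam mu π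
  let w : ℕ → Set (Rn d × Rn d) := fun n =>
    {q | ((n : ℝ) + 1)⁻¹ ≤ z q ∧ z q ≤ (n : ℝ) + 1 ∧ ‖q.1 - q.2‖ ^ 2 ≤ (n : ℝ) + 1}
  let w' : ℕ → Set (Rn d × Rn d) := fun n => {q | z q ≤ (n : ℝ) + 1 ∧ ‖q.1 - q.2‖ ^ 2 ≤ (n : ℝ) + 1}
  have cm : Measurable fun q : Rn d × Rn d => ‖q.1 - q.2‖ ^ 2 := by fun_prop
  have wm' : ∀ n, MeasurableSet (w' n) := fun n =>
    (measurableSet_le zm measurable_const).inter (measurableSet_le cm measurable_const)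
  have wm : ∀ n, MeasurableSet (w n) := fun n =>
    (measurableSet_le measurable_const zm).inter (wm' n)
  let F : Rn d × Rn d → ℝ := fun q => ‖q.1 - q.2‖ ^ 2 + ε ^ 2 * h' (z q)
  let F' : Rn d × Rn d → ℝ := fun q => ‖q.1 - q.2‖ ^ 2 + ε ^ 2 * h' (max (z q) τ)
  have Fm : Measurable F := cm.add ((hmeas'.comp zm).const_mul _)
  have Fm' : Measurable F' := cm.add ((hmeas'.comp (zm.max measurable_const)).const_mul _)
  have p00 : Measurable fun q : (Rn d × Rn d) × (Rn d × Rn d) => (q.1.1, q.2.1) := by fun_prop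
  have p11 : Measurable fun q : (Rn d × Rn d) × (Rn d × Rn d) => (q.1.2, q.2.2) := by fun_prop
  have p01 : Measurable fun q : (Rn d × Rn d) × (Rn d × Rn d) => (q.1.1, q.2.2) := by fun_prop
  have p10 : Measurable fun q : (Rn d × Rn d) × (Rn d × Rn d) => (q.1.2, q.2.1) := by fun_prop
  let Q : ℕ → Set ((Rn d × Rn d) × (Rn d × Rn d)) := fun n =>
    {q | (q.1.1, q.2.1) ∈ w n} ∩ {q | (q.1.2, q.2.2) ∈ w n} ∩ {q | (q.1.1, q.2.2) ∈ w' n} ∩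
    {q | (q.1.2, q.2.1) ∈ w' n} ∩
    {q | F' (q.1.1, q.2.2) + F' (q.1.2, q.2.1) < F (q.1.1, q.2.1) + F (q.1.2, q.2.2)}
  have Qm : ∀ n, MeasurableSet (Q n) := fun n =>
    ((((p00 (wm n)).inter (p11 (wm n))).inter (p01 (wm' n))).inter (p10 (wm' n))).inter
      (measurableSet_lt ((Fm'.comp p01).add (Fm'.comp p10)) ((Fm.comp p00).add (Fm.comp p11)))
  have Q0 : ∀ n, ((lam.prod lam).prod (mu.prod mu)) (Q n) = 0 := fun n =>
    two_cycle_null hmin hcont hmeas htan hmono hcont' hmeas' (κ := ((n : ℝ) + 1)⁻¹)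
      (N := (n : ℝ) + 1) (by positivity) hτ (Qm n) (fun q hq => hq.1.1.1.1)
      (fun q hq => hq.1.1.1.2) (fun q hq => hq.1.1.2) (fun q hq => hq.1.2) (fun q hq => hq.2)
  rw [ae_iff]
  refine measure_mono_null (fun q hq => ?_) (measure_iUnion_null Q0)
  simp only [mem_ofPred_eq, Classical.not_imp, not_le] at hq
  obtain ⟨h0, h1, hlt⟩ := hq
  have big : ∀ a : ℝ, ∀ᶠ n : ℕ in Filter.atTop, a ≤ (n : ℝ) + 1 := fun a =>
    (Filter.tendsto_atTop_add_const_right _ 1 tendsto_natCast_atTop_atTop).eventually_ge_atTop a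
  have small : ∀ a : ℝ, 0 < a → ∀ᶠ n : ℕ in Filter.atTop, ((n : ℝ) + 1)⁻¹ ≤ a := fun a ha => by
    filter_upwards [big a⁻¹] with n hn
    exact inv_le_of_inv_le₀ ha hn
  obtain ⟨n, h2, h3, h4, h5, h6, h7, h8, h9, h10, h11⟩ :=
    ((small _ h0).and <| (big (z (q.1.1, q.2.1))).and <| (big (‖q.1.1 - q.2.1‖ ^ 2)).and <|
    (small _ h1).and <| (big (z (q.1.2, q.2.2))).and <| (big (‖q.1.2 - q.2.2‖ ^ 2)).and <|
    (big (z (q.1.1, q.2.2))).and <| (big (‖q.1.1 - q.2.2‖ ^ 2)).and <|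
    (big (z (q.1.2, q.2.1))).and <| (big (‖q.1.2 - q.2.1‖ ^ 2))).exists
  exact mem_iUnion.2 ⟨n, ⟨⟨⟨⟨h2, h3, h4⟩, ⟨h5, h6, h7⟩⟩, ⟨h8, h9⟩⟩, ⟨h10, h11⟩⟩, hlt⟩

/-! ### Cycle conditions in power and exponential form -/

/-- First-order optimality of a plan with density `z` along two-cycles, in power form. -/
def PowCycle {d : ℕ} (s b : ℝ) (lam mu : Measure (Rn d)) (z : Rn d × Rn d → ℝ) : Prop :=
  ∀ᵐ q ∂((lam.prod lam).prod (mu.prod mu)),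
    0 < z (q.1.1, q.2.1) → 0 < z (q.1.2, q.2.2) →
    z (q.1.1, q.2.1) ^ s + z (q.1.2, q.2.2) ^ s ≤
      z (q.1.1, q.2.2) ^ s + z (q.1.2, q.2.1) ^ s + b * inner ℝ (q.1.1 - q.1.2) (q.2.1 - q.2.2)

/-- First-order optimality of a plan with density `z` along two-cycles, in exponential form. -/
def ExpCycle {d : ℕ} (b : ℝ) (lam mu : Measure (Rn d)) (z : Rn d × Rn d → ℝ) : Prop :=
  ∀ᵐ q ∂((lam.prod lam).prod (mu.prod mu)),
    0 < z (q.1.1, q.2.1) → 0 < z (q.1.2, q.2.2) →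
    0 < z (q.1.1, q.2.2) ∧ 0 < z (q.1.2, q.2.1) ∧
    z (q.1.1, q.2.1) * z (q.1.2, q.2.2) = z (q.1.1, q.2.2) * z (q.1.2, q.2.1) *
      Real.exp (b * inner ℝ (q.1.1 - q.1.2) (q.2.1 - q.2.2))

/-- `z` is a nonnegative density, with respect to `lam ⊗ mu`, of a coupling of `lam` and `mu`. -/
structure IsPlanDensity {d : ℕ} (lam mu : Measure (Rn d)) (z : Rn d × Rn d → ℝ) : Prop where
  meas : Measurable z
  nonneg : ∀ q, 0 ≤ z q
  fst : ∀ᵐ x ∂lam, ∫⁻ y, ENNReal.ofReal (z (x, y)) ∂mu = 1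
  snd : ∀ᵐ y ∂mu, ∫⁻ x, ENNReal.ofReal (z (x, y)) ∂lam = 1

theorem isPlanDensity_planDensity {d : ℕ} {lam mu : Measure (Rn d)} [IsFiniteMeasure lam]
    [IsFiniteMeasure mu] {π : Measure (Rn d × Rn d)} (hc : IsCoupling lam mu π)
    (hac : π ≪ lam.prod mu) : IsPlanDensity lam mu (planDensity lam mu π) := by
  have := hc.isFiniteMeasure
  have hπ := withDensity_planDensity hac
  have zm := measurable_planDensity lam mu π
  have zm' : Measurable fun q => ENNReal.ofReal (planDensity lam mu π q) := zm.ennreal_ofReal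
  refine ⟨zm, planDensity_nonneg lam mu π, ?_, ?_⟩
  · refine ae_eq_of_forall_setLIntegral_eq_of_sigmaFinite zm'.lintegral_prod_right'
      measurable_const fun s hs _ => ?_
    rw [setLIntegral_one]
    conv_rhs => rw [← hc.1, Measure.map_apply measurable_fst hs, ← hπ]
    rw [withDensity_apply _ (measurable_fst hs), ← prod_univ, ← Measure.prod_restrict,
      Measure.restrict_univ, lintegral_prod _ zm'.aemeasurable]
  · refine ae_eq_of_forall_setLIntegral_eq_of_sigmaFinite zm'.lintegral_prod_left'
      measurable_const fun s hs _ => ?_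
    rw [setLIntegral_one]
    conv_rhs => rw [← hc.2, Measure.map_apply measurable_snd hs, ← hπ]
    rw [withDensity_apply _ (measurable_snd hs), ← univ_prod, ← Measure.prod_restrict,
      Measure.restrict_univ, lintegral_prod_symm' _ zm']

theorem norm_sq_cycle {d : ℕ} (x₀ x₁ y₀ y₁ : Rn d) :
    ‖x₀ - y₁‖ ^ 2 + ‖x₁ - y₀‖ ^ 2 - ‖x₀ - y₀‖ ^ 2 - ‖x₁ - y₁‖ ^ 2 =
      2 * inner ℝ (x₀ - x₁) (y₀ - y₁) := by
  simp only [norm_sub_sq_real, inner_sub_left, inner_sub_right]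
  ring

theorem hReg_of_one_lt {p : ℝ} (hp : 1 < p) : hReg p = fun z => (|z| ^ p - 1) / (p - 1) := by
  funext z; rw [hReg, if_neg hp.ne']

theorem hReg_one : hReg 1 = fun z => z * Real.log z := by
  funext z; rw [hReg, if_pos rfl]

/-- Here h'(z) = p/(p-1) z^(p-1) is continuous up to zero, so the truncation level may tend to zero.
The quadratic costs combine to twice an inner product, and division by ε² p/(p-1) produces the
constant. -/
theorem IsRegMinimiser.powCycle {d : ℕ} {p ε : ℝ} (hp : 1 < p) (hε : 0 < ε)
    {lam mu : Measure (Rn d)} [IsFiniteMeasure lam] [IsFiniteMeasure mu]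
    {π : Measure (Rn d × Rn d)} (hmin : IsRegMinimiser (hReg p) ε lam mu π) :
    PowCycle (p - 1) (2 * (p - 1) / p / ε ^ 2) lam mu (planDensity lam mu π) := by
  have hp1 : 0 < p - 1 := by linarith
  have hc' : Continuous fun z : ℝ => p / (p - 1) * z ^ (p - 1) :=
    continuous_const.mul (Real.continuous_rpow_const hp1.le)
  have hc : Continuous (hReg p) := by
    rw [hReg_of_one_lt hp]
    exact (((continuous_abs).rpow_const fun _ => Or.inr (by linarith)).sub
      continuous_const).div_const _
  have htan : ∀ a, 0 ≤ a → ∀ b, 0 < b →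
      hReg p b - hReg p a ≤ p / (p - 1) * b ^ (p - 1) * (b - a) := by
    intro a ha b hb
    rw [hReg_of_one_lt hp]
    simp only [abs_of_nonneg ha, abs_of_pos hb]
    have h1 := one_add_mul_self_le_rpow_one_add (s := a / b - 1)
      (by have : 0 ≤ a / b := by positivity
          linarith) hp.le
    rw [add_sub_cancel, Real.div_rpow ha hb.le, le_div_iff₀ (by positivity)] at h1
    have h2 : b ^ p = b ^ (p - 1) * b := by
      rw [Real.rpow_sub_one hb.ne']; field_simp
    rw [← sub_div, div_mul_eq_mul_div, div_mul_eq_mul_div]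
    refine div_le_div_of_nonneg_right ?_ hp1.le
    have h3 : (1 + p * (a / b - 1)) * b ^ p = b ^ p + p * b ^ (p - 1) * (a - b) := by
      rw [h2]; field_simp
    rw [h3] at h1
    linarith
  have hmono : MonotoneOn (fun z : ℝ => p / (p - 1) * z ^ (p - 1)) (Ioi 0) := by
    intro a ha b hb hab
    exact mul_le_mul_of_nonneg_left (Real.rpow_le_rpow (le_of_lt ha) hab hp1.le) (by positivity)
  have key := fun n : ℕ => truncated_two_cycle hmin hc.continuousOn hc.measurable htan hmono
    hc'.continuousOn hc'.measurable (τ := ((n : ℝ) + 1)⁻¹) (by positivity)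
  filter_upwards [ae_all_iff.2 key] with q hq h0 h1
  have lim : ∀ a : ℝ, 0 ≤ a → Filter.Tendsto
      (fun n : ℕ => p / (p - 1) * (max a ((n : ℝ) + 1)⁻¹) ^ (p - 1)) Filter.atTop
      (nhds (p / (p - 1) * a ^ (p - 1))) := by
    intro a ha
    refine (hc'.tendsto a).comp ?_
    have h2 : Filter.Tendsto (fun n : ℕ => max a ((n : ℝ) + 1)⁻¹) Filter.atTop
        (nhds (max a 0)) := by
      refine tendsto_const_nhds.max ?_
      simpa [one_div] using tendsto_one_div_add_atTop_nhds_zero_nat (𝕜 := ℝ)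
    rwa [max_eq_left ha] at h2
  have h2 := ge_of_tendsto' (((tendsto_const_nhds (x := ‖q.1.1 - q.2.2‖ ^ 2)).add
    ((lim _ (planDensity_nonneg lam mu π (q.1.1, q.2.2))).const_mul (ε ^ 2))).add
    ((tendsto_const_nhds (x := ‖q.1.2 - q.2.1‖ ^ 2)).add
    ((lim _ (planDensity_nonneg lam mu π (q.1.2, q.2.1))).const_mul (ε ^ 2))))
    (fun n => hq n h0 h1)
  have h3 := norm_sq_cycle q.1.1 q.1.2 q.2.1 q.2.2
  have h4 : ε ^ 2 * (p / (p - 1)) * (planDensity lam mu π (q.1.1, q.2.1) ^ (p - 1) +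
      planDensity lam mu π (q.1.2, q.2.2) ^ (p - 1)) ≤
      ε ^ 2 * (p / (p - 1)) * (planDensity lam mu π (q.1.1, q.2.2) ^ (p - 1) +
      planDensity lam mu π (q.1.2, q.2.1) ^ (p - 1) + 2 * (p - 1) / p / ε ^ 2 *
        inner ℝ (q.1.1 - q.1.2) (q.2.1 - q.2.2)) := by
    have h5 : ε ^ 2 * (p / (p - 1)) * (2 * (p - 1) / p / ε ^ 2 *
        inner ℝ (q.1.1 - q.1.2) (q.2.1 - q.2.2)) =
        2 * inner ℝ (q.1.1 - q.1.2) (q.2.1 - q.2.2) := by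
      field_simp
    rw [mul_add _ _ (2 * (p - 1) / p / ε ^ 2 * _), h5]
    linarith
  exact le_of_mul_le_mul_left h4 (by positivity)

theorem ae_prod_swap {d : ℕ} (mu : Measure (Rn d)) [IsFiniteMeasure mu] (ν : Measure (Rn d × Rn d))
    [IsFiniteMeasure ν] {T : (Rn d × Rn d) × (Rn d × Rn d) → Prop}
    (h : ∀ᵐ q ∂(ν.prod (mu.prod mu)), T q) :
    ∀ᵐ q ∂(ν.prod (mu.prod mu)), T (q.1, q.2.swap) := by
  have h1 : MeasurePreserving (Prod.swap : Rn d × Rn d → Rn d × Rn d) (mu.prod mu) (mu.prod mu) :=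
    Measure.measurePreserving_swap
  exact ((MeasurePreserving.id ν).prod h1).quasiMeasurePreserving.ae h

/-- Since log τ → -∞, the truncated inequality at all levels is possible only if both crossed
densities are positive. The crossed pairs then form an admissible cycle themselves, whose inequality
is the reverse one; the two give equality. -/
theorem IsRegMinimiser.expCycle {d : ℕ} {ε : ℝ} (hε : 0 < ε)
    {lam mu : Measure (Rn d)} [IsFiniteMeasure lam] [IsFiniteMeasure mu]
    {π : Measure (Rn d × Rn d)} (hmin : IsRegMinimiser (hReg 1) ε lam mu π) :
    ExpCycle (2 / ε ^ 2) lam mu (planDensity lam mu π) := by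
  have hc : Continuous (hReg 1) := by rw [hReg_one]; exact Real.continuous_mul_log
  have hc' : ContinuousOn (fun z : ℝ => Real.log z + 1) (Ioi 0) :=
    (Real.continuousOn_log.mono fun x hx => ne_of_gt hx).add continuousOn_const
  have htan : ∀ a, 0 ≤ a → ∀ b, 0 < b →
      hReg 1 b - hReg 1 a ≤ (Real.log b + 1) * (b - a) := by
    intro a ha b hb
    rw [hReg_one]
    rcases ha.eq_or_lt with rfl | ha
    · simp only [zero_mul, sub_zero]; nlinarith
    · have h1 := Real.log_le_sub_one_of_pos (div_pos hb ha)
      rw [Real.log_div hb.ne' ha.ne'] at h1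
      have h2 := mul_le_mul_of_nonneg_left h1 ha.le
      have h3 : a * (b / a - 1) = b - a := by field_simp
      rw [h3] at h2
      linarith
  have hmono : MonotoneOn (fun z : ℝ => Real.log z + 1) (Ioi 0) := by
    intro a ha b hb hab
    exact add_le_add_left (Real.log_le_log ha hab) 1
  have key := fun n : ℕ => truncated_two_cycle hmin hc.continuousOn hc.measurable htan hmono
    hc' (Real.measurable_log.add_const 1) (τ := ((n : ℝ) + 1)⁻¹) (by positivity)
  set z := planDensity lam mu π with hz
  have z0 : ∀ q, 0 ≤ z q := planDensity_nonneg lam mu π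
  have half : ∀ᵐ q ∂((lam.prod lam).prod (mu.prod mu)),
      0 < z (q.1.1, q.2.1) → 0 < z (q.1.2, q.2.2) →
      0 < z (q.1.1, q.2.2) ∧ 0 < z (q.1.2, q.2.1) ∧
      Real.log (z (q.1.1, q.2.1)) + Real.log (z (q.1.2, q.2.2)) ≤ Real.log (z (q.1.1, q.2.2)) +
        Real.log (z (q.1.2, q.2.1)) + 2 / ε ^ 2 * inner ℝ (q.1.1 - q.1.2) (q.2.1 - q.2.2) := by
    filter_upwards [ae_all_iff.2 key] with q hq h0 h1
    have hτ : Filter.Tendsto (fun n : ℕ => Real.log ((n : ℝ) + 1)⁻¹) Filter.atTop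
        Filter.atBot := by
      simp only [Real.log_inv]
      exact Filter.tendsto_neg_atTop_atBot.comp (Real.tendsto_log_atTop.comp
        (Filter.tendsto_atTop_add_const_right _ 1 tendsto_natCast_atTop_atTop))
    have hτ1 : ∀ n : ℕ, ((n : ℝ) + 1)⁻¹ ≤ 1 := fun n =>
      inv_le_one_of_one_le₀ (by linarith [(Nat.cast_nonneg n : (0 : ℝ) ≤ n)])
    have hτ0 : ∀ n : ℕ, 0 < ((n : ℝ) + 1)⁻¹ := fun n => by positivity
    have up : ∀ a : ℝ, 0 ≤ a → ∀ n : ℕ, Real.log (max a ((n : ℝ) + 1)⁻¹) ≤ Real.log (max a 1) :=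
      fun a _ n => Real.log_le_log (lt_max_of_lt_right (hτ0 n)) (max_le_max_left _ (hτ1 n))
    have nn : ∀ a b C : ℝ, 0 ≤ a → 0 ≤ b → (∀ n : ℕ, C ≤ Real.log (max a ((n : ℝ) + 1)⁻¹) +
        Real.log (max b ((n : ℝ) + 1)⁻¹)) → 0 < a := by
      intro a b C ha hb hC
      rcases ha.eq_or_lt with rfl | ha
      · exfalso
        obtain ⟨n, hn⟩ := (hτ.eventually_lt_atBot (C - Real.log (max b 1))).exists
        have h3 := hC n
        rw [max_eq_right (hτ0 n).le] at h3
        linarith [up b hb n]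
      · exact ha
    obtain ⟨C, hC⟩ : ∃ C, ∀ n : ℕ, C ≤ Real.log (max (z (q.1.1, q.2.2)) ((n : ℝ) + 1)⁻¹) +
        Real.log (max (z (q.1.2, q.2.1)) ((n : ℝ) + 1)⁻¹) := by
      refine ⟨Real.log (z (q.1.1, q.2.1)) + Real.log (z (q.1.2, q.2.2)) - 2 / ε ^ 2 *
        inner ℝ (q.1.1 - q.1.2) (q.2.1 - q.2.2), fun n => ?_⟩
      have h4 := hq n h0 h1
      have h5 := norm_sq_cycle q.1.1 q.1.2 q.2.1 q.2.2
      refine le_of_mul_le_mul_left (a := ε ^ 2) ?_ (by positivity)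
      have h6 : ε ^ 2 * (Real.log (z (q.1.1, q.2.1)) + Real.log (z (q.1.2, q.2.2)) - 2 / ε ^ 2 *
        inner ℝ (q.1.1 - q.1.2) (q.2.1 - q.2.2)) =
        ε ^ 2 * (Real.log (z (q.1.1, q.2.1)) + Real.log (z (q.1.2, q.2.2))) - 2 *
        inner ℝ (q.1.1 - q.1.2) (q.2.1 - q.2.2) := by field_simp
      rw [h6]
      linarith
    have p1 := nn _ _ C (z0 _) (z0 _) hC
    have p2 := nn _ _ C (z0 (q.1.2, q.2.1)) (z0 (q.1.1, q.2.2)) fun n => by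
      rw [add_comm]; exact hC n
    refine ⟨p1, p2, ?_⟩
    have hinv : Filter.Tendsto (fun n : ℕ => ((n : ℝ) + 1)⁻¹) Filter.atTop (nhds 0) := by
      simpa [one_div] using tendsto_one_div_add_atTop_nhds_zero_nat (𝕜 := ℝ)
    obtain ⟨n, hn1, hn2⟩ := ((hinv.eventually_lt_const p1).and (hinv.eventually_lt_const p2)).exists
    have h4 := hq n h0 h1
    rw [max_eq_left hn1.le, max_eq_left hn2.le] at h4
    have h5 := norm_sq_cycle q.1.1 q.1.2 q.2.1 q.2.2
    refine le_of_mul_le_mul_left (a := ε ^ 2) ?_ (by positivity)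
    have h6 : ε ^ 2 * (Real.log (z (q.1.1, q.2.2)) + Real.log (z (q.1.2, q.2.1)) + 2 / ε ^ 2 *
        inner ℝ (q.1.1 - q.1.2) (q.2.1 - q.2.2)) =
        ε ^ 2 * (Real.log (z (q.1.1, q.2.2)) + Real.log (z (q.1.2, q.2.1))) + 2 *
        inner ℝ (q.1.1 - q.1.2) (q.2.1 - q.2.2) := by field_simp
    rw [h6]
    linarith
  filter_upwards [half, ae_prod_swap mu (lam.prod lam) half] with q h1 h2 p00 p11
  obtain ⟨p01, p10, hle⟩ := h1 p00 p11
  have hge := (h2 p01 p10).2.2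
  simp only [Prod.fst_swap, Prod.snd_swap] at hge
  have h7 : inner ℝ (q.1.1 - q.1.2) (q.2.2 - q.2.1) =
      - inner ℝ (q.1.1 - q.1.2) (q.2.1 - q.2.2) := by
    rw [← inner_neg_right, neg_sub]
  rw [h7] at hge
  refine ⟨p01, p10, ?_⟩
  have h8 : Real.log (z (q.1.1, q.2.1)) + Real.log (z (q.1.2, q.2.2)) = Real.log (z (q.1.1, q.2.2))
    + Real.log (z (q.1.2, q.2.1)) + 2 / ε ^ 2 * inner ℝ (q.1.1 - q.1.2) (q.2.1 - q.2.2) := by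
    linarith
  rw [← Real.exp_log p00, ← Real.exp_log p11, ← Real.exp_log p01, ← Real.exp_log p10,
    ← Real.exp_add, ← Real.exp_add, ← Real.exp_add, h8]

/-! ### Localised hypotheses and their behaviour under rescaling -/

/-- On `B_r` the measure `ν` lies between `m` and `M` times Lebesgue measure. -/
def VolBetween {d : ℕ} (ν : Measure (Rn d)) (m M r : ℝ) : Prop :=
  ∀ A, MeasurableSet A → A ⊆ ball (0 : Rn d) r →
    ENNReal.ofReal m * volume A ≤ ν A ∧ ν A ≤ ENNReal.ofReal M * volume A

/-- The transport energy of `z` over `B_r × ℝᵈ` is at most `e`. -/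
def EnergyLe {d : ℕ} (lam mu : Measure (Rn d)) (z : Rn d × Rn d → ℝ) (r e : ℝ) : Prop :=
  ∫⁻ x in ball (0 : Rn d) r, ∫⁻ y, ENNReal.ofReal (‖y - x‖ ^ 2 * z (x, y)) ∂mu ∂lam ≤
    ENNReal.ofReal e

/-- The weight `z^(2-p)` on the support of the plan. -/
noncomputable def weight (p a : ℝ) : ℝ := if 0 < a then a ^ (2 - p) else 0

/-- The weighted mean of the plan with density `z` makes sense and is regular on `B_ρ`. -/
def RegularMean {d : ℕ} (p ρ : ℝ) (K : ℝ≥0) (mu : Measure (Rn d)) (z : Rn d × Rn d → ℝ) : Prop :=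
  (∀ᵐ x ∂(volume.restrict (ball (0 : Rn d) ρ)),
    Integrable (fun y => weight p (z (x, y))) mu ∧
    Integrable (fun y => weight p (z (x, y)) • y) mu ∧ 0 < ∫ y, weight p (z (x, y)) ∂mu) ∧
  ∃ T : Rn d → Rn d,
    (∀ᵐ x ∂(volume.restrict (ball (0 : Rn d) ρ)),
      T x = (∫ y, weight p (z (x, y)) ∂mu)⁻¹ • ∫ y, weight p (z (x, y)) • y ∂mu) ∧
    LipschitzOnWith K T (ball 0 ρ) ∧ (p < 2 → ContDiffOn ℝ 1 T (ball 0 ρ))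

theorem weight_mul {p σ : ℝ} (hσ : 0 < σ) (a : ℝ) :
    weight p (σ * a) = σ ^ (2 - p) * weight p a := by
  unfold weight
  by_cases h : 0 < a
  · rw [if_pos h, if_pos (mul_pos hσ h), Real.mul_rpow hσ.le h.le]
  · rw [if_neg h, if_neg (by rwa [mul_pos_iff_of_pos_left hσ]), mul_zero]

/-- The measure `ν` read in units of length `s`, with its density preserved. -/
noncomputable def rescale {d : ℕ} (s : ℝ) (ν : Measure (Rn d)) : Measure (Rn d) :=
  (ENNReal.ofReal (s ^ d))⁻¹ • ν.map fun x => s⁻¹ • x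

section rescale

variable {d : ℕ} {s : ℝ}

theorem measurableEmbedding_smul_Rn (hs : s ≠ 0) : MeasurableEmbedding fun x : Rn d => s • x :=
  (Homeomorph.smulOfNeZero s hs).measurableEmbedding

theorem ofReal_inv_ne (hs : 0 < s) : (ENNReal.ofReal (s ^ d))⁻¹ ≠ 0 ∧
    (ENNReal.ofReal (s ^ d))⁻¹ ≠ ∞ := by
  have h : 0 < s ^ d := by positivity
  exact ⟨ENNReal.inv_ne_zero.2 ENNReal.ofReal_ne_top,
    ENNReal.inv_ne_top.2 (ENNReal.ofReal_pos.2 h).ne'⟩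

theorem isFiniteMeasure_rescale (hs : 0 < s) (ν : Measure (Rn d)) [IsFiniteMeasure ν] :
    IsFiniteMeasure (rescale s ν) :=
  Measure.smul_finite _ (ofReal_inv_ne hs).2

theorem quasi_rescale (hs : 0 < s) (ν : Measure (Rn d)) :
    Measure.QuasiMeasurePreserving (fun x => s • x) (rescale s ν) ν := by
  refine ⟨(measurableEmbedding_smul_Rn hs.ne').measurable, ?_⟩
  rw [rescale, Measure.map_smul, Measure.map_map
    (measurableEmbedding_smul_Rn hs.ne').measurable
    (measurableEmbedding_smul_Rn (inv_ne_zero hs.ne')).measurable]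
  have : ((fun x : Rn d => s • x) ∘ fun x => s⁻¹ • x) = id := by
    funext x; simp [smul_smul, hs.ne']
  rw [this, Measure.map_id]
  exact Measure.smul_absolutelyContinuous

theorem lintegral_rescale (hs : 0 < s) (ν : Measure (Rn d)) (f : Rn d → ℝ≥0∞) :
    ∫⁻ x, f (s • x) ∂(rescale s ν) = (ENNReal.ofReal (s ^ d))⁻¹ * ∫⁻ x, f x ∂ν := by
  rw [rescale, lintegral_smul_measure,
    (measurableEmbedding_smul_Rn (inv_ne_zero hs.ne')).lintegral_map]
  simp [smul_smul, hs.ne']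

theorem integral_rescale {F : Type*} [NormedAddCommGroup F] [NormedSpace ℝ F] (hs : 0 < s)
    (ν : Measure (Rn d)) (f : Rn d → F) :
    ∫ x, f (s • x) ∂(rescale s ν) = (s ^ d)⁻¹ • ∫ x, f x ∂ν := by
  rw [rescale, integral_smul_measure,
    (measurableEmbedding_smul_Rn (inv_ne_zero hs.ne')).integral_map, ENNReal.toReal_inv,
    ENNReal.toReal_ofReal (by positivity)]
  simp [smul_smul, hs.ne']

theorem integrable_rescale {F : Type*} [NormedAddCommGroup F] (hs : 0 < s)
    (ν : Measure (Rn d)) (f : Rn d → F) :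
    Integrable (fun x => f (s • x)) (rescale s ν) ↔ Integrable f ν := by
  rw [rescale, integrable_smul_measure (ofReal_inv_ne hs).1 (ofReal_inv_ne hs).2,
    (measurableEmbedding_smul_Rn (inv_ne_zero hs.ne')).integrable_map_iff]
  simp [Function.comp_def, smul_smul, hs.ne']

theorem VolBetween.rescale {ν : Measure (Rn d)} {m M r : ℝ} (hs : 0 < s)
    (h : VolBetween ν m M r) : VolBetween (rescale s ν) m M (r / s) := by
  intro A hA hAr
  have hm := (measurableEmbedding_smul_Rn (d := d) (inv_ne_zero hs.ne')).measurable
  obtain ⟨h1, h2⟩ := h _ (hm hA) (fun x hx => by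
    have := hAr hx
    rw [mem_ball_zero_iff, norm_smul, norm_inv, Real.norm_eq_abs, abs_of_pos hs, lt_div_iff₀ hs]
      at this
    rw [mem_ball_zero_iff]
    calc ‖x‖ = s⁻¹ * ‖x‖ * s := by field_simp
      _ < r := this)
  have e1 : _root_.rescale s ν A = (ENNReal.ofReal (s ^ d))⁻¹ * ν ((fun x => s⁻¹ • x) ⁻¹' A) := by
    rw [_root_.rescale, Measure.smul_apply, Measure.map_apply hm hA, smul_eq_mul]
  have e2 : volume ((fun x : Rn d => s⁻¹ • x) ⁻¹' A) = ENNReal.ofReal (s ^ d) * volume A := by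
    rw [Measure.addHaar_preimage_smul _ (inv_ne_zero hs.ne')]
    simp only [finrank_euclideanSpace, Fintype.card_fin, inv_pow, inv_inv]
    rw [abs_of_pos (by positivity)]
  have hc : (ENNReal.ofReal (s ^ d))⁻¹ * ENNReal.ofReal (s ^ d) = 1 :=
    ENNReal.inv_mul_cancel (ENNReal.ofReal_pos.2 (by positivity)).ne' ENNReal.ofReal_ne_top
  rw [e2] at h1 h2
  rw [e1]
  constructor
  · calc ENNReal.ofReal m * volume A
        = (ENNReal.ofReal (s ^ d))⁻¹ * (ENNReal.ofReal m * (ENNReal.ofReal (s ^ d) * volume A)) := by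
          rw [mul_left_comm (ENNReal.ofReal m), ← mul_assoc, hc, one_mul]
      _ ≤ _ := by gcongr
  · calc _ ≤ (ENNReal.ofReal (s ^ d))⁻¹ *
          (ENNReal.ofReal M * (ENNReal.ofReal (s ^ d) * volume A)) := by gcongr
      _ = ENNReal.ofReal M * volume A := by
          rw [mul_left_comm (ENNReal.ofReal M), ← mul_assoc, hc, one_mul]

/-- The plan density read in units of length `s`. -/
noncomputable def rescaleDensity (s : ℝ) (z : Rn d × Rn d → ℝ) : Rn d × Rn d → ℝ :=
  fun q => s ^ d * z (s • q.1, s • q.2)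

theorem IsPlanDensity.rescale {lam mu : Measure (Rn d)} {z : Rn d × Rn d → ℝ} (hs : 0 < s)
    (h : IsPlanDensity lam mu z) :
    IsPlanDensity (rescale s lam) (rescale s mu) (rescaleDensity s z) := by
  have hsd : 0 < s ^ d := by positivity
  have hc : (ENNReal.ofReal (s ^ d))⁻¹ * ENNReal.ofReal (s ^ d) = 1 :=
    ENNReal.inv_mul_cancel (ENNReal.ofReal_pos.2 (by positivity)).ne' ENNReal.ofReal_ne_top
  have hcore : ∀ (ν : Measure (Rn d)) (f : Rn d → ℝ), ∫⁻ y, ENNReal.ofReal (f y) ∂ν = 1 →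
      ∫⁻ y, ENNReal.ofReal (s ^ d * f (s • y)) ∂(_root_.rescale s ν) = 1 := by
    intro ν f hf
    simp only [ENNReal.ofReal_mul hsd.le]
    rw [lintegral_const_mul' _ _ ENNReal.ofReal_ne_top,
      lintegral_rescale hs ν fun y => ENNReal.ofReal (f y), hf, mul_one, mul_comm, hc]
  refine ⟨?_, fun q => mul_nonneg hsd.le (h.nonneg _), ?_, ?_⟩
  · have := h.meas
    unfold rescaleDensity
    fun_prop
  · exact ((quasi_rescale hs lam).ae h.fst).mono fun x hx => hcore mu (fun y => z (s • x, y)) hx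
  · exact ((quasi_rescale hs mu).ae h.snd).mono fun y hy => hcore lam (fun x => z (x, s • y)) hy

theorem quasi_rescale_four (hs : 0 < s) (lam mu : Measure (Rn d)) [IsFiniteMeasure lam]
    [IsFiniteMeasure mu] :
    Measure.QuasiMeasurePreserving
      (Prod.map (Prod.map (s • ·) (s • ·)) (Prod.map (s • ·) (s • ·)))
      (((rescale s lam).prod (rescale s lam)).prod ((rescale s mu).prod (rescale s mu)))
      ((lam.prod lam).prod (mu.prod mu)) := by
  have := isFiniteMeasure_rescale hs lam
  have := isFiniteMeasure_rescale hs mu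
  exact QuasiMeasurePreserving.prodMap
    (QuasiMeasurePreserving.prodMap (quasi_rescale hs lam) (quasi_rescale hs lam))
    (QuasiMeasurePreserving.prodMap (quasi_rescale hs mu) (quasi_rescale hs mu))

/-- The inner product contributes s² and the density, which scales like s^d, contributes (s^d)^t.
For t = p - 1 and the length s chosen in the main theorem, the product is ε². -/
theorem PowCycle.rescale {lam mu : Measure (Rn d)} [IsFiniteMeasure lam] [IsFiniteMeasure mu]
    {z : Rn d × Rn d → ℝ} {t b : ℝ} (z0 : ∀ q, 0 ≤ z q) (hs : 0 < s)
    (h : PowCycle t b lam mu z) :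
    PowCycle t (b * s ^ 2 * (s ^ d) ^ t) (rescale s lam) (rescale s mu) (rescaleDensity s z) := by
  have hsd : 0 < s ^ d := by positivity
  filter_upwards [(quasi_rescale_four hs lam mu).ae h] with q hq h0 h1
  simp only [rescaleDensity, mul_pos_iff_of_pos_left hsd] at h0 h1
  have h2 := hq h0 h1
  simp only [Prod.map, ← smul_sub, real_inner_smul_left, real_inner_smul_right] at h2
  simp only [rescaleDensity, Real.mul_rpow hsd.le (z0 _)]
  have h3 := mul_le_mul_of_nonneg_left h2 (Real.rpow_nonneg hsd.le t)
  linarith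

theorem ExpCycle.rescale {lam mu : Measure (Rn d)} [IsFiniteMeasure lam] [IsFiniteMeasure mu]
    {z : Rn d × Rn d → ℝ} {b : ℝ} (hs : 0 < s) (h : ExpCycle b lam mu z) :
    ExpCycle (b * s ^ 2) (rescale s lam) (rescale s mu) (rescaleDensity s z) := by
  have hsd : 0 < s ^ d := by positivity
  filter_upwards [(quasi_rescale_four hs lam mu).ae h] with q hq h0 h1
  simp only [rescaleDensity, mul_pos_iff_of_pos_left hsd] at h0 h1
  obtain ⟨h2, h3, h4⟩ := hq h0 h1
  simp only [Prod.map, ← smul_sub, real_inner_smul_left, real_inner_smul_right] at h2 h3 h4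
  simp only [rescaleDensity, mul_pos_iff_of_pos_left hsd]
  refine ⟨h2, h3, ?_⟩
  have e : b * s ^ 2 * inner ℝ (q.1.1 - q.1.2) (q.2.1 - q.2.2) =
    b * (s * (s * inner ℝ (q.1.1 - q.1.2) (q.2.1 - q.2.2))) := by ring
  rw [e, mul_mul_mul_comm, h4]
  ring

theorem EnergyLe.rescale {lam mu : Measure (Rn d)} {z : Rn d × Rn d → ℝ} {r e : ℝ}
    (hs : 0 < s) (h : EnergyLe lam mu z r e) :
    EnergyLe (rescale s lam) (rescale s mu) (rescaleDensity s z) (r / s) (e / s ^ (d + 2)) := by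
  have hsd : 0 < s ^ d := by positivity
  unfold EnergyLe at h ⊢
  have hin : ∀ x, ∫⁻ y, ENNReal.ofReal (‖y - x‖ ^ 2 * rescaleDensity s z (x, y))
      ∂(_root_.rescale s mu) = ENNReal.ofReal ((s ^ 2)⁻¹) *
      ∫⁻ y, ENNReal.ofReal (‖y - s • x‖ ^ 2 * z (s • x, y)) ∂mu := by
    intro x
    have e1 : ∀ y, ENNReal.ofReal (‖y - x‖ ^ 2 * rescaleDensity s z (x, y)) =
        ENNReal.ofReal (s ^ d * (s ^ 2)⁻¹) *
          ENNReal.ofReal (‖s • y - s • x‖ ^ 2 * z (s • x, s • y)) := by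
      intro y
      rw [← ENNReal.ofReal_mul (by positivity)]
      congr 1
      rw [← smul_sub, norm_smul, Real.norm_eq_abs, abs_of_pos hs, rescaleDensity]
      field_simp
    simp only [e1]
    rw [lintegral_const_mul' _ _ ENNReal.ofReal_ne_top, lintegral_rescale hs mu fun y =>
      ENNReal.ofReal (‖y - s • x‖ ^ 2 * z (s • x, y)), ← mul_assoc]
    congr 1
    rw [← ENNReal.ofReal_inv_of_pos hsd, ← ENNReal.ofReal_mul (by positivity)]
    congr 1
    field_simp
  simp only [hin]
  rw [lintegral_const_mul' _ _ ENNReal.ofReal_ne_top, ← lintegral_indicator measurableSet_ball]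
  have e2 : ∀ x, (ball (0 : Rn d) (r / s)).indicator (fun x =>
      ∫⁻ y, ENNReal.ofReal (‖y - s • x‖ ^ 2 * z (s • x, y)) ∂mu) x =
      (ball (0 : Rn d) r).indicator (fun x =>
        ∫⁻ y, ENNReal.ofReal (‖y - x‖ ^ 2 * z (x, y)) ∂mu) (s • x) := by
    intro x
    have : s • x ∈ ball (0 : Rn d) r ↔ x ∈ ball (0 : Rn d) (r / s) := by
      rw [mem_ball_zero_iff, mem_ball_zero_iff, norm_smul, Real.norm_eq_abs, abs_of_pos hs,
        lt_div_iff₀ hs, mul_comm]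
    by_cases hx : x ∈ ball (0 : Rn d) (r / s)
    · rw [indicator_of_mem hx, indicator_of_mem (this.2 hx)]
    · rw [indicator_of_notMem hx, indicator_of_notMem (fun h => hx (this.1 h))]
  simp only [e2]
  rw [lintegral_rescale hs lam ((ball (0 : Rn d) r).indicator (fun x =>
        ∫⁻ y, ENNReal.ofReal (‖y - x‖ ^ 2 * z (x, y)) ∂mu)), lintegral_indicator measurableSet_ball]
  calc _ ≤ ENNReal.ofReal ((s ^ 2)⁻¹) * ((ENNReal.ofReal (s ^ d))⁻¹ * ENNReal.ofReal e) := by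
        gcongr
    _ = ENNReal.ofReal (e / s ^ (d + 2)) := by
        rw [← ENNReal.ofReal_inv_of_pos hsd, ← ENNReal.ofReal_mul (by positivity),
          ← ENNReal.ofReal_mul (by positivity)]
        congr 1
        rw [pow_add]
        field_simp

/-- The mean at x is s times the rescaled mean at x/s, so its Lipschitz constant does not change.
The common factor of the weights cancels in the quotient. -/
theorem RegularMean.of_rescale {p ρ : ℝ} {K : ℝ≥0} {mu : Measure (Rn d)} {z : Rn d × Rn d → ℝ}
    (hs : 0 < s) (h : RegularMean p (ρ / s) K (rescale s mu) (rescaleDensity s z)) :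
    RegularMean p ρ K mu z := by
  have hsd : 0 < s ^ d := by positivity
  obtain ⟨h1, T, hT, hL, hC⟩ := h
  set κ := (s ^ d) ^ (2 - p) with hκ
  have κ0 : 0 < κ := by positivity
  have hw : ∀ x y, weight p (rescaleDensity s z (x, y)) = κ * weight p (z (s • x, s • y)) :=
    fun x y => weight_mul hsd _
  have hball : ∀ x, x ∈ ball (0 : Rn d) ρ ↔ s⁻¹ • x ∈ ball (0 : Rn d) (ρ / s) := by
    intro x
    rw [mem_ball_zero_iff, mem_ball_zero_iff, norm_smul, norm_inv, Real.norm_eq_abs,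
      abs_of_pos hs, lt_div_iff₀ hs]
    have : s⁻¹ * ‖x‖ * s = ‖x‖ := by field_simp
    rw [this]
  have back : ∀ Q : Rn d → Prop, (∀ᵐ x ∂(volume.restrict (ball (0 : Rn d) (ρ / s))), Q x) →
      ∀ᵐ x ∂(volume.restrict (ball (0 : Rn d) ρ)), Q (s⁻¹ • x) := by
    intro Q hQ
    rw [ae_restrict_iff' measurableSet_ball] at hQ ⊢
    filter_upwards [(Measure.quasiMeasurePreserving_smul volume (inv_ne_zero hs.ne')).ae hQ]
      with x hx hxb using hx ((hball x).1 hxb)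
  have i1 : ∀ x, Integrable (fun y => weight p (rescaleDensity s z (s⁻¹ • x, y))) (rescale s mu) ↔
      Integrable (fun y => weight p (z (x, y))) mu := by
    intro x
    simp only [hw, smul_smul, mul_inv_cancel₀ hs.ne', one_smul]
    rw [integrable_rescale hs mu fun y => κ * weight p (z (x, y)),
      integrable_const_mul_iff (IsUnit.mk0 _ κ0.ne')]
  have ev : ∀ x y : Rn d, weight p (rescaleDensity s z (s⁻¹ • x, y)) • y =
      (κ * s⁻¹) • (weight p (z (x, s • y)) • (s • y)) := by
    intro x y
    simp only [hw, smul_smul, mul_inv_cancel₀ hs.ne', one_smul]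
    congr 1
    field_simp
  have i2 : ∀ x, Integrable (fun y => weight p (rescaleDensity s z (s⁻¹ • x, y)) • y)
      (rescale s mu) ↔ Integrable (fun y => weight p (z (x, y)) • y) mu := by
    intro x
    simp only [ev]
    rw [integrable_rescale hs mu fun y => (κ * s⁻¹) • (weight p (z (x, y)) • y),
      integrable_fun_smul_iff (mul_pos κ0 (inv_pos.2 hs)).ne']
  have I1 : ∀ x, ∫ y, weight p (rescaleDensity s z (s⁻¹ • x, y)) ∂(rescale s mu) =
      (s ^ d)⁻¹ * κ * ∫ y, weight p (z (x, y)) ∂mu := by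
    intro x
    simp only [hw, smul_smul, mul_inv_cancel₀ hs.ne', one_smul]
    rw [integral_rescale hs mu fun y => κ * weight p (z (x, y)), integral_const_mul, smul_eq_mul,
      mul_assoc]
  have I2 : ∀ x, ∫ y, weight p (rescaleDensity s z (s⁻¹ • x, y)) • y ∂(rescale s mu) =
      ((s ^ d)⁻¹ * κ * s⁻¹) • ∫ y, weight p (z (x, y)) • y ∂mu := by
    intro x
    simp only [ev]
    rw [integral_rescale hs mu fun y => (κ * s⁻¹) • (weight p (z (x, y)) • y), integral_smul,
      smul_smul, mul_assoc]
  refine ⟨?_, fun x => s • T (s⁻¹ • x), ?_, ?_, ?_⟩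
  · filter_upwards [back _ h1] with x hx
    rw [i1, i2, I1] at hx
    exact ⟨hx.1, hx.2.1, (mul_pos_iff_of_pos_left (by positivity)).1 hx.2.2⟩
  · filter_upwards [back _ hT] with x hx
    rw [hx, I1, I2, smul_smul, smul_smul]
    congr 1
    have : (s ^ d)⁻¹ * κ ≠ 0 := by positivity
    rw [mul_inv]
    field_simp
  · refine LipschitzOnWith.of_dist_le_mul fun x hx y hy => ?_
    have := hL.dist_le_mul _ ((hball x).1 hx) _ ((hball y).1 hy)
    rw [dist_smul₀, Real.norm_eq_abs, abs_inv, abs_of_pos hs] at this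
    rw [dist_smul₀, Real.norm_eq_abs, abs_of_pos hs]
    calc s * dist (T (s⁻¹ • x)) (T (s⁻¹ • y)) ≤ s * (K * (s⁻¹ * dist x y)) := by gcongr
      _ = K * dist x y := by field_simp
  · intro hp
    have h3 : ContDiff ℝ 1 fun x : Rn d => s⁻¹ • x := by fun_prop
    exact (contDiffOn_const (c := s)).smul ((hC hp).comp h3.contDiffOn fun x hx => (hball x).1 hx)

end rescale

/-! ### Mass near the diagonal and pointwise bounds on the density -/

/-- The volume of the unit ball of `ℝᵈ`. -/
noncomputable def unitBallVolume (d : ℕ) : ℝ := (volume (ball (0 : Rn d) 1)).toReal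

theorem unitBallVolume_pos (d : ℕ) : 0 < unitBallVolume d :=
  ENNReal.toReal_pos (measure_ball_pos volume _ one_pos).ne' measure_ball_lt_top.ne

theorem volume_ball_eq {d : ℕ} (x : Rn d) {ρ : ℝ} (hρ : 0 < ρ) :
    volume (ball x ρ) = ENNReal.ofReal (unitBallVolume d * ρ ^ d) := by
  rw [Measure.addHaar_ball_of_pos _ _ hρ, unitBallVolume, mul_comm, ENNReal.ofReal_mul
    ENNReal.toReal_nonneg, ENNReal.ofReal_toReal measure_ball_lt_top.ne]
  simp

theorem VolBetween.ball_ge {d : ℕ} {ν : Measure (Rn d)} {m M r ρ : ℝ} {x : Rn d} (hm : 0 ≤ m)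
    (h : VolBetween ν m M r) (hρ : 0 < ρ) (hb : ball x ρ ⊆ ball 0 r) :
    ENNReal.ofReal (m * (unitBallVolume d * ρ ^ d)) ≤ ν (ball x ρ) := by
  rw [ENNReal.ofReal_mul hm, ← volume_ball_eq x hρ]
  exact (h _ measurableSet_ball hb).1

theorem VolBetween.ball_le {d : ℕ} {ν : Measure (Rn d)} {m M r ρ : ℝ} {x : Rn d} (hM : 0 ≤ M)
    (h : VolBetween ν m M r) (hρ : 0 < ρ) (hb : ball x ρ ⊆ ball 0 r) :
    ν (ball x ρ) ≤ ENNReal.ofReal (M * (unitBallVolume d * ρ ^ d)) := by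
  rw [ENNReal.ofReal_mul hM, ← volume_ball_eq x hρ]
  exact (h _ measurableSet_ball hb).2

theorem VolBetween.ae_volume {d : ℕ} {ν : Measure (Rn d)} {m M r : ℝ} (hm : 0 < m)
    (h : VolBetween ν m M r) {T : Rn d → Prop} (hT : ∀ᵐ x ∂ν, T x) {A : Set (Rn d)}
    (hA : MeasurableSet A) (hAr : A ⊆ ball 0 r) : ∀ᵐ x ∂(volume.restrict A), T x := by
  obtain ⟨N, hN, hNm, hN0⟩ := exists_measurable_superset_of_null (ae_iff.1 hT)
  rw [ae_iff]
  refine measure_mono_null hN ?_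
  rw [Measure.restrict_apply hNm]
  have h1 := (h (N ∩ A) (hNm.inter hA) (inter_subset_right.trans hAr)).1
  have h2 : ν (N ∩ A) = 0 := measure_mono_null inter_subset_left hN0
  rw [h2, nonpos_iff_eq_zero, mul_eq_zero] at h1
  exact h1.resolve_left (ENNReal.ofReal_pos.2 hm).ne'

theorem VolBetween.ae_restrict {d : ℕ} {ν : Measure (Rn d)} {m M r : ℝ}
    (h : VolBetween ν m M r) {A : Set (Rn d)} (hA : MeasurableSet A) (hAr : A ⊆ ball 0 r)
    {T : Rn d → Prop} (hT : ∀ᵐ x ∂(volume.restrict A), T x) : ∀ᵐ x ∂(ν.restrict A), T x := by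
  obtain ⟨N, hN, hNm, hN0⟩ := exists_measurable_superset_of_null (ae_iff.1 hT)
  rw [ae_iff]
  refine measure_mono_null hN ?_
  rw [Measure.restrict_apply hNm] at hN0 ⊢
  have h1 := (h (N ∩ A) (hNm.inter hA) (inter_subset_right.trans hAr)).2
  rw [hN0, mul_zero, nonpos_iff_eq_zero] at h1
  exact h1

/-- Regroups a quadruple as two pairs (x, y), so that one pair can be frozen and the other averaged
against the plan. -/
theorem ae_prod_pair_comm {d : ℕ} {lam mu : Measure (Rn d)} [IsFiniteMeasure lam]
    [IsFiniteMeasure mu] {T : (Rn d × Rn d) × (Rn d × Rn d) → Prop}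
    (h : ∀ᵐ q ∂((lam.prod lam).prod (mu.prod mu)), T q) :
    ∀ᵐ a ∂(lam.prod mu), ∀ᵐ b ∂(lam.prod mu), T ((a.1, b.1), (a.2, b.2)) := by
  have s1 := measurePreserving_prodAssoc lam mu (lam.prod mu)
  have s2 := (measurePreserving_prodAssoc mu lam mu).symm
  have s3 := (Measure.measurePreserving_swap (μ := mu) (ν := lam)).prod (MeasurePreserving.id mu)
  have s4 := measurePreserving_prodAssoc lam mu mu
  have s5 := (MeasurePreserving.id lam).prod (s4.comp (s3.comp s2))
  have s6 := (measurePreserving_prodAssoc lam lam (mu.prod mu)).symm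
  have s7 := s6.comp (s5.comp s1)
  exact Measure.ae_ae_of_ae_prod (s7.quasiMeasurePreserving.ae h)

/-- The plan with density `z` with respect to `lam ⊗ mu`. -/
noncomputable def planMeasure {d : ℕ} (lam mu : Measure (Rn d)) (z : Rn d × Rn d → ℝ) :
    Measure (Rn d × Rn d) :=
  (lam.prod mu).withDensity fun q => ENNReal.ofReal (z q)

section plan

variable {d : ℕ} {lam mu : Measure (Rn d)} [IsFiniteMeasure lam] [IsFiniteMeasure mu]
  {z : Rn d × Rn d → ℝ}

theorem IsPlanDensity.map_fst (h : IsPlanDensity lam mu z) :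
    (planMeasure lam mu z).map Prod.fst = lam := by
  ext s hs
  rw [Measure.map_apply measurable_fst hs, planMeasure, withDensity_apply _ (measurable_fst hs),
    ← prod_univ, ← Measure.prod_restrict, Measure.restrict_univ,
    lintegral_prod _ h.meas.ennreal_ofReal.aemeasurable,
    lintegral_congr_ae (ae_restrict_of_ae h.fst), setLIntegral_one]

theorem IsPlanDensity.map_snd (h : IsPlanDensity lam mu z) :
    (planMeasure lam mu z).map Prod.snd = mu := by
  ext s hs
  rw [Measure.map_apply measurable_snd hs, planMeasure, withDensity_apply _ (measurable_snd hs),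
    ← univ_prod, ← Measure.prod_restrict, Measure.restrict_univ,
    lintegral_prod_symm' _ h.meas.ennreal_ofReal,
    lintegral_congr_ae (ae_restrict_of_ae h.snd), setLIntegral_one]

theorem IsPlanDensity.lintegral_fst (h : IsPlanDensity lam mu z) {f : Rn d → ℝ≥0∞}
    (hf : Measurable f) : ∫⁻ q, f q.1 ∂(planMeasure lam mu z) = ∫⁻ x, f x ∂lam := by
  nth_rw 2 [← h.map_fst]
  rw [lintegral_map hf measurable_fst]

theorem IsPlanDensity.lintegral_snd (h : IsPlanDensity lam mu z) {f : Rn d → ℝ≥0∞}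
    (hf : Measurable f) : ∫⁻ q, f q.2 ∂(planMeasure lam mu z) = ∫⁻ y, f y ∂mu := by
  nth_rw 2 [← h.map_snd]
  rw [lintegral_map hf measurable_snd]

theorem IsPlanDensity.ae_planMeasure (h : IsPlanDensity lam mu z) {T : Rn d × Rn d → Prop}
    (hT : ∀ᵐ q ∂(lam.prod mu), 0 < z q → T q) : ∀ᵐ q ∂(planMeasure lam mu z), T q := by
  rw [planMeasure, ae_withDensity_iff h.meas.ennreal_ofReal]
  filter_upwards [hT] with q hq hq0
  exact hq (by
    by_contra hn
    exact hq0 (ENNReal.ofReal_eq_zero.2 (not_lt.1 hn)))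

/-- Chebyshev's inequality for the squared displacement. -/
theorem IsPlanDensity.far_mass (h : IsPlanDensity lam mu z) {r e η : ℝ} (hη : 0 < η)
    (he : EnergyLe lam mu z r e) :
    planMeasure lam mu z {q | q.1 ∈ ball (0 : Rn d) r ∧ η ≤ dist q.2 q.1} ≤
      ENNReal.ofReal (e / η ^ 2) := by
  have hzm := h.meas
  have h1 : ∫⁻ q in {q : Rn d × Rn d | q.1 ∈ ball (0 : Rn d) r}, ENNReal.ofReal (‖q.2 - q.1‖ ^ 2)
      ∂(planMeasure lam mu z) ≤ ENNReal.ofReal e := by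
    refine le_trans (le_of_eq ?_) he
    have hset : {q : Rn d × Rn d | q.1 ∈ ball (0 : Rn d) r} = ball (0 : Rn d) r ×ˢ univ := by
      ext q; simp
    rw [hset, planMeasure, setLIntegral_withDensity_eq_setLIntegral_mul _ hzm.ennreal_ofReal
      (by fun_prop) (measurableSet_ball.prod MeasurableSet.univ), ← Measure.prod_restrict,
      Measure.restrict_univ, lintegral_prod _ (by
        refine Measurable.aemeasurable ?_
        exact hzm.ennreal_ofReal.mul (by fun_prop))]
    refine lintegral_congr fun x => lintegral_congr fun y => ?_
    simp only [Pi.mul_apply]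
    rw [mul_comm, ENNReal.ofReal_mul (by positivity)]
  have hms : MeasurableSet {q : Rn d × Rn d | q.1 ∈ ball (0 : Rn d) r ∧ η ≤ dist q.2 q.1} :=
    (measurable_fst measurableSet_ball).inter (measurableSet_le
      (g := fun q : Rn d × Rn d => dist q.2 q.1) measurable_const (by fun_prop))
  have h2 : ENNReal.ofReal (η ^ 2) *
      planMeasure lam mu z {q | q.1 ∈ ball (0 : Rn d) r ∧ η ≤ dist q.2 q.1} ≤
      ENNReal.ofReal e := by
    refine le_trans ?_ h1
    rw [← setLIntegral_const]
    refine (setLIntegral_mono' hms fun q hq => ?_).trans (lintegral_mono_set fun q hq => hq.1)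
    refine ENNReal.ofReal_le_ofReal ?_
    rw [← dist_eq_norm]
    exact pow_le_pow_left₀ hη.le hq.2 2
  rw [ENNReal.ofReal_div_of_pos (by positivity)]
  rw [ENNReal.le_div_iff_mul_le (Or.inl (ENNReal.ofReal_pos.2 (by positivity)).ne')
    (Or.inl ENNReal.ofReal_ne_top), mul_comm]
  exact h2

/-- Pairs `(x, y)` with `x` within `ρ` of `c` and `y` within `ρ` of `x`. -/
def nearPairs (c : Rn d) (ρ : ℝ) : Set (Rn d × Rn d) := {q | q.1 ∈ ball c ρ ∧ dist q.2 q.1 < ρ}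

theorem measurableSet_nearPairs (c : Rn d) (ρ : ℝ) : MeasurableSet (nearPairs c ρ) :=
  (measurable_fst measurableSet_ball).inter
    (measurableSet_lt (f := fun q : Rn d × Rn d => dist q.2 q.1) (by fun_prop) measurable_const)

/-- The source has mass at least m times the volume of the ball, and by `IsPlanDensity.far_mass` at
most half of this amount travels a distance `ρ` or more. -/
theorem IsPlanDensity.near_mass (h : IsPlanDensity lam mu z) {m M r e ρ : ℝ} {c : Rn d}
    (hm : 0 < m) (hlam : VolBetween lam m M r) (hρ : 0 < ρ) (hb : ball c ρ ⊆ ball 0 r)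
    (he : EnergyLe lam mu z r e) (heρ : e / ρ ^ 2 ≤ m * (unitBallVolume d * ρ ^ d) / 2) :
    ENNReal.ofReal (m * (unitBallVolume d * ρ ^ d) / 2) ≤
      planMeasure lam mu z (nearPairs c ρ) := by
  set N := m * (unitBallVolume d * ρ ^ d) with hN
  have hN0 : 0 < N := by have := unitBallVolume_pos d; positivity
  have h1 : ENNReal.ofReal N ≤ planMeasure lam mu z (Prod.fst ⁻¹' ball c ρ) := by
    rw [← Measure.map_apply measurable_fst measurableSet_ball, h.map_fst]
    exact hlam.ball_ge hm.le hρ hb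
  have h2 : planMeasure lam mu z (Prod.fst ⁻¹' ball c ρ) ≤
      planMeasure lam mu z (nearPairs c ρ) + ENNReal.ofReal (N / 2) := by
    refine (measure_mono (t := nearPairs c ρ ∪
      {q | q.1 ∈ ball (0 : Rn d) r ∧ ρ ≤ dist q.2 q.1}) fun q hq => ?_).trans
      ((measure_union_le _ _).trans (add_le_add le_rfl ((h.far_mass hρ he).trans
        (ENNReal.ofReal_le_ofReal heρ))))
    by_cases hd : dist q.2 q.1 < ρ
    · exact Or.inl ⟨hq, hd⟩
    · exact Or.inr ⟨hb hq, not_lt.1 hd⟩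
  have h3 := h1.trans h2
  have h4 : ENNReal.ofReal N = ENNReal.ofReal (N / 2) + ENNReal.ofReal (N / 2) := by
    rw [← ENNReal.ofReal_add (by positivity) (by positivity), add_halves]
  rw [h4] at h3
  exact (ENNReal.add_le_add_iff_right ENNReal.ofReal_ne_top).1 h3

theorem Real.rpow_le_one_add {s a : ℝ} (hs : 0 < s) (hs1 : s ≤ 1) (ha : 0 ≤ a) :
    a ^ s ≤ 1 + a := by
  rcases le_total a 1 with h | h
  · have := Real.rpow_le_one ha h hs.le; linarith
  · have := Real.rpow_le_rpow_of_exponent_le h hs1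
    rw [Real.rpow_one] at this; linarith

/-- Freeze the pair `a` and integrate the cycle inequality over near pairs `q` against the plan. The
crossed terms satisfy z^s ≤ 1 + z, and the marginal constraints give z(a.1, q.2) and z(q.1, a.2)
integral one each. Dropping z(q)^s ≥ 0 leaves (z(a)^s - 2 - bS) N ≤ 2. -/
theorem IsPlanDensity.pow_density_le (h : IsPlanDensity lam mu z) {s b : ℝ} (hs : 0 < s)
    (hs1 : s ≤ 1) (hb : 0 ≤ b) (hcyc : PowCycle s b lam mu z) {N : ℝ} (hN : 0 < N) :
    ∀ᵐ a ∂(lam.prod mu), 0 < z a → ∀ (c : Rn d) (ρ S : ℝ),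
      ENNReal.ofReal N ≤ planMeasure lam mu z (nearPairs c ρ) →
      (∀ q ∈ nearPairs c ρ, inner ℝ (a.1 - q.1) (a.2 - q.2) ≤ S) → z a ^ s ≤ 2 + 2 / N + b * S := by
  have h1 : ∀ᵐ a ∂(lam.prod mu), ∫⁻ y, ENNReal.ofReal (z (a.1, y)) ∂mu = 1 :=
    Measure.quasiMeasurePreserving_fst.ae h.fst
  have h2 : ∀ᵐ a ∂(lam.prod mu), ∫⁻ x, ENNReal.ofReal (z (x, a.2)) ∂lam = 1 :=
    Measure.quasiMeasurePreserving_snd.ae h.snd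
  filter_upwards [h1, h2, ae_prod_pair_comm hcyc] with a ha1 ha2 hac ha0 c ρ S hmass hS
  by_contra hcon
  rw [not_le] at hcon
  set t := z a ^ s - 2 - b * S with ht
  have ht0 : 2 / N < t := by linarith
  have htp : 0 < t := lt_trans (by positivity) ht0
  have hzm := h.meas
  have hae : ∀ᵐ q ∂(planMeasure lam mu z), q ∈ nearPairs c ρ →
      ENNReal.ofReal t ≤ ENNReal.ofReal (z (a.1, q.2)) + ENNReal.ofReal (z (q.1, a.2)) := by
    refine h.ae_planMeasure (hac.mono fun q hq hq0 hqn => ?_)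
    have h3 := hq ha0 hq0
    have h4 := Real.rpow_le_one_add hs hs1 (h.nonneg (a.1, q.2))
    have h5 := Real.rpow_le_one_add hs hs1 (h.nonneg (q.1, a.2))
    have h6 := Real.rpow_nonneg (h.nonneg q) s
    have h7 := mul_le_mul_of_nonneg_left (hS q hqn) hb
    rw [← ENNReal.ofReal_add (h.nonneg _) (h.nonneg _)]
    refine ENNReal.ofReal_le_ofReal ?_
    simp only [Prod.mk.eta] at h3
    linarith
  have h8 : ENNReal.ofReal t * ENNReal.ofReal N ≤ 2 := by
    calc ENNReal.ofReal t * ENNReal.ofReal N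
        ≤ ENNReal.ofReal t * planMeasure lam mu z (nearPairs c ρ) := by gcongr
      _ = ∫⁻ q in nearPairs c ρ, ENNReal.ofReal t ∂(planMeasure lam mu z) := by
          rw [setLIntegral_const]
      _ ≤ ∫⁻ q in nearPairs c ρ, (ENNReal.ofReal (z (a.1, q.2)) + ENNReal.ofReal (z (q.1, a.2)))
          ∂(planMeasure lam mu z) :=
          lintegral_mono_ae ((ae_restrict_iff' (measurableSet_nearPairs c ρ)).2 hae)
      _ ≤ ∫⁻ q, (ENNReal.ofReal (z (a.1, q.2)) + ENNReal.ofReal (z (q.1, a.2)))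
          ∂(planMeasure lam mu z) := setLIntegral_le_lintegral _ _
      _ = 2 := by
          rw [lintegral_add_left (by fun_prop),
            h.lintegral_snd (f := fun y => ENNReal.ofReal (z (a.1, y))) (by fun_prop),
            h.lintegral_fst (f := fun x => ENNReal.ofReal (z (x, a.2))) (by fun_prop), ha1, ha2,
            one_add_one_eq_two]
  rw [← ENNReal.ofReal_mul htp.le, show (2 : ℝ≥0∞) = ENNReal.ofReal 2 by simp,
    ENNReal.ofReal_le_ofReal_iff (by norm_num)] at h8
  rw [div_lt_iff₀ hN] at ht0
  linarith

end plan

/-- Write w = y - x, τ = 8ρ/D, x₁ = x + τw + u and y₁ = x₁ + k, where u and k are shorter than `ρ`.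
The leading term is -τ(1-τ)D² = -8ρ(D - 8ρ), and all terms together are at most -7ρD + 74ρ²; the
condition 32ρ ≤ D absorbs the second summand. -/
theorem inner_nearPairs_le {d : ℕ} {x y : Rn d} {ρ D : ℝ} (hρ : 0 < ρ) (hD : ‖y - x‖ = D)
    (hDρ : 32 * ρ ≤ D) : ∀ q ∈ nearPairs (x + (8 * ρ / D) • (y - x)) ρ,
    inner ℝ (x - q.1) (y - q.2) ≤ -(4 * ρ * D) := by
  rintro ⟨x₁, y₁⟩ ⟨h1, h2⟩
  have hD0 : 0 < D := by linarith
  set τ := 8 * ρ / D with hτ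
  have hτD : τ * D = 8 * ρ := by rw [hτ]; field_simp
  set w := y - x with hw
  set u := x₁ - (x + τ • w) with hu
  set k := y₁ - x₁ with hk
  simp only [mem_ball, dist_eq_norm] at h1 h2
  rw [← hu] at h1
  rw [← hk] at h2
  have e1 : x - x₁ = -(τ • w + u) := by rw [hu]; abel
  have e2 : y - y₁ = (1 - τ) • w - u - k := by rw [hk, hu, sub_smul, one_smul, hw]; abel
  simp only [e1, e2]
  have e3 : inner ℝ (-(τ • w + u)) ((1 - τ) • w - u - k) = -(τ * (1 - τ) * ‖w‖ ^ 2) +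
      τ * inner ℝ w u + τ * inner ℝ w k - (1 - τ) * inner ℝ w u + ‖u‖ ^ 2 + inner ℝ u k := by
    simp only [inner_neg_left, inner_add_left, inner_sub_right, real_inner_smul_left,
      real_inner_smul_right, real_inner_self_eq_norm_sq, real_inner_comm w u]
    ring
  rw [e3, hD]
  have b1 := abs_real_inner_le_norm w u
  have b2 := abs_real_inner_le_norm w k
  have b3 := abs_real_inner_le_norm u k
  rw [hD] at b1 b2
  have c1 : |inner ℝ w u| ≤ D * ρ := b1.trans (by gcongr)
  have c2 : |inner ℝ w k| ≤ D * ρ := b2.trans (by gcongr)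
  have c3 : |inner ℝ u k| ≤ ρ * ρ := b3.trans (by gcongr)
  have c4 : ‖u‖ ^ 2 ≤ ρ ^ 2 := by gcongr
  have hτ0 : 0 < τ := by positivity
  have hτ1 : τ ≤ 1 / 4 := by rw [hτ, div_le_iff₀ hD0]; linarith
  have t1 : τ * inner ℝ w u ≤ τ * (D * ρ) :=
    mul_le_mul_of_nonneg_left ((le_abs_self _).trans c1) hτ0.le
  have t2 : τ * inner ℝ w k ≤ τ * (D * ρ) :=
    mul_le_mul_of_nonneg_left ((le_abs_self _).trans c2) hτ0.le
  have t3 : -((1 - τ) * inner ℝ w u) ≤ (1 - τ) * (D * ρ) := by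
    rw [← mul_neg]
    exact mul_le_mul_of_nonneg_left ((neg_le_abs _).trans c1) (by linarith)
  have t4 : inner ℝ u k ≤ ρ * ρ := (le_abs_self _).trans c3
  have f1 : τ * (D * ρ) = 8 * ρ * ρ := by rw [← mul_assoc, hτD]
  have f2 : τ * (1 - τ) * D ^ 2 = 8 * ρ * (D - 8 * ρ) := by
    calc τ * (1 - τ) * D ^ 2 = (τ * D) * (D - τ * D) := by ring
      _ = _ := by rw [hτD]
  have f3 : (1 - τ) * (D * ρ) = D * ρ - 8 * ρ * ρ := by rw [sub_mul, f1, one_mul]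
  nlinarith

section localisation

variable {d : ℕ} {lam mu : Measure (Rn d)} [IsFiniteMeasure lam] [IsFiniteMeasure mu]
  {z : Rn d × Rn d → ℝ}

/-- A lower bound for the mass that the plan transports within small balls of `B_r`. -/
noncomputable def nearMass (d : ℕ) (m r : ℝ) : ℝ := m * (unitBallVolume d * (r / 96) ^ d) / 2

theorem nearMass_pos {m r : ℝ} (hm : 0 < m) (hr : 0 < r) : 0 < nearMass d m r := by
  have := unitBallVolume_pos d
  unfold nearMass; positivity

theorem ball_shift_subset {x w : Rn d} {r : ℝ} (hr : 0 < r) (hx : x ∈ ball (0 : Rn d) (r / 3))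
    (hw : ‖w‖ ≤ r / 12) : ball (x + w) (r / 96) ⊆ ball 0 (r / 2) := by
  intro u hu
  rw [mem_ball_zero_iff] at hx ⊢
  rw [mem_ball, dist_eq_norm] at hu
  have : u = (u - (x + w)) + (x + w) := by abel
  rw [this]
  have h1 := norm_add_le (u - (x + w)) (x + w)
  have h2 := norm_add_le x w
  linarith

theorem norm_shift {x y : Rn d} {ρ D : ℝ} (hρ : 0 < ρ) (hD : ‖y - x‖ = D) (hD0 : 0 < D) :
    ‖(8 * ρ / D) • (y - x)‖ = 8 * ρ := by
  rw [norm_smul, hD, Real.norm_eq_abs, abs_of_pos (by positivity)]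
  field_simp

theorem inner_nearPairs_zero_le {x y : Rn d} {r : ℝ} (hr : 0 < r)
    (hx : x ∈ ball (0 : Rn d) (r / 3)) (hy : dist y x < r / 3) :
    ∀ q ∈ nearPairs (0 : Rn d) (r / 96), inner ℝ (x - q.1) (y - q.2) ≤ r ^ 2 := by
  rintro ⟨x₁, y₁⟩ ⟨h1, h2⟩
  rw [mem_ball_zero_iff] at hx
  simp only [mem_ball_zero_iff] at h1
  rw [dist_eq_norm] at h2 hy
  have b1 : ‖x - x₁‖ ≤ r := (norm_sub_le _ _).trans (by linarith)
  have b2 : ‖y - y₁‖ ≤ r := by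
    have : y - y₁ = (y - x) + x - x₁ - (y₁ - x₁) := by abel
    rw [this]
    have := norm_sub_le ((y - x) + x - x₁) (y₁ - x₁)
    have := norm_sub_le ((y - x) + x) x₁
    have := norm_add_le (y - x) x
    linarith
  calc inner ℝ (x - x₁) (y - y₁) ≤ ‖x - x₁‖ * ‖y - y₁‖ := real_inner_le_norm _ _
    _ ≤ r * r := by gcongr
    _ = r ^ 2 := by ring

/-- With ρ = r/96 the threshold 32ρ is r/3, the shift 8ρ = r/12 keeps the small ball inside B_{r/2},
and 4ρD ≥ r²/72 for D ≥ r/3. For the general bound at nearby y, near pairs at the origin suffice,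
with inner product at most r². -/
theorem IsPlanDensity.pow_density_bounds (h : IsPlanDensity lam mu z) {s b m M r e : ℝ}
    (hs : 0 < s) (hs1 : s ≤ 1) (hb : 0 ≤ b) (hcyc : PowCycle s b lam mu z) (hm : 0 < m)
    (hr : 0 < r) (hlam : VolBetween lam m M r) (he : EnergyLe lam mu z r e)
    (heρ : e / (r / 96) ^ 2 ≤ nearMass d m r) :
    ∀ᵐ a ∂(lam.prod mu), a.1 ∈ ball (0 : Rn d) (r / 3) → 0 < z a →
      z a ^ s ≤ 2 + 2 / nearMass d m r + b * r ^ 2 ∧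
      (r / 3 ≤ dist a.2 a.1 → z a ^ s ≤ 2 + 2 / nearMass d m r - b * (r ^ 2 / 72)) := by
  have hN := nearMass_pos (d := d) hm hr
  filter_upwards [h.pow_density_le hs hs1 hb hcyc hN] with a ha hx hz
  have key : r / 3 ≤ dist a.2 a.1 → z a ^ s ≤ 2 + 2 / nearMass d m r - b * (r ^ 2 / 72) := by
    intro hd
    rw [dist_eq_norm] at hd
    have hD0 : 0 < ‖a.2 - a.1‖ := by linarith
    have h1 := ha hz (a.1 + (8 * (r / 96) / ‖a.2 - a.1‖) • (a.2 - a.1)) (r / 96)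
      (-(4 * (r / 96) * ‖a.2 - a.1‖))
      (h.near_mass hm hlam (by positivity) ((ball_shift_subset hr hx (by
        rw [norm_shift (by positivity) rfl hD0]; linarith)).trans
          (ball_subset_ball (by linarith))) he heρ)
      (inner_nearPairs_le (by positivity) rfl (by linarith))
    have h2 : b * (r ^ 2 / 72) ≤ b * (4 * (r / 96) * ‖a.2 - a.1‖) := by
      refine mul_le_mul_of_nonneg_left ?_ hb
      nlinarith
    linarith
  refine ⟨?_, key⟩
  rcases le_or_gt (r / 3) (dist a.2 a.1) with hd | hd
  · have h1 := key hd
    have : 0 ≤ b * (r ^ 2 / 72) := by positivity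
    have : 0 ≤ b * r ^ 2 := by positivity
    linarith
  · exact ha hz 0 (r / 96) (r ^ 2) (h.near_mass hm hlam (by positivity)
      (ball_subset_ball (by linarith)) he heρ) (inner_nearPairs_zero_le hr hx hd)

/-- A density at most `Z` cannot concentrate at the diagonal: pairs closer than `η` carry at most
half of the mass over B_{r/3}, and by Chebyshev the remaining pairs carry less than the other half.
-/
theorem IsPlanDensity.not_bounded_of_energy_small (h : IsPlanDensity lam mu z)
    {m M r e η Z : ℝ} (hm : 0 < m) (hM : 0 ≤ M) (hr : 0 < r) (hlam : VolBetween lam m M r)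
    (hmu : VolBetween mu m M r) (he : EnergyLe lam mu z r e) (hη : 0 < η) (hηr : η ≤ r / 3)
    (hZ0 : 0 ≤ Z) (hZ : Z * (M * (unitBallVolume d * η ^ d)) ≤ 1 / 2)
    (heη : e / η ^ 2 < m * (unitBallVolume d * (r / 3) ^ d) / 2)
    (hz : ∀ᵐ a ∂(lam.prod mu), a.1 ∈ ball (0 : Rn d) (r / 3) → z a ≤ Z) : False := by
  have hω := unitBallVolume_pos d
  have hzm := h.meas
  set Om := ball (0 : Rn d) (r / 3) with hOm
  set A : Set (Rn d × Rn d) := {q | q.1 ∈ Om ∧ dist q.2 q.1 < η} with hA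
  have hAm : MeasurableSet A := (measurable_fst measurableSet_ball).inter
    (measurableSet_lt (f := fun q : Rn d × Rn d => dist q.2 q.1) (by fun_prop) measurable_const)
  have hL : ENNReal.ofReal (m * (unitBallVolume d * (r / 3) ^ d)) ≤ lam Om :=
    hlam.ball_ge hm.le (by positivity) (ball_subset_ball (by linarith))
  have hPA : (lam.prod mu) A ≤ ENNReal.ofReal (M * (unitBallVolume d * η ^ d)) * lam Om := by
    rw [Measure.prod_apply hAm, ← setLIntegral_const, ← lintegral_indicator measurableSet_ball]
    refine lintegral_mono fun x => ?_
    by_cases hx : x ∈ Om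
    · rw [indicator_of_mem hx]
      have : Prod.mk x ⁻¹' A = ball x η := by
        ext y; simp [hA, hx]
      rw [this]
      refine hmu.ball_le hM hη fun y hy => ?_
      rw [hOm, mem_ball_zero_iff] at hx
      rw [mem_ball, dist_eq_norm] at hy
      rw [mem_ball_zero_iff]
      have := norm_add_le (y - x) x
      rw [sub_add_cancel] at this
      linarith
    · rw [indicator_of_notMem hx]
      have : Prod.mk x ⁻¹' A = ∅ := by
        ext y; simp [hA, hx]
      rw [this, measure_empty]
  have h1 : planMeasure lam mu z A ≤ ENNReal.ofReal (1 / 2) * lam Om := by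
    calc planMeasure lam mu z A = ∫⁻ q in A, ENNReal.ofReal (z q) ∂(lam.prod mu) := by
          rw [planMeasure, withDensity_apply _ hAm]
      _ ≤ ∫⁻ q in A, ENNReal.ofReal Z ∂(lam.prod mu) := by
          refine lintegral_mono_ae ((ae_restrict_iff' hAm).2 (hz.mono fun q hq hqA => ?_))
          exact ENNReal.ofReal_le_ofReal (hq hqA.1)
      _ = ENNReal.ofReal Z * (lam.prod mu) A := setLIntegral_const _ _
      _ ≤ ENNReal.ofReal Z * (ENNReal.ofReal (M * (unitBallVolume d * η ^ d)) * lam Om) := by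
          gcongr
      _ = ENNReal.ofReal (Z * (M * (unitBallVolume d * η ^ d))) * lam Om := by
          rw [← mul_assoc, ENNReal.ofReal_mul hZ0]
      _ ≤ _ := by gcongr
  have h2 : lam Om ≤ ENNReal.ofReal (1 / 2) * lam Om + ENNReal.ofReal (e / η ^ 2) := by
    calc lam Om = planMeasure lam mu z (Prod.fst ⁻¹' Om) := by
          rw [← Measure.map_apply measurable_fst measurableSet_ball, h.map_fst]
      _ ≤ planMeasure lam mu z (A ∪ {q | q.1 ∈ ball (0 : Rn d) r ∧ η ≤ dist q.2 q.1}) := by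
          refine measure_mono fun q hq => ?_
          by_cases hd : dist q.2 q.1 < η
          · exact Or.inl ⟨hq, hd⟩
          · exact Or.inr ⟨ball_subset_ball (by linarith) hq, not_lt.1 hd⟩
      _ ≤ _ := (measure_union_le _ _).trans (add_le_add h1 (h.far_mass hη he))
  have hLt : m * (unitBallVolume d * (r / 3) ^ d) ≤ (lam Om).toReal :=
    (ENNReal.ofReal_le_iff_le_toReal (measure_ne_top _ _)).1 hL
  have h3 : (lam Om).toReal ≤ 1 / 2 * (lam Om).toReal + max (e / η ^ 2) 0 := by
    have h4 := ENNReal.toReal_mono (ENNReal.add_ne_top.2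
      ⟨ENNReal.mul_ne_top ENNReal.ofReal_ne_top (measure_ne_top _ _), ENNReal.ofReal_ne_top⟩) h2
    rw [ENNReal.toReal_add (ENNReal.mul_ne_top ENNReal.ofReal_ne_top (measure_ne_top _ _))
      ENNReal.ofReal_ne_top, ENNReal.toReal_mul, ENNReal.toReal_ofReal (by norm_num),
      ENNReal.toReal_ofReal'] at h4
    exact h4
  have h5 : max (e / η ^ 2) 0 < m * (unitBallVolume d * (r / 3) ^ d) / 2 :=
    max_lt heη (by positivity)
  linarith

end localisation

/-! ### The case p = 1: exponential tails and tilts -/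

section exponential

variable {d : ℕ} {lam mu : Measure (Rn d)} [IsFiniteMeasure lam] [IsFiniteMeasure mu]
  {z : Rn d × Rn d → ℝ}

/-- Among near pairs `q`, discard those with z(q) < κ, which are light because near pairs have small
product measure, and those with z(a.1, q.2) ≥ Λ, which are light by Chebyshev and the marginal
constraint. Half of the mass remains, and there the cycle identity gives z(a) ≤ κ⁻¹ Λ exp(bS) z(q.1,
a.2). Averaging over `q` keeps the last factor, whose integral in a.2 is controlled by the other
marginal. -/
theorem IsPlanDensity.exp_density_le (h : IsPlanDensity lam mu z) {b : ℝ} (hb : 0 ≤ b)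
    (hcyc : ExpCycle b lam mu z) {N κ Λ : ℝ} (hN : 0 < N) (hκ : 0 < κ) (hΛ : 4 / N ≤ Λ) :
    ∀ᵐ a ∂(lam.prod mu), 0 < z a → ∀ (c : Rn d) (ρ S r : ℝ), ball c ρ ⊆ ball 0 r →
      ENNReal.ofReal N ≤ planMeasure lam mu z (nearPairs c ρ) →
      ENNReal.ofReal κ * (lam.prod mu) (nearPairs c ρ) ≤ ENNReal.ofReal (N / 4) →
      (∀ q ∈ nearPairs c ρ, inner ℝ (a.1 - q.1) (a.2 - q.2) ≤ S) →
      ENNReal.ofReal (z a) * ENNReal.ofReal (N / 2) ≤ ENNReal.ofReal (κ⁻¹ * Λ * Real.exp (b * S)) *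
        ∫⁻ x in ball 0 r, ENNReal.ofReal (z (x, a.2)) ∂lam := by
  have h1 : ∀ᵐ a ∂(lam.prod mu), ∫⁻ y, ENNReal.ofReal (z (a.1, y)) ∂mu = 1 :=
    Measure.quasiMeasurePreserving_fst.ae h.fst
  have hzm := h.meas
  have hΛ0 : 0 < Λ := lt_of_lt_of_le (by positivity) hΛ
  filter_upwards [h1, ae_prod_pair_comm hcyc] with a ha1 hac ha0 c ρ S r hcr hmass hκm hS
  set ϖ := planMeasure lam mu z with hϖ
  set G := nearPairs c ρ with hG
  have hGm : MeasurableSet G := measurableSet_nearPairs c ρ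
  set B₁ : Set (Rn d × Rn d) := {q | z q < κ} with hB₁
  set B₂ : Set (Rn d × Rn d) := {q | Λ ≤ z (a.1, q.2)} with hB₂
  have hB₁m : MeasurableSet B₁ := measurableSet_lt hzm measurable_const
  have hB₂m : MeasurableSet B₂ :=
    measurableSet_le (g := fun q : Rn d × Rn d => z (a.1, q.2)) measurable_const (by fun_prop)
  have m1 : ϖ (G ∩ B₁) ≤ ENNReal.ofReal (N / 4) := by
    refine le_trans ?_ hκm
    rw [hϖ, planMeasure, withDensity_apply _ (hGm.inter hB₁m)]
    calc _ ≤ ∫⁻ q in G ∩ B₁, ENNReal.ofReal κ ∂(lam.prod mu) :=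
          setLIntegral_mono' (hGm.inter hB₁m) fun q hq => ENNReal.ofReal_le_ofReal (le_of_lt hq.2)
      _ = ENNReal.ofReal κ * (lam.prod mu) (G ∩ B₁) := setLIntegral_const _ _
      _ ≤ _ := by gcongr; exact inter_subset_left
  have m2 : ϖ B₂ ≤ ENNReal.ofReal (N / 4) := by
    have h2 : ENNReal.ofReal Λ * ϖ B₂ ≤ 1 := by
      rw [← setLIntegral_const, ← ha1,
        ← h.lintegral_snd (f := fun y => ENNReal.ofReal (z (a.1, y))) (by fun_prop)]
      exact (setLIntegral_mono' hB₂m fun q hq => ENNReal.ofReal_le_ofReal hq).trans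
        (setLIntegral_le_lintegral _ _)
    have h3 : ϖ B₂ ≤ (ENNReal.ofReal Λ)⁻¹ := by
      rw [ENNReal.le_inv_iff_mul_le, mul_comm]; exact h2
    refine h3.trans ?_
    rw [← ENNReal.ofReal_inv_of_pos hΛ0]
    refine ENNReal.ofReal_le_ofReal (inv_le_of_inv_le₀ (by positivity) ?_)
    rwa [inv_div]
  have m3 : ENNReal.ofReal (N / 2) ≤ ϖ ((G \ B₁) \ B₂) := by
    have h2 : ENNReal.ofReal N ≤ ϖ ((G \ B₁) \ B₂) + (ENNReal.ofReal (N / 4) +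
        ENNReal.ofReal (N / 4)) := by
      refine hmass.trans ((measure_mono (t := ((G \ B₁) \ B₂) ∪ ((G ∩ B₁) ∪ B₂)) ?_).trans
        ((measure_union_le _ _).trans (add_le_add le_rfl ((measure_union_le _ _).trans
          (add_le_add m1 m2)))))
      intro q hq
      by_cases q1 : q ∈ B₁
      · exact Or.inr (Or.inl ⟨hq, q1⟩)
      · by_cases q2 : q ∈ B₂
        · exact Or.inr (Or.inr q2)
        · exact Or.inl ⟨⟨hq, q1⟩, q2⟩
    rw [← ENNReal.ofReal_add (by positivity) (by positivity),
      show N / 4 + N / 4 = N / 2 by ring] at h2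
    nth_rw 1 [show N = N / 2 + N / 2 by ring] at h2
    rw [ENNReal.ofReal_add (by positivity) (by positivity)] at h2
    exact (ENNReal.add_le_add_iff_right ENNReal.ofReal_ne_top).1 h2
  have hGm' : MeasurableSet ((G \ B₁) \ B₂) := (hGm.diff hB₁m).diff hB₂m
  have hae : ∀ᵐ q ∂ϖ, q ∈ (G \ B₁) \ B₂ → ENNReal.ofReal (z a) ≤
      ENNReal.ofReal (κ⁻¹ * Λ * Real.exp (b * S)) * ENNReal.ofReal (z (q.1, a.2)) := by
    refine h.ae_planMeasure (hac.mono fun q hq hq0 hqn => ?_)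
    obtain ⟨h01, h10, he⟩ := hq ha0 hq0
    simp only [Prod.mk.eta] at h01 h10 he
    have k1 : κ ≤ z q := not_lt.1 hqn.1.2
    have k2 : z (a.1, q.2) ≤ Λ := le_of_lt (not_le.1 hqn.2)
    have k3 : Real.exp (b * inner ℝ (a.1 - q.1) (a.2 - q.2)) ≤ Real.exp (b * S) :=
      Real.exp_le_exp.2 (mul_le_mul_of_nonneg_left (hS q hqn.1.1) hb)
    rw [← ENNReal.ofReal_mul (by positivity)]
    refine ENNReal.ofReal_le_ofReal ?_
    have k4 : z a * κ ≤ Λ * z (q.1, a.2) * Real.exp (b * S) := by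
      calc z a * κ ≤ z a * z q := by gcongr
        _ = _ := he
        _ ≤ _ := by gcongr
    calc z a = κ⁻¹ * (z a * κ) := by field_simp
      _ ≤ κ⁻¹ * (Λ * z (q.1, a.2) * Real.exp (b * S)) := by gcongr
      _ = _ := by ring
  calc ENNReal.ofReal (z a) * ENNReal.ofReal (N / 2)
      ≤ ENNReal.ofReal (z a) * ϖ ((G \ B₁) \ B₂) := by gcongr
    _ = ∫⁻ q in (G \ B₁) \ B₂, ENNReal.ofReal (z a) ∂ϖ := (setLIntegral_const _ _).symm
    _ ≤ ∫⁻ q in (G \ B₁) \ B₂, ENNReal.ofReal (κ⁻¹ * Λ * Real.exp (b * S)) *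
        ENNReal.ofReal (z (q.1, a.2)) ∂ϖ := lintegral_mono_ae ((ae_restrict_iff' hGm').2 hae)
    _ ≤ ∫⁻ q, ENNReal.ofReal (κ⁻¹ * Λ * Real.exp (b * S)) *
        (ball (0 : Rn d) r).indicator (fun x => ENNReal.ofReal (z (x, a.2))) q.1 ∂ϖ := by
        rw [← lintegral_indicator hGm']
        refine lintegral_mono fun q => ?_
        by_cases hq : q ∈ (G \ B₁) \ B₂
        · rw [indicator_of_mem hq, indicator_of_mem (hcr hq.1.1.1)]
        · rw [indicator_of_notMem hq]; exact zero_le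
    _ = _ := by
        rw [lintegral_const_mul' _ _ ENNReal.ofReal_ne_top,
          h.lintegral_fst (Measurable.indicator (by fun_prop) measurableSet_ball),
          lintegral_indicator measurableSet_ball]

end exponential

/-- For y far from x the near pairs of `inner_nearPairs_le` give S = -(r/24)|y - x|, which pays for
the exponential weight. The remaining factor, the integral of z(·, y) over B_r, has μ-integral
λ(B_r). -/
theorem exists_exp_tail (d : ℕ) {b m M r : ℝ} (hb : 0 < b) (hm : 0 < m) (hM : 0 < M)
    (hr : 0 < r) :
    ∃ K : ℝ, 0 < K ∧ ∀ (lam mu : Measure (Rn d)) [IsFiniteMeasure lam] [IsFiniteMeasure mu]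
      (z : Rn d × Rn d → ℝ) (e : ℝ), IsPlanDensity lam mu z → ExpCycle b lam mu z →
      VolBetween lam m M r → VolBetween mu m M r → EnergyLe lam mu z r e →
      e / (r / 96) ^ 2 ≤ nearMass d m r →
      ∀ᵐ x ∂lam, x ∈ ball (0 : Rn d) (r / 3) →
        ∫⁻ y, ENNReal.ofReal (Real.exp (b * (r / 24) * ‖y‖) * z (x, y)) ∂mu ≤
          ENNReal.ofReal K := by
  have hω := unitBallVolume_pos d
  have hN := nearMass_pos (d := d) hm hr
  set N := nearMass d m r with hNdef
  set V := M * (unitBallVolume d * r ^ d) with hV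
  have hV0 : 0 < V := by positivity
  -- Chosen so that κ times the product measure of B_r × B_r, which contains the near pairs, is at
  -- most N/4.
  set κ := N / 4 / (V * V) with hκ
  have hκ0 : 0 < κ := by positivity
  set K₀ := 2 / N * (κ⁻¹ * (4 / N) * Real.exp (b * r ^ 2 + b * (r / 24) * r)) with hK₀
  have hK₀0 : 0 < K₀ := by positivity
  refine ⟨K₀ * V, by positivity, ?_⟩
  intro lam mu _ _ z e h hcyc hlam hmu he heρ
  have hzm := h.meas
  have hlamB : lam (ball 0 r) ≤ ENNReal.ofReal V := hlam.ball_le hM.le hr subset_rfl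
  have hmuB : mu (ball 0 r) ≤ ENNReal.ofReal V := hmu.ball_le hM.le hr subset_rfl
  have hκG : ∀ c : Rn d, ball c (r / 96) ⊆ ball 0 (r / 2) →
      ENNReal.ofReal κ * (lam.prod mu) (nearPairs c (r / 96)) ≤ ENNReal.ofReal (N / 4) := by
    intro c hc
    have h1 : (lam.prod mu) (nearPairs c (r / 96)) ≤ ENNReal.ofReal (V * V) := by
      calc _ ≤ (lam.prod mu) (ball 0 r ×ˢ ball 0 r) := by
            refine measure_mono fun q hq => ?_
            have h2 := hc hq.1
            rw [mem_ball_zero_iff] at h2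
            have h3 := hq.2
            rw [dist_eq_norm] at h3
            refine ⟨mem_ball_zero_iff.2 (by linarith), mem_ball_zero_iff.2 ?_⟩
            have := norm_add_le (q.2 - q.1) q.1
            rw [sub_add_cancel] at this
            linarith
        _ = lam (ball 0 r) * mu (ball 0 r) := Measure.prod_prod _ _
        _ ≤ ENNReal.ofReal V * ENNReal.ofReal V := by gcongr
        _ = _ := (ENNReal.ofReal_mul hV0.le).symm
    calc _ ≤ ENNReal.ofReal κ * ENNReal.ofReal (V * V) := by gcongr
      _ = ENNReal.ofReal (N / 4) := by
        rw [← ENNReal.ofReal_mul hκ0.le, hκ]; congr 1; field_simp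
  have hpt : ∀ᵐ a ∂(lam.prod mu), a.1 ∈ ball (0 : Rn d) (r / 3) →
      ENNReal.ofReal (Real.exp (b * (r / 24) * ‖a.2‖) * z a) ≤
      ENNReal.ofReal K₀ * ∫⁻ x in ball 0 r, ENNReal.ofReal (z (x, a.2)) ∂lam := by
    filter_upwards [h.exp_density_le hb.le hcyc hN hκ0 le_rfl] with a ha hx
    rcases (h.nonneg a).eq_or_lt with hz0 | hz0
    · rw [← hz0, mul_zero, ENNReal.ofReal_zero]; exact zero_le
    obtain ⟨c, S, hc, hS, hSb⟩ : ∃ (c : Rn d) (S : ℝ), ball c (r / 96) ⊆ ball 0 (r / 2) ∧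
        (∀ q ∈ nearPairs c (r / 96), inner ℝ (a.1 - q.1) (a.2 - q.2) ≤ S) ∧
        b * S + b * (r / 24) * ‖a.2‖ ≤ b * r ^ 2 + b * (r / 24) * r := by
      have hxn : ‖a.1‖ < r / 3 := mem_ball_zero_iff.1 hx
      have htri := norm_add_le (a.2 - a.1) a.1
      rw [sub_add_cancel] at htri
      rcases le_or_gt (r / 3) (dist a.2 a.1) with hd | hd
      · rw [dist_eq_norm] at hd
        have hD0 : 0 < ‖a.2 - a.1‖ := by linarith
        refine ⟨a.1 + (8 * (r / 96) / ‖a.2 - a.1‖) • (a.2 - a.1), -(4 * (r / 96) * ‖a.2 - a.1‖),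
          ball_shift_subset hr hx (by rw [norm_shift (by positivity) rfl hD0]; linarith),
          inner_nearPairs_le (by positivity) rfl (by linarith), ?_⟩
        have h2 : b * (r / 24) * ‖a.2‖ ≤ b * (r / 24) * (‖a.2 - a.1‖ + r) := by
          refine mul_le_mul_of_nonneg_left (by linarith) (by positivity)
        have : 0 ≤ b * r ^ 2 := by positivity
        linarith
      · refine ⟨0, r ^ 2, ball_subset_ball (by linarith), inner_nearPairs_zero_le hr hx hd, ?_⟩
        rw [dist_eq_norm] at hd
        have h2 : b * (r / 24) * ‖a.2‖ ≤ b * (r / 24) * r := by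
          refine mul_le_mul_of_nonneg_left (by linarith) (by positivity)
        linarith
    have hcr : ball c (r / 96) ⊆ ball 0 r := hc.trans (ball_subset_ball (by linarith))
    have h1 := ha hz0 c (r / 96) S r hcr (h.near_mass hm hlam (by positivity) hcr he heρ)
      (hκG c hc) hS
    set A := ∫⁻ x in ball 0 r, ENNReal.ofReal (z (x, a.2)) ∂lam with hA
    have h2 : ENNReal.ofReal (z a) ≤ ENNReal.ofReal (2 / N) *
        (ENNReal.ofReal (κ⁻¹ * (4 / N) * Real.exp (b * S)) * A) := by
      calc ENNReal.ofReal (z a)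
          = ENNReal.ofReal (2 / N) * (ENNReal.ofReal (z a) * ENNReal.ofReal (N / 2)) := by
            rw [← ENNReal.ofReal_mul hz0.le, ← ENNReal.ofReal_mul (by positivity)]
            congr 1; field_simp
        _ ≤ _ := by gcongr
    calc ENNReal.ofReal (Real.exp (b * (r / 24) * ‖a.2‖) * z a)
        = ENNReal.ofReal (Real.exp (b * (r / 24) * ‖a.2‖)) * ENNReal.ofReal (z a) :=
          ENNReal.ofReal_mul (by positivity)
      _ ≤ ENNReal.ofReal (Real.exp (b * (r / 24) * ‖a.2‖)) * (ENNReal.ofReal (2 / N) *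
        (ENNReal.ofReal (κ⁻¹ * (4 / N) * Real.exp (b * S)) * A)) := by gcongr
      _ = ENNReal.ofReal (2 / N * (κ⁻¹ * (4 / N) *
          Real.exp (b * S + b * (r / 24) * ‖a.2‖))) * A := by
        rw [← mul_assoc, ← mul_assoc, ← ENNReal.ofReal_mul (by positivity),
          ← ENNReal.ofReal_mul (by positivity), Real.exp_add]
        congr 2; ring
      _ ≤ _ := by rw [hK₀]; gcongr
  filter_upwards [Measure.ae_ae_of_ae_prod hpt] with x hx hxb
  calc _ ≤ ∫⁻ y, ENNReal.ofReal K₀ * ∫⁻ x in ball 0 r, ENNReal.ofReal (z (x, y)) ∂lam ∂mu :=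
        lintegral_mono_ae (hx.mono fun y hy => hy hxb)
    _ = ENNReal.ofReal K₀ * ∫⁻ x in ball 0 r, ∫⁻ y, ENNReal.ofReal (z (x, y)) ∂mu ∂lam := by
        rw [lintegral_const_mul' _ _ ENNReal.ofReal_ne_top, lintegral_lintegral_swap (by
          refine Measurable.aemeasurable ?_
          have : Measurable fun q : Rn d × Rn d => z (q.2, q.1) := by fun_prop
          exact this.ennreal_ofReal)]
    _ = ENNReal.ofReal K₀ * lam (ball 0 r) := by
        rw [lintegral_congr_ae (ae_restrict_of_ae h.fst), setLIntegral_one]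
    _ ≤ ENNReal.ofReal K₀ * ENNReal.ofReal V := by gcongr
    _ = _ := (ENNReal.ofReal_mul hK₀0.le).symm

theorem weight_one {a : ℝ} (ha : 0 ≤ a) : weight 1 a = a := by
  unfold weight
  rcases ha.eq_or_lt with h | h
  · simp [← h]
  · rw [if_pos h]; norm_num

theorem exists_ae_pos_of_lintegral {α : Type*} [MeasurableSpace α] {ν : Measure α} {f : α → ℝ}
    (h : ∫⁻ y, ENNReal.ofReal (f y) ∂ν = 1) : ∃ᵐ y ∂ν, 0 < f y := by
  intro hn
  have : ∫⁻ y, ENNReal.ofReal (f y) ∂ν = 0 := by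
    rw [← lintegral_zero (μ := ν)]
    refine lintegral_congr_ae (hn.mono fun y hy => ?_)
    exact ENNReal.ofReal_eq_zero.2 (not_lt.1 hy)
  rw [h] at this
  exact one_ne_zero this

/-- The cycle identity says that z(x, y) / z(u, y), divided by exp(b⟨x - u, y⟩), does not depend on
y. The positivity of crossed densities makes the supports of the two slices agree almost everywhere.
-/
theorem IsPlanDensity.exp_representation {d : ℕ} {lam mu : Measure (Rn d)} [IsFiniteMeasure lam]
    [IsFiniteMeasure mu] {z : Rn d × Rn d → ℝ} (h : IsPlanDensity lam mu z) {b : ℝ}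
    (hcyc : ExpCycle b lam mu z) :
    ∀ᵐ u ∂lam, ∀ᵐ x ∂lam, ∃ c : ℝ, 0 < c ∧
      ∀ᵐ y ∂mu, z (x, y) = c * (Real.exp (b * inner ℝ (x - u) y) * z (u, y)) := by
  have h1 := hcyc.and (ae_prod_swap mu (lam.prod lam) hcyc)
  have h2 := Measure.ae_ae_of_ae_prod (Measure.ae_ae_of_ae_prod h1)
  filter_upwards [h2, h.fst] with u hu hu1
  filter_upwards [hu, h.fst] with x hx hx1
  have h3 := Measure.ae_ae_of_ae_prod hx
  obtain ⟨y₀, hy0, hy⟩ := ((exists_ae_pos_of_lintegral hu1).and_eventually h3).exists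
  obtain ⟨y₁, hy1, hyy1⟩ := ((exists_ae_pos_of_lintegral hx1).and_eventually hy).exists
  have hxy0 := (hyy1.1 hy0 hy1).2.1
  refine ⟨z (x, y₀) / z (u, y₀) * Real.exp (-(b * inner ℝ (x - u) y₀)), by positivity, ?_⟩
  filter_upwards [hy] with y hy2
  rcases (h.nonneg (x, y)).eq_or_lt with h0 | h0
  · have : z (u, y) = 0 := by
      by_contra hne
      have hpos := lt_of_le_of_ne (h.nonneg (u, y)) (Ne.symm hne)
      have := (hy2.2 hpos hxy0).2.1
      exact this.ne h0
    rw [← h0, this, mul_zero, mul_zero]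
  · have h4 := (hy2.1 hy0 h0).2.2
    have e1 : inner ℝ (u - x) (y₀ - y) = inner ℝ (x - u) y - inner ℝ (x - u) y₀ := by
      rw [← neg_sub x u, ← neg_sub y y₀, inner_neg_neg, inner_sub_right]
    rw [e1, mul_sub, sub_eq_add_neg, Real.exp_add] at h4
    field_simp
    linarith

theorem one_add_pow_le_exp {a t : ℝ} (ha : 0 < a) (ht : 0 ≤ t) (k : ℕ) :
    (1 + t) ^ k ≤ (k.factorial * (a ^ k)⁻¹ * Real.exp a) * Real.exp (a * t) := by
  have h := Real.pow_div_factorial_le_exp (a * (1 + t)) (by positivity) k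
  rw [div_le_iff₀ (by positivity), mul_pow, mul_add, mul_one, Real.exp_add] at h
  calc (1 + t) ^ k = (a ^ k)⁻¹ * (a ^ k * (1 + t) ^ k) := by field_simp
    _ ≤ (a ^ k)⁻¹ * (Real.exp a * Real.exp (a * t) * k.factorial) := by gcongr
    _ = _ := by ring

section tilt

variable {d : ℕ} {mu : Measure (Rn d)} {g : Rn d → ℝ} {b c : ℝ} {u x₀ x' : Rn d}

/-- The exponential tilt of `g` by `x - u`. -/
noncomputable def tilt (b : ℝ) (u : Rn d) (g : Rn d → ℝ) (x y : Rn d) : ℝ :=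
  Real.exp (b * inner ℝ (x - u) y) * g y

/-- Differentiation under the integral. Of the exponential moment at x', one half pays for moving
the tilt within distance c/(2b), the other half for polynomial growth of the integrand and its
derivative. The moment is assumed at a neighbour x' of x₀ because it is known only at almost every
point. -/
theorem hasFDerivAt_tilt_integral {H : Type*} [NormedAddCommGroup H] [NormedSpace ℝ H]
    [CompleteSpace H] (hg : Measurable g) (g0 : ∀ y, 0 ≤ g y) (hb : 0 < b) (hc : 0 < c)
    (hx' : ‖x₀ - x'‖ < c / (4 * b))
    (hint : Integrable (fun y => Real.exp (c * ‖y‖) * tilt b u g x' y) mu)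
    {F : Rn d → H} (hF : StronglyMeasurable F) {C : ℝ} {k : ℕ}
    (hFb : ∀ y, ‖F y‖ ≤ C * (1 + ‖y‖) ^ k) :
    Integrable (fun y => tilt b u g x₀ y • F y) mu ∧
    HasFDerivAt (fun x => ∫ y, tilt b u g x y • F y ∂mu)
      (∫ y, tilt b u g x₀ y • (b • (innerSL ℝ y).smulRight (F y)) ∂mu) x₀ := by
  have hC : 0 ≤ C := by simpa using (norm_nonneg _).trans (hFb 0)
  have tm : ∀ x, Measurable (tilt b u g x) := fun x => by unfold tilt; fun_prop
  have t0 : ∀ x y, 0 ≤ tilt b u g x y := fun x y => mul_nonneg (Real.exp_pos _).le (g0 y)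
  set s := ball x' (c / (2 * b)) with hs
  have hxs : x₀ ∈ ball x' (c / (2 * b)) := by
    rw [mem_ball, dist_eq_norm]
    refine hx'.trans_le ?_
    rw [div_le_div_iff₀ (by positivity) (by positivity)]
    nlinarith
  have hsn : s ∈ nhds x₀ := isOpen_ball.mem_nhds hxs
  have htl : ∀ x ∈ s, ∀ y, tilt b u g x y ≤ Real.exp (c / 2 * ‖y‖) * tilt b u g x' y := by
    intro x hx y
    unfold tilt
    rw [← mul_assoc, ← Real.exp_add]
    refine mul_le_mul_of_nonneg_right (Real.exp_le_exp.2 ?_) (g0 y)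
    have e : inner ℝ (x - u) y = inner ℝ (x - x') y + inner ℝ (x' - u) y := by
      rw [← inner_add_left, sub_add_sub_cancel]
    rw [e, mul_add]
    rw [mem_ball, dist_eq_norm, lt_div_iff₀ (by positivity)] at hx
    have h1 := real_inner_le_norm (x - x') y
    have h2 : b * inner ℝ (x - x') y ≤ b * (‖x - x'‖ * ‖y‖) := by gcongr
    have h3 : b * (‖x - x'‖ * ‖y‖) ≤ c / 2 * ‖y‖ := by
      rw [← mul_assoc]; gcongr; linarith
    linarith
  have hpoly : ∀ (n : ℕ), ∃ A : ℝ, 0 ≤ A ∧ ∀ x ∈ s, ∀ y, tilt b u g x y * (1 + ‖y‖) ^ n ≤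
      A * (Real.exp (c * ‖y‖) * tilt b u g x' y) := by
    intro n
    refine ⟨n.factorial * ((c / 2) ^ n)⁻¹ * Real.exp (c / 2), by positivity, fun x hx y => ?_⟩
    have h1 := one_add_pow_le_exp (a := c / 2) (t := ‖y‖) (by positivity) (norm_nonneg y) n
    calc tilt b u g x y * (1 + ‖y‖) ^ n ≤ (Real.exp (c / 2 * ‖y‖) * tilt b u g x' y) *
          ((n.factorial * ((c / 2) ^ n)⁻¹ * Real.exp (c / 2)) * Real.exp (c / 2 * ‖y‖)) := by
          refine mul_le_mul (htl x hx y) h1 (by positivity) (mul_nonneg (by positivity) (t0 _ _))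
      _ = (n.factorial * ((c / 2) ^ n)⁻¹ * Real.exp (c / 2)) *
          ((Real.exp (c / 2 * ‖y‖) * Real.exp (c / 2 * ‖y‖)) * tilt b u g x' y) := by ring
      _ = _ := by rw [← Real.exp_add]; ring_nf
  have hmeas : ∀ x, AEStronglyMeasurable (fun y => tilt b u g x y • F y) mu := fun x =>
    ((tm x).stronglyMeasurable.smul hF).aestronglyMeasurable
  have hint0 : Integrable (fun y => tilt b u g x₀ y • F y) mu := by
    obtain ⟨A, hA, hAb⟩ := hpoly k
    refine (hint.const_mul (C * A)).mono' (hmeas x₀) (Filter.Eventually.of_forall fun y => ?_)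
    rw [norm_smul, Real.norm_eq_abs, abs_of_nonneg (t0 _ _)]
    calc tilt b u g x₀ y * ‖F y‖ ≤ tilt b u g x₀ y * (C * (1 + ‖y‖) ^ k) :=
          mul_le_mul_of_nonneg_left (hFb y) (t0 _ _)
      _ = C * (tilt b u g x₀ y * (1 + ‖y‖) ^ k) := by ring
      _ ≤ C * (A * (Real.exp (c * ‖y‖) * tilt b u g x' y)) := 
          mul_le_mul_of_nonneg_left (hAb x₀ hxs y) hC
      _ = _ := by ring
  refine ⟨hint0, ?_⟩
  obtain ⟨A, hA, hAb⟩ := hpoly (k + 1)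
  have hF' : StronglyMeasurable fun y : Rn d => b • (innerSL ℝ y).smulRight (F y) := by
    have h1 : Continuous fun q : (Rn d →L[ℝ] ℝ) × H => q.1.smulRight q.2 := by
      exact (ContinuousLinearMap.smulRightL ℝ (Rn d) H).continuous₂
    have h2 : StronglyMeasurable fun y : Rn d => (innerSL ℝ y, F y) :=
      (innerSL ℝ (E := Rn d)).continuous.stronglyMeasurable.prodMk hF
    exact (h1.comp_stronglyMeasurable h2).const_smul b
  refine hasFDerivAt_integral_of_dominated_of_fderiv_le
    (F' := fun x y => tilt b u g x y • (b • (innerSL ℝ y).smulRight (F y)))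
    (bound := fun y => (b * C * A) * (Real.exp (c * ‖y‖) * tilt b u g x' y)) hsn
    (Filter.Eventually.of_forall hmeas) hint0 ?_ ?_ (hint.const_mul _) ?_
  · exact ((tm x₀).stronglyMeasurable.smul hF').aestronglyMeasurable
  · refine Filter.Eventually.of_forall fun y x hx => ?_
    rw [norm_smul, norm_smul, ContinuousLinearMap.norm_smulRight_apply, innerSL_apply_norm,
      Real.norm_eq_abs, Real.norm_eq_abs, abs_of_nonneg (t0 _ _), abs_of_pos hb]
    calc tilt b u g x y * (b * (‖y‖ * ‖F y‖))
        ≤ tilt b u g x y * (b * ((1 + ‖y‖) * (C * (1 + ‖y‖) ^ k))) := by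
          refine mul_le_mul_of_nonneg_left ?_ (t0 _ _)
          gcongr
          · linarith
          · exact hFb y
      _ = b * C * (tilt b u g x y * (1 + ‖y‖) ^ (k + 1)) := by ring
      _ ≤ b * C * (A * (Real.exp (c * ‖y‖) * tilt b u g x' y)) := 
          mul_le_mul_of_nonneg_left (hAb x hx y) (by positivity)
      _ = _ := by ring
  · refine Filter.Eventually.of_forall fun y x _ => ?_
    have h1 : HasFDerivAt (fun x : Rn d => inner ℝ (x - u) y) (innerSL ℝ y) x := by
      have h2 : (fun x : Rn d => inner ℝ (x - u) y) = fun x => innerSL ℝ y x - innerSL ℝ y u := by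
        funext x; simp [inner_sub_left, real_inner_comm]
      rw [h2]
      exact ((innerSL ℝ y).hasFDerivAt).sub_const _
    have h3 := (((h1.const_mul b).exp).mul_const (g y)).smul_const (F y)
    refine h3.congr_fderiv ?_
    ext v
    simp [tilt, smul_smul]
    ring_nf

end tilt

theorem contDiffOn_one_of_hasFDerivAt {E F : Type*} [NormedAddCommGroup E] [NormedSpace ℝ E]
    [NormedAddCommGroup F] [NormedSpace ℝ F] {s : Set E} {f : E → F} {f' : E → E →L[ℝ] F}
    (hs : IsOpen s) (h : ∀ x ∈ s, HasFDerivAt f (f' x) x) (hc : ContinuousOn f' s) :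
    ContDiffOn ℝ 1 f s := by
  have : (1 : WithTop ℕ∞) = 0 + 1 := rfl
  rw [this, contDiffOn_succ_iff_fderiv_of_isOpen hs]
  refine ⟨fun x hx => (h x hx).differentiableAt.differentiableWithinAt, by simp, ?_⟩
  rw [contDiffOn_zero]
  exact hc.congr fun x hx => (h x hx).fderiv

theorem exists_near_of_ae {d : ℕ} {U : Set (Rn d)} (hU : IsOpen U) {Q : Rn d → Prop}
    (h : ∀ᵐ x ∂(volume.restrict U), Q x) {x₀ : Rn d} (hx₀ : x₀ ∈ U) {η : ℝ} (hη : 0 < η) :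
    ∃ x ∈ U, dist x x₀ < η ∧ Q x := by
  by_contra hn
  push Not at hn
  have h1 : (volume : Measure (Rn d)) (U ∩ ball x₀ η) = 0 := by
    rw [ae_restrict_iff' hU.measurableSet] at h
    have h' := ae_iff.1 h
    exact measure_mono_null (fun x hx => show ¬ (x ∈ U → Q x) from
      fun hmem => hn x hx.1 hx.2 (hmem hx.1)) h'
  exact ((hU.inter isOpen_ball).measure_pos volume ⟨x₀, hx₀, mem_ball_self hη⟩).ne' h1

set_option maxHeartbeats 1000000 in
-- The mean is J/I with tilted moments I, J. Its derivative involves normalised first and second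
-- moments, and |y|^k ≤ k! c^(-k) e^c e^(c|y|) bounds them by the tail. This holds at almost every
-- x; continuity of the derivative extends it to all x, and convexity of the ball turns it into a
-- Lipschitz bound.
theorem IsPlanDensity.regularMean_one {d : ℕ} {lam mu : Measure (Rn d)} [IsFiniteMeasure lam]
    [IsFiniteMeasure mu] {z : Rn d × Rn d → ℝ} (h : IsPlanDensity lam mu z) {b c K₀ m M r : ℝ}
    (hb : 0 < b) (hc : 0 < c) (hm : 0 < m) (hr : 0 < r) (hlam : VolBetween lam m M r)
    (hcyc : ExpCycle b lam mu z)
    (htail : ∀ᵐ x ∂lam, x ∈ ball (0 : Rn d) (r / 3) →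
      ∫⁻ y, ENNReal.ofReal (Real.exp (c * ‖y‖) * z (x, y)) ∂mu ≤ ENNReal.ofReal K₀) :
    RegularMean 1 (r / 3) (Real.toNNReal (b * (2 * (c ^ 2)⁻¹ * Real.exp c * K₀) +
      b * (c⁻¹ * Real.exp c * K₀) ^ 2)) mu z := by
  set U := ball (0 : Rn d) (r / 3) with hU
  have hzm := h.meas
  have hUr : U ⊆ ball 0 r := ball_subset_ball (by linarith)
  have toU : ∀ {Q : Rn d → Prop}, (∀ᵐ x ∂lam, Q x) → ∀ᵐ x ∂(volume.restrict U), Q x :=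
    fun hQ => hlam.ae_volume hm hQ measurableSet_ball hUr
  -- A base slice: almost every other slice is a tilt of this one times a constant that cancels in
  -- the mean.
  obtain ⟨u, -, -, hu, hu1⟩ := exists_near_of_ae isOpen_ball
    (toU ((h.exp_representation hcyc).and h.fst))
    (mem_ball_self (x := (0 : Rn d)) (show 0 < r / 3 by positivity)) one_pos
  set g : Rn d → ℝ := fun y => z (u, y) with hg
  have hgm : Measurable g := by rw [hg]; fun_prop
  have g0 : ∀ y, 0 ≤ g y := fun y => h.nonneg _
  have t0 : ∀ x y, 0 ≤ tilt b u g x y := fun x y => mul_nonneg (Real.exp_pos _).le (g0 y)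
  have tm : ∀ x, Measurable (tilt b u g x) := fun x => by unfold tilt; fun_prop
  have hgood : ∀ᵐ x ∂(volume.restrict U), x ∈ U ∧
      ∫⁻ y, ENNReal.ofReal (z (x, y)) ∂mu = 1 ∧
      (∫⁻ y, ENNReal.ofReal (Real.exp (c * ‖y‖) * z (x, y)) ∂mu ≤ ENNReal.ofReal K₀) ∧
      ∃ c' : ℝ, 0 < c' ∧ ∀ᵐ y ∂mu, z (x, y) = c' * tilt b u g x y := by
    filter_upwards [toU hu, toU htail, toU h.fst, ae_restrict_mem measurableSet_ball]
      with x h1 h2 h3 h4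
    exact ⟨h4, h3, h2 h4, h1⟩
  have zint : ∀ x, ∫⁻ y, ENNReal.ofReal (Real.exp (c * ‖y‖) * z (x, y)) ∂mu ≤ ENNReal.ofReal K₀ →
      Integrable (fun y => Real.exp (c * ‖y‖) * z (x, y)) mu := by
    intro x hx
    refine ⟨(by fun_prop : Measurable _).aestronglyMeasurable, ?_⟩
    rw [hasFiniteIntegral_iff_ofReal (Filter.Eventually.of_forall fun y =>
      mul_nonneg (Real.exp_pos _).le (h.nonneg _))]
    exact hx.trans_lt ENNReal.ofReal_lt_top
  have tint : ∀ x, (∃ c' : ℝ, 0 < c' ∧ ∀ᵐ y ∂mu, z (x, y) = c' * tilt b u g x y) →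
      Integrable (fun y => Real.exp (c * ‖y‖) * z (x, y)) mu →
      Integrable (fun y => Real.exp (c * ‖y‖) * tilt b u g x y) mu := by
    rintro x ⟨c', hc', hz⟩ hi
    refine (hi.const_mul c'⁻¹).congr (hz.mono fun y hy => ?_)
    simp only [hy]; field_simp
  have main : ∀ {H : Type} [NormedAddCommGroup H] [NormedSpace ℝ H] [CompleteSpace H]
      {F : Rn d → H}, StronglyMeasurable F → ∀ {C : ℝ} {k : ℕ},
      (∀ y, ‖F y‖ ≤ C * (1 + ‖y‖) ^ k) → ∀ x ∈ U,
      Integrable (fun y => tilt b u g x y • F y) mu ∧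
      HasFDerivAt (fun x => ∫ y, tilt b u g x y • F y ∂mu)
      (∫ y, tilt b u g x y • (b • (innerSL ℝ y).smulRight (F y)) ∂mu) x := by
    intro H _ _ _ F hF C k hFb x hx
    obtain ⟨x', -, hd, -, -, h2, h3⟩ := exists_near_of_ae isOpen_ball hgood hx
      (η := c / (4 * b)) (by positivity)
    rw [dist_comm, dist_eq_norm] at hd
    exact hasFDerivAt_tilt_integral hgm g0 hb hc hd (tint x' h3 (zint x' h2)) hF hFb
  have m0 : StronglyMeasurable fun _ : Rn d => (1 : ℝ) := stronglyMeasurable_const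
  have m1 : StronglyMeasurable fun y : Rn d => y := stronglyMeasurable_id
  have m0' : StronglyMeasurable fun y : Rn d => b • (innerSL ℝ y).smulRight (1 : ℝ) := by
    have : Continuous fun y : Rn d => b • (innerSL ℝ y).smulRight (1 : ℝ) := by
      have h1 := (ContinuousLinearMap.smulRightL ℝ (Rn d) ℝ).continuous₂
      exact (h1.comp ((innerSL ℝ (E := Rn d)).continuous.prodMk continuous_const)).const_smul b
    exact this.stronglyMeasurable
  have m1' : StronglyMeasurable fun y : Rn d => b • (innerSL ℝ y).smulRight y := by
    have : Continuous fun y : Rn d => b • (innerSL ℝ y).smulRight y := by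
      have h1 := (ContinuousLinearMap.smulRightL ℝ (Rn d) (Rn d)).continuous₂
      exact (h1.comp ((innerSL ℝ (E := Rn d)).continuous.prodMk continuous_id)).const_smul b
    exact this.stronglyMeasurable
  have n0' : ∀ y : Rn d, ‖b • (innerSL ℝ y).smulRight (1 : ℝ)‖ = b * ‖y‖ := by
    intro y
    rw [norm_smul, ContinuousLinearMap.norm_smulRight_apply, innerSL_apply_norm, norm_one,
      Real.norm_eq_abs, abs_of_pos hb, mul_one]
  have n1' : ∀ y : Rn d, ‖b • (innerSL ℝ y).smulRight y‖ = b * (‖y‖ * ‖y‖) := by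
    intro y
    rw [norm_smul, ContinuousLinearMap.norm_smulRight_apply, innerSL_apply_norm,
      Real.norm_eq_abs, abs_of_pos hb]
  have D0 := fun x hx => main m0 (C := 1) (k := 0) (fun y => by simp) x hx
  have D1 := fun x hx => main m1 (C := 1) (k := 1) (fun y => by
    have := norm_nonneg y; rw [pow_one]; linarith) x hx
  have D0' := fun x hx => main m0' (C := b) (k := 1) (fun y => by
    rw [n0', pow_one]; gcongr; linarith) x hx
  have D1' := fun x hx => main m1' (C := b) (k := 2) (fun y => by
    rw [n1', sq]; have := norm_nonneg y; gcongr <;> linarith) x hx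
  set I : Rn d → ℝ := fun x => ∫ y, tilt b u g x y • (1 : ℝ) ∂mu with hI
  set J : Rn d → Rn d := fun x => ∫ y, tilt b u g x y • y ∂mu with hJ
  set I' := fun x => ∫ y, tilt b u g x y • (b • (innerSL ℝ y).smulRight (1 : ℝ)) ∂mu with hI'
  set J' := fun x => ∫ y, tilt b u g x y • (b • (innerSL ℝ y).smulRight y) ∂mu with hJ'
  have cI : ContDiffOn ℝ 1 I U := contDiffOn_one_of_hasFDerivAt isOpen_ball
    (fun x hx => (D0 x hx).2) fun x hx => (D0' x hx).2.continuousAt.continuousWithinAt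
  have cJ : ContDiffOn ℝ 1 J U := contDiffOn_one_of_hasFDerivAt isOpen_ball
    (fun x hx => (D1 x hx).2) fun x hx => (D1' x hx).2.continuousAt.continuousWithinAt
  have Ipos : ∀ x ∈ U, 0 < I x := by
    intro x hx
    have hi := (D0 x hx).1
    refine lt_of_le_of_ne (integral_nonneg fun y => by simpa using t0 x y) (Ne.symm fun h0 => ?_)
    have h1 := (integral_eq_zero_iff_of_nonneg (fun y => by simpa using t0 x y) hi).1 h0
    refine exists_ae_pos_of_lintegral hu1 (h1.mono fun y hy => ?_)
    simp only [tilt, smul_eq_mul, mul_one, Pi.zero_apply, mul_eq_zero, Real.exp_ne_zero,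
      false_or] at hy
    show ¬ (0 < z (u, y))
    have hy' : z (u, y) = 0 := hy
    rw [hy']; exact lt_irrefl _
  set T : Rn d → Rn d := fun x => (I x)⁻¹ • J x with hT
  have cT : ContDiffOn ℝ 1 T U := (cI.inv fun x hx => (Ipos x hx).ne').smul cJ
  have good_int : ∀ x ∈ U, ∀ c' : ℝ, 0 < c' → (∀ᵐ y ∂mu, z (x, y) = c' * tilt b u g x y) →
      Integrable (fun y => weight 1 (z (x, y))) mu ∧
      Integrable (fun y => weight 1 (z (x, y)) • y) mu ∧
      ∫ y, weight 1 (z (x, y)) ∂mu = c' * I x ∧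
      ∫ y, weight 1 (z (x, y)) • y ∂mu = c' • J x := by
    intro x hx c' hc' hz
    have e0 : (fun y => weight 1 (z (x, y))) =ᵐ[mu] fun y => c' * (tilt b u g x y • (1 : ℝ)) :=
      hz.mono fun y hy => by
        simp only [weight_one (h.nonneg _)]; rw [hy, smul_eq_mul, mul_one]
    have e1 : (fun y => weight 1 (z (x, y)) • y) =ᵐ[mu] fun y => c' • (tilt b u g x y • y) :=
      hz.mono fun y hy => by
        simp only [weight_one (h.nonneg _)]; rw [hy, smul_smul]
    refine ⟨((D0 x hx).1.const_mul c').congr e0.symm, ((D1 x hx).1.smul c').congr e1.symm, ?_, ?_⟩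
    · rw [integral_congr_ae e0, integral_const_mul]
    · rw [integral_congr_ae e1, integral_smul]
  refine ⟨?_, T, ?_, ?_, fun _ => cT⟩
  · filter_upwards [hgood] with x ⟨hxU, _, _, c', hc', hz⟩
    obtain ⟨h1, h2, h3, -⟩ := good_int x hxU c' hc' hz
    exact ⟨h1, h2, by rw [h3]; exact mul_pos hc' (Ipos x hxU)⟩
  · filter_upwards [hgood] with x ⟨hxU, _, _, c', hc', hz⟩
    obtain ⟨-, -, h3, h4⟩ := good_int x hxU c' hc' hz
    rw [h3, h4, hT, smul_smul, mul_inv, mul_right_comm, inv_mul_cancel₀ hc'.ne', one_mul]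
  · set K := b * (2 * (c ^ 2)⁻¹ * Real.exp c * K₀) + b * (c⁻¹ * Real.exp c * K₀) ^ 2 with hK
    have hder : ∀ x ∈ U, HasFDerivAt T ((I x)⁻¹ • J' x +
        ((-(I x ^ 2)⁻¹) • I' x).smulRight (J x)) x := fun x hx =>
      ((hasDerivAt_inv (Ipos x hx).ne').comp_hasFDerivAt x (D0 x hx).2).smul (D1 x hx).2
    have hbound : ∀ᵐ x ∂(volume.restrict U), ‖fderiv ℝ T x‖ ≤ K := by
      filter_upwards [hgood] with x ⟨hxU, hx1, hx2, c', hc', hz⟩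
      rw [(hder x hxU).fderiv]
      have hi := zint x hx2
      have hE : ∫ y, Real.exp (c * ‖y‖) * z (x, y) ∂mu ≤ max K₀ 0 := by
        rw [integral_eq_lintegral_of_nonneg_ae (Filter.Eventually.of_forall fun y =>
          mul_nonneg (Real.exp_pos _).le (h.nonneg _)) hi.1]
        rw [← ENNReal.toReal_ofReal']
        exact ENNReal.toReal_mono ENNReal.ofReal_ne_top hx2
      have hI1 : c' * I x = 1 := by
        rw [← (good_int x hxU c' hc' hz).2.2.1]
        simp only [weight_one (h.nonneg _)]
        rw [integral_eq_lintegral_of_nonneg_ae (Filter.Eventually.of_forall fun y =>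
          h.nonneg _) (by fun_prop : Measurable _).aestronglyMeasurable, hx1, ENNReal.toReal_one]
      have hIinv : (I x)⁻¹ = c' := by
        rw [inv_eq_iff_eq_inv]; exact eq_inv_of_mul_eq_one_right hI1
      have hE1 : 1 ≤ ∫ y, Real.exp (c * ‖y‖) * z (x, y) ∂mu := by
        have h1 : (1 : ℝ≥0∞) ≤ ENNReal.ofReal (∫ y, Real.exp (c * ‖y‖) * z (x, y) ∂mu) := by
          rw [ofReal_integral_eq_lintegral_ofReal hi (Filter.Eventually.of_forall fun y =>
            mul_nonneg (Real.exp_pos _).le (h.nonneg _)), ← hx1]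
          refine lintegral_mono fun y => ENNReal.ofReal_le_ofReal ?_
          have := Real.one_le_exp (mul_nonneg hc.le (norm_nonneg y))
          nlinarith [h.nonneg (x, y)]
        rwa [ENNReal.one_le_ofReal] at h1
      have hK0 : 0 < K₀ := by
        by_contra hn
        rw [max_eq_right (not_lt.1 hn)] at hE
        linarith
      rw [max_eq_left hK0.le] at hE
      have mom : ∀ {H : Type} [NormedAddCommGroup H] [NormedSpace ℝ H] (F : Rn d → H) (A : ℝ),
          0 ≤ A → (∀ y, ‖F y‖ ≤ A * Real.exp (c * ‖y‖)) →
          ‖∫ y, tilt b u g x y • F y ∂mu‖ ≤ c'⁻¹ * (A * K₀) := by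
        intro H _ _ F A hA hF
        have h1 := norm_integral_le_of_norm_le (f := fun y => tilt b u g x y • F y)
          (hi.const_mul (c'⁻¹ * A)) (hz.mono fun y hy => by
            rw [norm_smul, Real.norm_eq_abs, abs_of_nonneg (t0 x y), hy]
            calc tilt b u g x y * ‖F y‖ ≤ tilt b u g x y * (A * Real.exp (c * ‖y‖)) :=
                  mul_le_mul_of_nonneg_left (hF y) (t0 x y)
              _ = _ := by field_simp)
        refine h1.trans ?_
        rw [integral_const_mul, mul_assoc]
        gcongr
      have pw : ∀ (k : ℕ) (y : Rn d), ‖y‖ ^ k ≤ (k.factorial * (c ^ k)⁻¹ * Real.exp c) *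
          Real.exp (c * ‖y‖) := fun k y =>
        (pow_le_pow_left₀ (norm_nonneg y) (by linarith) k).trans
          (one_add_pow_le_exp hc (norm_nonneg y) k)
      have pw1 := fun y => pw 1 y
      have pw2 := fun y => pw 2 y
      simp only [Nat.factorial_one, Nat.factorial_two, Nat.cast_one, Nat.cast_ofNat, pow_one,
        one_mul] at pw1 pw2
      have bJ' : ‖J' x‖ ≤ c'⁻¹ * (b * (2 * (c ^ 2)⁻¹ * Real.exp c) * K₀) :=
        mom _ _ (by positivity) fun y => by
          rw [n1', mul_assoc b, ← sq]; exact mul_le_mul_of_nonneg_left (pw2 y) hb.le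
      have bI' : ‖I' x‖ ≤ c'⁻¹ * (b * (c⁻¹ * Real.exp c) * K₀) :=
        mom _ _ (by positivity) fun y => by
          rw [n0', mul_assoc b]; exact mul_le_mul_of_nonneg_left (pw1 y) hb.le
      have bJ : ‖J x‖ ≤ c'⁻¹ * ((c⁻¹ * Real.exp c) * K₀) := mom _ _ (by positivity) pw1
      refine (norm_add_le _ _).trans (add_le_add ?_ ?_)
      · rw [norm_smul, hIinv, Real.norm_eq_abs, abs_of_pos hc']
        calc c' * ‖J' x‖ ≤ c' * (c'⁻¹ * (b * (2 * (c ^ 2)⁻¹ * Real.exp c) * K₀)) := by gcongr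
          _ = _ := by field_simp
      · rw [ContinuousLinearMap.norm_smulRight_apply, norm_smul, norm_neg, ← inv_pow, hIinv,
          Real.norm_eq_abs, abs_of_pos (by positivity)]
        calc c' ^ 2 * ‖I' x‖ * ‖J x‖ ≤ c' ^ 2 * (c'⁻¹ * (b * (c⁻¹ * Real.exp c) * K₀)) *
              (c'⁻¹ * ((c⁻¹ * Real.exp c) * K₀)) := by gcongr
          _ = _ := by field_simp
    have hcont : ContinuousOn (fun x => ‖fderiv ℝ T x‖) U :=
      (cT.continuousOn_fderiv_of_isOpen isOpen_ball le_rfl).norm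
    have hall : ∀ x ∈ U, ‖fderiv ℝ T x‖ ≤ K := by
      intro x hx
      by_contra hn
      rw [not_le] at hn
      obtain ⟨η, hη, hηU⟩ := Metric.continuousWithinAt_iff.1 (hcont x hx) _ (sub_pos.2 hn)
      obtain ⟨x', hx'U, hd, hle⟩ := exists_near_of_ae isOpen_ball hbound hx hη
      have := hηU hx'U hd
      rw [Real.dist_eq, abs_lt] at this
      linarith [this.1]
    refine Convex.lipschitzOnWith_of_nnnorm_fderiv_le (𝕜 := ℝ)
      (fun x hx => (hder x hx).differentiableAt) (fun x hx => ?_) (convex_ball 0 (r / 3))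
    rw [← NNReal.coe_le_coe, coe_nnnorm]
    exact (hall x hx).trans (Real.le_coe_toNNReal K)

/-! ### The case p > 1: Lipschitz continuity and concavity of the power of the density -/

/-- Converts marginal constraints into pointwise comparisons: two slices of equal finite mass that
are ordered agree almost everywhere, so the order cannot be strict on the non-null set where `f` is
positive. -/
theorem not_ae_lt_of_lintegral_eq_one {α : Type*} [MeasurableSpace α] {ν : Measure α}
    {f g : α → ℝ} (hg : Measurable g) (hg0 : ∀ x, 0 ≤ g x)
    (hf1 : ∫⁻ x, ENNReal.ofReal (f x) ∂ν = 1) (hg1 : ∫⁻ x, ENNReal.ofReal (g x) ∂ν = 1)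
    (h : ∀ᵐ x ∂ν, 0 < f x → f x < g x) : False := by
  have hle : (fun x => ENNReal.ofReal (f x)) ≤ᵐ[ν] fun x => ENNReal.ofReal (g x) := by
    filter_upwards [h] with x hx
    rcases lt_or_ge 0 (f x) with h0 | h0
    · exact ENNReal.ofReal_le_ofReal (hx h0).le
    · simp [ENNReal.ofReal_of_nonpos h0]
  have heq := ae_eq_of_ae_le_of_lintegral_le hle (by rw [hf1]; exact ENNReal.one_ne_top)
    hg.ennreal_ofReal.aemeasurable (by rw [hf1, hg1])
  refine exists_ae_pos_of_lintegral hf1 ?_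
  filter_upwards [heq, h] with x hx hx2 h0
  rw [ENNReal.ofReal_eq_ofReal_iff h0.le (hg0 x)] at hx
  exact (hx2 h0).ne hx

theorem forall_of_ae_of_closed {d : ℕ} {U : Set (Rn d)} (hU : IsOpen U) {Q : Rn d → Prop}
    (h : ∀ᵐ x ∂(volume.restrict U), Q x)
    (hcl : ∀ (u : ℕ → Rn d), ∀ x ∈ U, (∀ n, u n ∈ U) →
      Filter.Tendsto u Filter.atTop (nhds x) → (∀ n, Q (u n)) → Q x) : ∀ x ∈ U, Q x := by
  intro x hx
  have hη : ∀ n : ℕ, (0 : ℝ) < 1 / ((n : ℝ) + 1) := fun n => by positivity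
  choose u huU hud hQ using fun n : ℕ => exists_near_of_ae hU h hx (hη n)
  exact hcl u x hx huU (tendsto_iff_dist_tendsto_zero.2 (squeeze_zero (fun _ => dist_nonneg)
    (fun n => (hud n).le) tendsto_one_div_add_atTop_nhds_zero_nat)) hQ

theorem forall_ae_of_ae_ae {d : ℕ} {Ω : Type*} [MeasurableSpace Ω] {ν : Measure Ω}
    {U : Set (Rn d)} (hU : IsOpen U) {Q : Rn d → Ω → Prop}
    (h : ∀ᵐ x ∂(volume.restrict U), ∀ᵐ ω ∂ν, Q x ω)
    (hcl : ∀ ω (u : ℕ → Rn d), ∀ x ∈ U, (∀ n, u n ∈ U) →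
      Filter.Tendsto u Filter.atTop (nhds x) → (∀ n, Q (u n) ω) → Q x ω) :
    ∀ x ∈ U, ∀ᵐ ω ∂ν, Q x ω :=
  forall_of_ae_of_closed hU h fun u x hx hu hlim hQ => by
    filter_upwards [ae_all_iff.2 hQ] with ω hω
    exact hcl ω u x hx hu hlim hω

theorem VolBetween.absolutelyContinuous {d : ℕ} {ν : Measure (Rn d)} {m M r : ℝ} (hm : 0 < m)
    (h : VolBetween ν m M r) : (volume : Measure (Rn d)).restrict (ball 0 r) ≪ ν := by
  rw [← Measure.ae_le_iff_absolutelyContinuous]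
  intro A hA
  exact h.ae_volume hm (T := fun x => x ∈ A) hA measurableSet_ball subset_rfl

/-- The map is an invertible linear shear of the product, so null sets pull back to null sets. This
permits evaluating almost-everywhere statements at convex combinations. -/
theorem quasiMeasurePreserving_convexComb {d : ℕ} {θ : ℝ} (h0 : 0 < θ) (h1 : θ < 1)
    {B : Set (Rn d)} (hB : Convex ℝ B) :
    Measure.QuasiMeasurePreserving (fun q : Rn d × Rn d => (q.1, (1 - θ) • q.1 + θ • q.2))
      ((volume.restrict B).prod (volume.restrict B))
      ((volume.restrict B).prod (volume.restrict B)) := by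
  let e : (Rn d × Rn d) ≃ₗ[ℝ] (Rn d × Rn d) :=
    { toFun := fun q => (q.1, (1 - θ) • q.1 + θ • q.2)
      map_add' := fun a b => by
        ext1
        · rfl
        · simp only [Prod.fst_add, Prod.snd_add, smul_add]; abel
      map_smul' := fun c a => by
        ext1
        · rfl
        · simp only [Prod.smul_fst, Prod.smul_snd, smul_add, smul_comm c, RingHom.id_apply]
      invFun := fun q => (q.1, θ⁻¹ • (q.2 - (1 - θ) • q.1))
      left_inv := fun q => by
        ext1
        · rfl
        · simp only [add_sub_cancel_left, smul_smul, inv_mul_cancel₀ h0.ne', one_smul]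
      right_inv := fun q => by
        ext1
        · rfl
        · simp only [smul_smul, mul_inv_cancel₀ h0.ne', one_smul, add_sub_cancel] }
  have hdet : LinearMap.det (e : (Rn d × Rn d) →ₗ[ℝ] (Rn d × Rn d)) ≠ 0 :=
    (LinearEquiv.isUnit_det' e).ne_zero
  have hq := Measure.LinearMap.quasiMeasurePreserving
    ((volume : Measure (Rn d)).prod volume) (e : (Rn d × Rn d) →ₗ[ℝ] (Rn d × Rn d)) hdet
  rw [Measure.prod_restrict]
  refine hq.restrict ?_
  rintro ⟨a, c⟩ ⟨ha, hc⟩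
  exact ⟨ha, hB ha hc (by linarith) h0.le (by ring)⟩

section powers

variable {d : ℕ} {lam mu : Measure (Rn d)} [IsFiniteMeasure lam] [IsFiniteMeasure mu]
  {z : Rn d × Rn d → ℝ} {s b m M r V : ℝ}

/-- The slices have equal mass, so z(x₁, y') ≤ z(x₂, y') for a non-null set of y' in the support of
the second. The cycle inequality for (x₁, y), (x₂, y') then loses these two terms, leaving an inner
product at most 2r |x₁ - x₂|. -/
theorem IsPlanDensity.pow_lipschitz_of_cycle (h : IsPlanDensity lam mu z) (hs : 0 < s)
    (hb : 0 ≤ b) (hr : 0 < r) {x₁ x₂ : Rn d} (hi₁ : ∫⁻ y, ENNReal.ofReal (z (x₁, y)) ∂mu = 1)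
    (hi₂ : ∫⁻ y, ENNReal.ofReal (z (x₂, y)) ∂mu = 1)
    (hs₁ : ∀ᵐ y ∂mu, 0 < z (x₁, y) → y ∈ ball 0 r)
    (hs₂ : ∀ᵐ y ∂mu, 0 < z (x₂, y) → y ∈ ball 0 r)
    (hcyc : ∀ᵐ y ∂mu, ∀ᵐ y' ∂mu, 0 < z (x₁, y) → 0 < z (x₂, y') →
      z (x₁, y) ^ s + z (x₂, y') ^ s ≤ z (x₁, y') ^ s + z (x₂, y) ^ s +
        b * inner ℝ (x₁ - x₂) (y - y')) :
    ∀ᵐ y ∂mu, z (x₁, y) ^ s ≤ z (x₂, y) ^ s + 2 * b * r * dist x₁ x₂ := by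
  have hzm := h.meas
  have hfreq : ∃ᵐ y ∂mu, 0 < z (x₂, y) ∧ z (x₁, y) ≤ z (x₂, y) := by
    intro hn
    refine not_ae_lt_of_lintegral_eq_one (g := fun y => z (x₁, y)) (by fun_prop)
      (fun y => h.nonneg _) hi₂ hi₁ (hn.mono fun y hy h0 => ?_)
    by_contra hlt
    exact hy ⟨h0, not_lt.1 hlt⟩
  filter_upwards [hcyc, hs₁] with y hy hyr
  rcases (h.nonneg (x₁, y)).eq_or_lt with h0 | h0
  · rw [← h0, Real.zero_rpow hs.ne']
    have := Real.rpow_nonneg (h.nonneg (x₂, y)) s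
    have := dist_nonneg (x := x₁) (y := x₂)
    positivity
  · obtain ⟨y', ⟨hp, hle⟩, hc, hr'⟩ := (hfreq.and_eventually (hy.and hs₂)).exists
    have h1 := hc h0 hp
    have h2 := Real.rpow_le_rpow (h.nonneg _) hle hs.le
    have h3 : inner ℝ (x₁ - x₂) (y - y') ≤ dist x₁ x₂ * (2 * r) := by
      refine (real_inner_le_norm _ _).trans ?_
      rw [dist_eq_norm]
      refine mul_le_mul_of_nonneg_left ?_ (norm_nonneg _)
      have h4 := hyr h0
      have h5 := hr' hp
      rw [mem_ball_zero_iff] at h4 h5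
      exact (norm_sub_le _ _).trans (by linarith)
    have h6 := mul_le_mul_of_nonneg_left h3 hb
    linarith

theorem IsPlanDensity.pow_lipschitz (h : IsPlanDensity lam mu z) (hs : 0 < s) (hb : 0 ≤ b)
    (hr : 0 < r) (hcyc : PowCycle s b lam mu z)
    (hsupp : ∀ᵐ x ∂lam, x ∈ ball (0 : Rn d) (r / 3) → ∀ᵐ y ∂mu, 0 < z (x, y) → y ∈ ball 0 r) :
    ∀ᵐ x₁ ∂lam, ∀ᵐ x₂ ∂lam, x₁ ∈ ball (0 : Rn d) (r / 3) → x₂ ∈ ball (0 : Rn d) (r / 3) →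
      ∀ᵐ y ∂mu, |z (x₁, y) ^ s - z (x₂, y) ^ s| ≤ 2 * b * r * dist x₁ x₂ := by
  have hcyc' := ae_prod_swap mu (lam.prod lam) hcyc
  filter_upwards [Measure.ae_ae_of_ae_prod (Measure.ae_ae_of_ae_prod (hcyc.and hcyc')), h.fst,
    hsupp] with x₁ hx₁ hi₁ hs₁
  filter_upwards [hx₁, h.fst, hsupp] with x₂ hx₂ hi₂ hs₂ hU₁ hU₂
  have hx := Measure.ae_ae_of_ae_prod hx₂
  filter_upwards [h.pow_lipschitz_of_cycle hs hb hr hi₁ hi₂ (hs₁ hU₁) (hs₂ hU₂)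
      (hx.mono fun y hy => hy.mono fun y' hy' => hy'.1),
    h.pow_lipschitz_of_cycle hs hb hr hi₂ hi₁ (hs₂ hU₂) (hs₁ hU₁)
      (hx.mono fun y hy => hy.mono fun y' hy' p p' => by
        have h1 := hy'.2 p' p
        have h2 : inner ℝ (x₂ - x₁) (y - y') = inner ℝ (x₁ - x₂) (y' - y) := by
          rw [← neg_sub x₁ x₂, ← neg_sub y' y, inner_neg_neg]
        simp only [Prod.fst_swap, Prod.snd_swap] at h1
        rw [h2]
        linarith)] with y h1 h2
  rw [dist_comm] at h2
  rw [abs_le]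
  constructor <;> linarith

/-- Suppose concavity fails at x for y₀, y₁ and their combination yθ. Combining two cycle
inequalities transfers the strict failure to every x' with z(x', yθ) > 0, and convexity of t^(1/s)
gives z(x', yθ) < (1-θ) z(x', y₀) + θ z(x', y₁). Both sides have integral one in x', which is
impossible. -/
theorem IsPlanDensity.pow_concave (h : IsPlanDensity lam mu z) (hs : 0 < s) (hs1 : s ≤ 1)
    (hm : 0 < m) (hcyc : PowCycle s b lam mu z) (hmu : VolBetween mu m M r) {θ : ℝ} (h0 : 0 < θ)
    (h1 : θ < 1) :
    ∀ᵐ x ∂lam, ∀ᵐ q ∂(((volume : Measure (Rn d)).restrict (ball 0 r)).prod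
      ((volume : Measure (Rn d)).restrict (ball 0 r))), 0 < z (x, q.1) → 0 < z (x, q.2) →
      (1 - θ) * z (x, q.1) ^ s + θ * z (x, q.2) ^ s ≤
        z (x, (1 - θ) • q.1 + θ • q.2) ^ s := by
  have hzm := h.meas
  have hac := hmu.absolutelyContinuous hm
  have hQ := quasiMeasurePreserving_convexComb h0 h1 (convex_ball (0 : Rn d) r)
  have hQ' : Measure.QuasiMeasurePreserving
      (fun q : Rn d × Rn d => (q.2, (1 - θ) • q.1 + θ • q.2))
      ((volume.restrict (ball 0 r)).prod (volume.restrict (ball 0 r)))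
      ((volume.restrict (ball 0 r)).prod (volume.restrict (ball 0 r))) := by
    have h2 := (quasiMeasurePreserving_convexComb (θ := 1 - θ) (by linarith) (by linarith)
      (convex_ball (0 : Rn d) r)).comp
      (Measure.measurePreserving_swap (μ := volume.restrict (ball (0 : Rn d) r))
        (ν := volume.restrict (ball (0 : Rn d) r))).quasiMeasurePreserving
    convert h2 using 2 with q
    simp only [Function.comp, Prod.fst_swap, Prod.snd_swap, sub_sub_cancel]
    rw [add_comm]
  have hsnd : ∀ᵐ y ∂((volume : Measure (Rn d)).restrict (ball 0 r)),
    ∫⁻ x, ENNReal.ofReal (z (x, y)) ∂lam = 1 := hac.ae_le h.snd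
  filter_upwards [Measure.ae_ae_of_ae_prod (Measure.ae_ae_of_ae_prod hcyc)] with x hx
  have hswap : ∀ᵐ q ∂(mu.prod mu), ∀ᵐ x' ∂lam, 0 < z (x, q.1) → 0 < z (x', q.2) →
      z (x, q.1) ^ s + z (x', q.2) ^ s ≤ z (x, q.2) ^ s + z (x', q.1) ^ s +
        b * inner ℝ (x - x') (q.1 - q.2) := by
    refine (Measure.ae_ae_comm ?_).1 hx
    have e1 : Measurable fun a : Rn d × (Rn d × Rn d) => z (x, a.2.1) := by fun_prop
    have e2 : Measurable fun a : Rn d × (Rn d × Rn d) => z (a.1, a.2.2) := by fun_prop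
    have e3 : Measurable fun a : Rn d × (Rn d × Rn d) => z (x, a.2.2) := by fun_prop
    have e4 : Measurable fun a : Rn d × (Rn d × Rn d) => z (a.1, a.2.1) := by fun_prop
    refine (measurableSet_lt measurable_const e1).imp
      ((measurableSet_lt measurable_const e2).imp (measurableSet_le ?_ ?_)) <;> fun_prop
  have hswap' := (hac.prod hac).ae_le hswap
  have hmid := hQ.ae (Measure.quasiMeasurePreserving_snd.ae hsnd)
  filter_upwards [hQ.ae hswap', hQ'.ae hswap', Measure.quasiMeasurePreserving_fst.ae hsnd,
    Measure.quasiMeasurePreserving_snd.ae hsnd, hmid] with q c0 c1 i0 i1 iθ p0 p1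
  set yθ := (1 - θ) • q.1 + θ • q.2 with hyθ
  by_contra hn
  rw [not_le] at hn
  refine not_ae_lt_of_lintegral_eq_one (ν := lam) (f := fun x' => z (x', yθ))
    (g := fun x' => (1 - θ) * z (x', q.1) + θ * z (x', q.2)) (by fun_prop)
    (fun x' => add_nonneg (mul_nonneg (by linarith) (h.nonneg _)) (mul_nonneg h0.le (h.nonneg _)))
    iθ ?_ ?_
  · have e0 : ∀ x', ENNReal.ofReal ((1 - θ) * z (x', q.1) + θ * z (x', q.2)) =
        ENNReal.ofReal (1 - θ) * ENNReal.ofReal (z (x', q.1)) +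
        ENNReal.ofReal θ * ENNReal.ofReal (z (x', q.2)) := fun x' => by
      rw [ENNReal.ofReal_add (mul_nonneg (by linarith) (h.nonneg _))
        (mul_nonneg h0.le (h.nonneg _)), ENNReal.ofReal_mul (by linarith),
        ENNReal.ofReal_mul h0.le]
    simp only [e0]
    rw [lintegral_add_left (by fun_prop), lintegral_const_mul' _ _ ENNReal.ofReal_ne_top,
      lintegral_const_mul' _ _ ENNReal.ofReal_ne_top, i0, i1, mul_one, mul_one,
      ← ENNReal.ofReal_add (by linarith) h0.le]
    simp
  · filter_upwards [c0, c1] with x' d0 d1 hp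
    -- With weights 1 - θ and θ the two inner products cancel, since yθ is the corresponding
    -- barycentre.
    have k0 := mul_le_mul_of_nonneg_left (d0 p0 hp) (sub_nonneg.2 h1.le)
    have k1 := mul_le_mul_of_nonneg_left (d1 p1 hp) h0.le
    have g0 : q.1 - yθ = θ • (q.1 - q.2) := by rw [hyθ]; module
    have g1 : q.2 - yθ = -((1 - θ) • (q.1 - q.2)) := by rw [hyθ]; module
    rw [g0, inner_smul_right] at k0
    rw [g1, inner_neg_right, inner_smul_right] at k1
    have k2 : z (x', yθ) ^ s < (1 - θ) * z (x', q.1) ^ s + θ * z (x', q.2) ^ s := by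
      linarith
    have hcv := (convexOn_rpow (p := s⁻¹) ((one_le_inv₀ hs).2 hs1)).2
      (Real.rpow_nonneg (h.nonneg (x', q.1)) s : _ ∈ Ici (0 : ℝ))
      (Real.rpow_nonneg (h.nonneg (x', q.2)) s : _ ∈ Ici (0 : ℝ)) (sub_nonneg.2 h1.le) h0.le
      (by ring)
    have k3 := Real.rpow_lt_rpow (Real.rpow_nonneg (h.nonneg _) s) k2 (inv_pos.2 hs)
    simp only [smul_eq_mul] at hcv
    rw [Real.rpow_rpow_inv (h.nonneg _) hs.ne'] at k3
    rw [Real.rpow_rpow_inv (h.nonneg _) hs.ne', Real.rpow_rpow_inv (h.nonneg _) hs.ne'] at hcv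
    linarith

end powers

/-- A pointwise defined, regular representative of the power `s` of a plan density that is
localised in `B_r`. -/
structure IsProfile {d : ℕ} (mu : Measure (Rn d)) (s b V r : ℝ) (f : Rn d → Rn d → ℝ) :
    Prop where
  meas : ∀ x, Measurable (f x)
  nonneg : ∀ x y, 0 ≤ f x y
  le : ∀ x y, f x y ≤ V
  lip : ∀ x x' y, f x y ≤ f x' y + 2 * b * r * dist x x'
  supp : ∀ x, ∀ y ∉ ball (0 : Rn d) r, f x y = 0
  mass : ∀ x ∈ ball (0 : Rn d) (r / 3), ∫ y, f x y ^ s⁻¹ ∂mu = 1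
  cycle : ∀ x ∈ ball (0 : Rn d) (r / 3), ∀ x' ∈ ball (0 : Rn d) (r / 3), ∀ᵐ q ∂(mu.prod mu),
    0 < f x q.1 → 0 < f x' q.2 →
      f x q.1 + f x' q.2 ≤ f x q.2 + f x' q.1 + b * inner ℝ (x - x') (q.1 - q.2)
  concave : ∀ θ : ℝ, 0 < θ → θ < 1 → ∀ x ∈ ball (0 : Rn d) (r / 3),
    ∀ᵐ q ∂(((volume : Measure (Rn d)).restrict (ball 0 r)).prod
      ((volume : Measure (Rn d)).restrict (ball 0 r))), 0 < f x q.1 → 0 < f x q.2 →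
      (1 - θ) * f x q.1 + θ * f x q.2 ≤ f x ((1 - θ) • q.1 + θ • q.2)

theorem exists_dense_seq_of_ae {d : ℕ} {U : Set (Rn d)} (hU : IsOpen U) (hne : U.Nonempty)
    {Q : Rn d → Prop} (h : ∀ᵐ x ∂(volume.restrict U), Q x) :
    ∃ u : ℕ → Rn d, (∀ i, u i ∈ U ∧ Q (u i)) ∧ ∀ x ∈ U, ∀ η : ℝ, 0 < η → ∃ i, dist (u i) x < η := by
  set A : Set (Rn d) := {x | x ∈ U ∧ Q x} with hA
  obtain ⟨D, hDA, hDc, hDd⟩ := (TopologicalSpace.IsSeparable.of_separableSpace A).exists_countable_dense_subset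
  have hclose : ∀ x ∈ U, ∀ η : ℝ, 0 < η → ∃ y ∈ D, dist y x < η := by
    intro x hx η hη
    obtain ⟨a, haU, had, hQ⟩ := exists_near_of_ae hU h hx (half_pos hη)
    obtain ⟨y, hy, hyd⟩ := Metric.mem_closure_iff.1 (hDd (show a ∈ A from ⟨haU, hQ⟩)) _
      (half_pos hη)
    refine ⟨y, hy, (dist_triangle y a x).trans_lt ?_⟩
    rw [dist_comm] at hyd
    linarith
  obtain ⟨x₀, hx₀⟩ := hne
  obtain ⟨y₀, hy₀, -⟩ := hclose x₀ hx₀ 1 one_pos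
  obtain ⟨u, rfl⟩ := hDc.exists_eq_range ⟨y₀, hy₀⟩
  refine ⟨u, fun i => hDA ⟨i, rfl⟩, fun x hx η hη => ?_⟩
  obtain ⟨_, ⟨i, rfl⟩, hi⟩ := hclose x hx η hη
  exact ⟨i, hi⟩

section inf_convolution

variable {d : ℕ} {u : ℕ → Rn d} {v : Rn d → Rn d → ℝ} {L V r : ℝ}

/-- The largest function below `V` that is `L`-Lipschitz in `x` and lies below `v` at the points
`u i`, cut off outside `B_r`. -/
noncomputable def infConv (u : ℕ → Rn d) (v : Rn d → Rn d → ℝ) (L V r : ℝ) (x y : Rn d) : ℝ :=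
  (ball (0 : Rn d) r).indicator (fun y => min V (⨅ i, (v (u i) y + L * dist x (u i)))) y

theorem infConv_bdd (v0 : ∀ x y, 0 ≤ v x y) (hL : 0 ≤ L) (x y : Rn d) :
    BddBelow (range fun i => v (u i) y + L * dist x (u i)) :=
  ⟨0, by rintro _ ⟨i, rfl⟩; exact add_nonneg (v0 _ _) (mul_nonneg hL dist_nonneg)⟩

theorem infConv_nonneg (v0 : ∀ x y, 0 ≤ v x y) (hL : 0 ≤ L) (hV : 0 ≤ V) (x y : Rn d) :
    0 ≤ infConv u v L V r x y := by
  refine indicator_nonneg (fun y _ => le_min hV (le_ciInf fun i => ?_)) y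
  exact add_nonneg (v0 _ _) (mul_nonneg hL dist_nonneg)

theorem infConv_le (hV : 0 ≤ V) (x y : Rn d) : infConv u v L V r x y ≤ V := by
  unfold infConv
  by_cases h : y ∈ ball (0 : Rn d) r
  · rw [indicator_of_mem h]; exact min_le_left _ _
  · rwa [indicator_of_notMem h]

theorem infConv_lip (v0 : ∀ x y, 0 ≤ v x y) (hL : 0 ≤ L) (x x' y : Rn d) :
    infConv u v L V r x y ≤ infConv u v L V r x' y + L * dist x x' := by
  have hd : 0 ≤ L * dist x x' := mul_nonneg hL dist_nonneg
  unfold infConv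
  by_cases h : y ∈ ball (0 : Rn d) r
  · rw [indicator_of_mem h, indicator_of_mem h, ← min_add_add_right]
    refine le_min ((min_le_left _ _).trans (by linarith)) ((min_le_right _ _).trans ?_)
    rw [← sub_le_iff_le_add]
    refine le_ciInf fun i => ?_
    have h1 := ciInf_le (infConv_bdd (u := u) v0 hL x y) i
    have h2 := mul_le_mul_of_nonneg_left (dist_triangle x x' (u i)) hL
    linarith
  · rw [indicator_of_notMem h, indicator_of_notMem h]; linarith

theorem measurable_infConv (hv : ∀ x, Measurable (v x)) (x : Rn d) :
    Measurable (infConv u v L V r x) := by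
  unfold infConv
  exact (measurable_const.min (Measurable.iInf fun i => (hv (u i)).add_const _)).indicator
    measurableSet_ball

theorem infConv_eq (v0 : ∀ x y, 0 ≤ v x y) (hL : 0 ≤ L) {x y : Rn d}
    (hx : ∀ η : ℝ, 0 < η → ∃ i, dist (u i) x < η)
    (hlip : ∀ i, |v x y - v (u i) y| ≤ L * dist x (u i)) (hV : v x y ≤ V)
    (hsupp : y ∉ ball (0 : Rn d) r → v x y = 0) : infConv u v L V r x y = v x y := by
  unfold infConv
  by_cases h : y ∈ ball (0 : Rn d) r
  · rw [indicator_of_mem h]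
    have h1 : ⨅ i, (v (u i) y + L * dist x (u i)) = v x y := by
      refine le_antisymm (le_of_forall_pos_le_add fun η hη => ?_) (le_ciInf fun i => ?_)
      · obtain ⟨i, hi⟩ := hx (η / (2 * L + 1)) (by positivity)
        refine (ciInf_le (infConv_bdd v0 hL x y) i).trans ?_
        have h2 := (abs_le.1 (hlip i)).1
        rw [dist_comm, lt_div_iff₀ (by positivity)] at hi
        have h3 := dist_nonneg (x := x) (y := u i)
        nlinarith
      · have h2 := (abs_le.1 (hlip i)).2
        linarith
    rw [h1, min_eq_right hV]
  · rw [indicator_of_notMem h, hsupp h]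

end inf_convolution

theorem tendsto_of_lip {d : ℕ} {f : Rn d → Rn d → ℝ} {L : ℝ}
    (hlip : ∀ x x' y, f x y ≤ f x' y + L * dist x x') (y : Rn d) {u : ℕ → Rn d} {x : Rn d}
    (hu : Filter.Tendsto u Filter.atTop (nhds x)) :
    Filter.Tendsto (fun n => f (u n) y) Filter.atTop (nhds (f x y)) := by
  rw [tendsto_iff_dist_tendsto_zero] at hu ⊢
  refine squeeze_zero (fun _ => dist_nonneg) (fun n => ?_) (by simpa using hu.const_mul L)
  rw [Real.dist_eq, abs_le]
  have h1 := hlip (u n) x y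
  have h2 := hlip x (u n) y
  rw [dist_comm] at h2
  constructor <;> linarith

/-- The Lipschitz bound holds off null sets of y that depend on the two points x. McShane's formula
over a countable dense set of good points gives a version Lipschitz for every x and y, equal to z^s
almost everywhere; mass, cycle and concavity relations then extend from almost every x to all x by
continuity. -/
theorem IsPlanDensity.exists_profile {d : ℕ} {lam mu : Measure (Rn d)} [IsFiniteMeasure lam]
    [IsFiniteMeasure mu] {z : Rn d × Rn d → ℝ} {s b m M r V : ℝ} (h : IsPlanDensity lam mu z)
    (hs : 0 < s) (hs1 : s ≤ 1) (hb : 0 ≤ b) (hm : 0 < m) (hr : 0 < r) (hV : 0 ≤ V)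
    (hcyc : PowCycle s b lam mu z) (hlam : VolBetween lam m M r) (hmu : VolBetween mu m M r)
    (hloc : ∀ᵐ a ∂(lam.prod mu), a.1 ∈ ball (0 : Rn d) (r / 3) → 0 < z a →
      z a ^ s ≤ V ∧ dist a.2 a.1 < r / 3) :
    ∃ f, IsProfile mu s b V r f ∧
      ∀ᵐ x ∂(volume.restrict (ball (0 : Rn d) (r / 3))), ∀ᵐ y ∂mu, z (x, y) ^ s = f x y := by
  set U := ball (0 : Rn d) (r / 3) with hU
  have hUo : IsOpen U := isOpen_ball
  have hUr : U ⊆ ball 0 r := ball_subset_ball (by linarith)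
  have toU : ∀ {Q : Rn d → Prop}, (∀ᵐ x ∂lam, Q x) → ∀ᵐ x ∂(volume.restrict U), Q x :=
    fun hQ => hlam.ae_volume hm hQ measurableSet_ball hUr
  have hzm := h.meas
  set v : Rn d → Rn d → ℝ := fun x y => z (x, y) ^ s with hv
  have v0 : ∀ x y, 0 ≤ v x y := fun x y => Real.rpow_nonneg (h.nonneg _) s
  have vm : ∀ x, Measurable (v x) := fun x => by rw [hv]; fun_prop
  have vpos : ∀ {x y}, 0 < v x y → 0 < z (x, y) := by
    intro x y hxy
    refine lt_of_le_of_ne (h.nonneg _) fun h0 => ?_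
    simp only [hv, ← h0, Real.zero_rpow hs.ne', lt_irrefl] at hxy
  have vzero : ∀ {x y}, ¬ 0 < z (x, y) → v x y = 0 := by
    intro x y hxy
    have : z (x, y) = 0 := le_antisymm (not_lt.1 hxy) (h.nonneg _)
    simp only [hv, this, Real.zero_rpow hs.ne']
  have hL : 0 ≤ 2 * b * r := by positivity
  set L := 2 * b * r with hLdef
  have hloc' : ∀ᵐ x ∂lam, x ∈ U → ∀ᵐ y ∂mu, 0 < z (x, y) → v x y ≤ V ∧ y ∈ ball 0 r := by
    filter_upwards [Measure.ae_ae_of_ae_prod hloc] with x hx hxU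
    filter_upwards [hx] with y hy h0
    obtain ⟨h1, h2⟩ := hy hxU h0
    refine ⟨h1, ?_⟩
    rw [hU, mem_ball_zero_iff] at hxU
    rw [dist_eq_norm] at h2
    rw [mem_ball_zero_iff]
    have := norm_add_le (y - x) x
    rw [sub_add_cancel] at this
    linarith
  have hpl := h.pow_lipschitz hs hb hr hcyc (hloc'.mono fun x hx hxU =>
    (hx hxU).mono fun y hy h0 => (hy h0).2)
  have hgood : ∀ᵐ x ∂(volume.restrict U), x ∈ U ∧
      (∀ᵐ x' ∂(volume.restrict U), ∀ᵐ y ∂mu, |v x y - v x' y| ≤ L * dist x x') ∧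
      (∀ᵐ y ∂mu, 0 < z (x, y) → v x y ≤ V ∧ y ∈ ball 0 r) ∧
      ∫⁻ y, ENNReal.ofReal (z (x, y)) ∂mu = 1 := by
    filter_upwards [toU hpl, toU hloc', toU h.fst, ae_restrict_mem measurableSet_ball]
      with x h1 h2 h3 h4
    refine ⟨h4, ?_, h2 h4, h3⟩
    filter_upwards [toU h1, ae_restrict_mem measurableSet_ball] with x' h5 h6
    exact h5 h4 h6
  obtain ⟨u, hu, hdense⟩ := exists_dense_seq_of_ae hUo
    ⟨0, mem_ball_self (by positivity)⟩ hgood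
  have hpair : ∀ x ∈ U, (∀ᵐ x' ∂(volume.restrict U), ∀ᵐ y ∂mu, |v x y - v x' y| ≤ L * dist x x') →
      ∀ i, ∀ᵐ y ∂mu, |v x y - v (u i) y| ≤ L * dist x (u i) := by
    intro x hx hxl i
    -- Two good points need not be directly comparable, but both are comparable with almost every
    -- third point x''; the bound is closed in x'' and may be evaluated at x'' = x.
    have h1 : ∀ᵐ x'' ∂(volume.restrict U), ∀ᵐ y ∂mu,
        |v x y - v (u i) y| ≤ L * dist x x'' + L * dist (u i) x'' := by
      filter_upwards [hxl, (hu i).2.2.1] with x'' h1 h2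
      filter_upwards [h1, h2] with y h3 h4
      rw [abs_le] at h3 h4 ⊢
      constructor <;> linarith [h3.1, h3.2, h4.1, h4.2]
    have h2 := forall_ae_of_ae_ae hUo h1 (fun y w a _ _ hw hQ => ?_) x hx
    · filter_upwards [h2] with y hy
      rwa [dist_self, mul_zero, zero_add, dist_comm] at hy
    · exact ge_of_tendsto' (((tendsto_const_nhds.dist hw).const_mul L).add
        ((tendsto_const_nhds.dist hw).const_mul L)) hQ
  set f := infConv u v L V r with hf
  have heq : ∀ᵐ x ∂(volume.restrict U), ∀ᵐ y ∂mu, v x y = f x y := by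
    filter_upwards [hgood] with x ⟨hxU, h1, h2, _⟩
    filter_upwards [ae_all_iff.2 (hpair x hxU h1), h2] with y h3 h4
    refine (infConv_eq v0 hL (hdense x hxU) h3 ?_ fun hn => ?_).symm
    · by_cases h0 : 0 < z (x, y)
      · exact (h4 h0).1
      · rw [vzero h0]; exact hV
    · by_contra hne
      exact hn (h4 (vpos (lt_of_le_of_ne (v0 x y) (Ne.symm hne)))).2
  have flip : ∀ x x' y, f x y ≤ f x' y + L * dist x x' := infConv_lip v0 hL
  have fm : ∀ x, Measurable (f x) := measurable_infConv vm
  have f0 : ∀ x y, 0 ≤ f x y := infConv_nonneg v0 hL hV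
  have fV : ∀ x y, f x y ≤ V := infConv_le hV
  have hs' : 0 < s⁻¹ := inv_pos.2 hs
  refine ⟨f, ⟨fm, f0, fV, flip, fun x y hy => indicator_of_notMem hy _, ?_, ?_, ?_⟩, heq⟩
  · refine forall_of_ae_of_closed hUo ?_ fun w x hx _ hlim hQ => ?_
    · filter_upwards [hgood, heq] with x ⟨_, _, _, h1⟩ h2
      have h3 : (fun y => f x y ^ s⁻¹) =ᵐ[mu] fun y => z (x, y) := by
        filter_upwards [h2] with y hy
        rw [← hy, hv]
        exact Real.rpow_rpow_inv (h.nonneg _) hs.ne'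
      rw [integral_congr_ae h3, integral_eq_lintegral_of_nonneg_ae
        (Filter.Eventually.of_forall fun y => h.nonneg _)
        (by fun_prop : Measurable _).aestronglyMeasurable, h1, ENNReal.toReal_one]
    · have h1 : Filter.Tendsto (fun n => ∫ y, f (w n) y ^ s⁻¹ ∂mu) Filter.atTop
          (nhds (∫ y, f x y ^ s⁻¹ ∂mu)) := by
        refine tendsto_integral_of_dominated_convergence (fun _ => V ^ s⁻¹)
          (fun n => ((fm _).pow_const _).aestronglyMeasurable) (integrable_const _) (fun n => ?_) ?_
        · refine Filter.Eventually.of_forall fun y => ?_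
          rw [Real.norm_eq_abs, abs_of_nonneg (Real.rpow_nonneg (f0 _ _) _)]
          exact Real.rpow_le_rpow (f0 _ _) (fV _ _) hs'.le
        · refine Filter.Eventually.of_forall fun y => ?_
          exact ((Real.continuous_rpow_const hs'.le).tendsto _).comp (tendsto_of_lip flip y hlim)
      simp only [hQ] at h1
      exact tendsto_nhds_unique h1 tendsto_const_nhds
  -- Positivity is an open condition in x and x' and the inequality a closed one, so the implication
  -- passes to limits, one variable at a time.
  · have hstep : ∀ᵐ x ∂(volume.restrict U), ∀ x' ∈ U, ∀ᵐ q ∂(mu.prod mu), 0 < f x q.1 →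
        0 < f x' q.2 →
        f x q.1 + f x' q.2 ≤ f x q.2 + f x' q.1 + b * inner ℝ (x - x') (q.1 - q.2) := by
      filter_upwards [toU (Measure.ae_ae_of_ae_prod (Measure.ae_ae_of_ae_prod hcyc)), heq]
        with x h1 h2
      refine forall_ae_of_ae_ae hUo ?_ fun q w x' _ _ hlim hQ p p' => ?_
      · filter_upwards [toU h1, heq] with x' h3 h4
        filter_upwards [h3, Measure.quasiMeasurePreserving_fst.ae h2,
          Measure.quasiMeasurePreserving_snd.ae h2, Measure.quasiMeasurePreserving_fst.ae h4,
          Measure.quasiMeasurePreserving_snd.ae h4] with q h5 e1 e2 e3 e4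
        rw [← e1, ← e2, ← e3, ← e4]
        exact fun p p' => h5 (vpos p) (vpos p')
      · have t1 := tendsto_of_lip flip q.1 hlim
        have t2 := tendsto_of_lip flip q.2 hlim
        have hin : Filter.Tendsto (fun n => b * inner ℝ (x - w n) (q.1 - q.2)) Filter.atTop
            (nhds (b * inner ℝ (x - x') (q.1 - q.2))) :=
          ((tendsto_const_nhds.sub hlim).inner tendsto_const_nhds).const_mul b
        exact le_of_tendsto_of_tendsto (tendsto_const_nhds.add t2)
          ((tendsto_const_nhds.add t1).add hin)
          ((t2.eventually_const_lt p').mono fun n hn => hQ n p hn)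
    intro x hx x' hx'
    refine forall_ae_of_ae_ae hUo (hstep.mono fun x hx => hx x' hx')
      (fun q w x _ _ hlim hQ p p' => ?_) x hx
    have t1 := tendsto_of_lip flip q.1 hlim
    have t2 := tendsto_of_lip flip q.2 hlim
    have hin : Filter.Tendsto (fun n => b * inner ℝ (w n - x') (q.1 - q.2)) Filter.atTop
        (nhds (b * inner ℝ (x - x') (q.1 - q.2))) :=
      ((hlim.sub tendsto_const_nhds).inner tendsto_const_nhds).const_mul b
    exact le_of_tendsto_of_tendsto (t1.add tendsto_const_nhds)
      ((t2.add tendsto_const_nhds).add hin)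
      ((t1.eventually_const_lt p).mono fun n hn => hQ n hn p')
  · intro θ h0 h1
    have hB := hmu.absolutelyContinuous hm
    have hQ := quasiMeasurePreserving_convexComb h0 h1 (convex_ball (0 : Rn d) r)
    refine forall_ae_of_ae_ae hUo ?_ fun q w x _ _ hlim hQ p p' => ?_
    · filter_upwards [toU (h.pow_concave hs hs1 hm hcyc hmu h0 h1), heq] with x h2 h3
      have h3' := hB.ae_le h3
      filter_upwards [h2, Measure.quasiMeasurePreserving_fst.ae h3',
        Measure.quasiMeasurePreserving_snd.ae h3',
        hQ.ae (Measure.quasiMeasurePreserving_snd.ae h3')] with q h4 e1 e2 e3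
      rw [← e1, ← e2, ← e3]
      exact fun p p' => h4 (vpos p) (vpos p')
    · have t1 := tendsto_of_lip flip q.1 hlim
      have t2 := tendsto_of_lip flip q.2 hlim
      have t3 := tendsto_of_lip flip ((1 - θ) • q.1 + θ • q.2) hlim
      exact le_of_tendsto_of_tendsto ((t1.const_mul _).add (t2.const_mul _)) t3
        (((t1.eventually_const_lt p).and (t2.eventually_const_lt p')).mono
          fun n hn => hQ n hn.1 hn.2)

/-! ### Contraction towards a high point: integral continuity of functions of the profile -/

theorem VolBetween.restrict_le {d : ℕ} {ν : Measure (Rn d)} {m M r : ℝ}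
    (h : VolBetween ν m M r) :
    ν.restrict (ball 0 r) ≤ ENNReal.ofReal M • (volume : Measure (Rn d)).restrict (ball 0 r) := by
  refine Measure.le_iff.2 fun A hA => ?_
  rw [Measure.smul_apply, Measure.restrict_apply hA, Measure.restrict_apply hA, smul_eq_mul]
  exact (h _ (hA.inter measurableSet_ball) inter_subset_right).2

/-- A height that a profile exceeds on a set of positive measure. -/
noncomputable def profileHeight (d : ℕ) (s M r : ℝ) : ℝ := (2 * M * (unitBallVolume d * r ^ d))⁻¹ ^ s

theorem profileHeight_pos {d : ℕ} {s M r : ℝ} (hM : 0 < M) (hr : 0 < r) :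
    0 < profileHeight d s M r := by
  have := unitBallVolume_pos d
  unfold profileHeight; positivity

section homothety

variable {d : ℕ} {mu : Measure (Rn d)} [IsFiniteMeasure mu] {s b V r m M : ℝ}
  {f : Rn d → Rn d → ℝ}

theorem volume_real_ball {d : ℕ} {r : ℝ} (hr : 0 < r) :
    (volume : Measure (Rn d)).real (ball 0 r) = unitBallVolume d * r ^ d := by
  have := unitBallVolume_pos d
  rw [Measure.real, volume_ball_eq _ hr, ENNReal.toReal_ofReal (by positivity)]

theorem VolBetween.real_ball_le {d : ℕ} {ν : Measure (Rn d)} {m M r : ℝ} (hM : 0 < M) (hr : 0 < r)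
    (h : VolBetween ν m M r) : ν.real (ball 0 r) ≤ M * (unitBallVolume d * r ^ d) := by
  have h1 := (h _ measurableSet_ball subset_rfl).2
  rw [volume_ball_eq _ hr, ← ENNReal.ofReal_mul hM.le] at h1
  have := unitBallVolume_pos d
  exact ENNReal.toReal_le_of_le_ofReal (by positivity) h1

/-- If the profile stayed below this height almost everywhere, the slice would have mass at most
1/2. -/
theorem IsProfile.frequently_ge (hf : IsProfile mu s b V r f) (hs : 0 < s) (hM : 0 < M)
    (hr : 0 < r) (hmu : VolBetween mu m M r) {x : Rn d} (hx : x ∈ ball (0 : Rn d) (r / 3)) :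
    ∃ᵐ y ∂((volume : Measure (Rn d)).restrict (ball 0 r)), profileHeight d s M r ≤ f x y := by
  intro hn
  have h1 := hmu.ae_restrict measurableSet_ball subset_rfl hn
  have hω := unitBallVolume_pos d
  have h2 := hf.mass x hx
  rw [← setIntegral_eq_integral_of_forall_compl_eq_zero (s := ball 0 r) fun y hy => by
    rw [hf.supp x y hy, Real.zero_rpow (inv_pos.2 hs).ne']] at h2
  have h3 : ∫ y in ball 0 r, f x y ^ s⁻¹ ∂mu ≤
      ∫ y in ball 0 r, (2 * M * (unitBallVolume d * r ^ d))⁻¹ ∂mu := by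
    refine integral_mono_of_nonneg (Filter.Eventually.of_forall fun y =>
      Real.rpow_nonneg (hf.nonneg _ _) _) (integrable_const _) ?_
    filter_upwards [h1] with y hy
    have := Real.rpow_le_rpow (hf.nonneg _ _) (not_le.1 hy).le (inv_pos.2 hs).le
    rwa [profileHeight, Real.rpow_rpow_inv (by positivity) hs.ne'] at this
  have h4 := hmu.real_ball_le hM hr
  rw [setIntegral_const, smul_eq_mul, h2] at h3
  have h5 : mu.real (ball 0 r) * (2 * M * (unitBallVolume d * r ^ d))⁻¹ ≤
      (M * (unitBallVolume d * r ^ d)) * (2 * M * (unitBallVolume d * r ^ d))⁻¹ := by gcongr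
  have h6 : (M * (unitBallVolume d * r ^ d)) * (2 * M * (unitBallVolume d * r ^ d))⁻¹ = 1 / 2 := by
    field_simp
  linarith

theorem integral_comp_homothety {E : Type*} [NormedAddCommGroup E] [NormedSpace ℝ E]
    [FiniteDimensional ℝ E] [MeasurableSpace E] [BorelSpace E] (ν : Measure E)
    [ν.IsAddHaarMeasure] (g : E → ℝ) (c : E) {θ : ℝ} (hθ : 0 < θ) :
    ∫ y, g (c + θ • y) ∂ν = (θ ^ Module.finrank ℝ E)⁻¹ * ∫ y, g y ∂ν := by
  rw [Measure.integral_comp_smul ν (fun u => g (c + u)) θ, integral_add_left_eq_self,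
    abs_of_pos (by positivity), smul_eq_mul]

/-- Contract by θ = 1 - 4τ/h towards a point where f(x₂, ·) ≥ h. Concavity shows that f(x₂, ·) at
the contracted point is at least max + 5τ/2 - (4τ/h) max, where max is taken over the two profiles
at y. Where max < h/2 this exceeds max, so monotonicity of Φ suffices; elsewhere the loss is at most
4Vτ/h and Φ has slope at most Λ. The change of variables costs θ^(-d), again an error of order τ. No
regularity of Φ at zero is needed, so jumps there are allowed. -/
theorem IsProfile.integral_max_sub_le (hf : IsProfile mu s b V r f) (hs : 0 < s) (hM : 0 < M)
    (hr : 0 < r) (hV : 0 ≤ V) (hmu : VolBetween mu m M r) {x₁ x₂ : Rn d}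
    (hx₁ : x₁ ∈ ball (0 : Rn d) (r / 3)) (hx₂ : x₂ ∈ ball (0 : Rn d) (r / 3))
    (hτ0 : 0 < 2 * b * r * dist x₁ x₂)
    (hτ : 2 * b * r * dist x₁ x₂ ≤ profileHeight d s M r / 8)
    {Φ : ℝ → ℝ} (hΦm : Measurable Φ) (hmono : MonotoneOn Φ (Ici 0)) (hΦ0 : Φ 0 = 0) {H Λ : ℝ}
    (hH : ∀ t, 0 ≤ t → t ≤ V → Φ t ≤ H) (hΛ0 : 0 ≤ Λ)
    (hΛ : ∀ t u, 0 ≤ u → u ≤ t → profileHeight d s M r / 2 ≤ t → t ≤ V → Φ t - Φ u ≤ Λ * (t - u)) :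
    (∫ y in ball 0 r, Φ (max (f x₁ y) (f x₂ y))) - ∫ y in ball 0 r, Φ (f x₂ y) ≤
      4 * (unitBallVolume d * r ^ d) / profileHeight d s M r * (d * H + V * Λ) *
        (2 * b * r * dist x₁ x₂) := by
  set h := profileHeight d s M r with hh
  set τ := 2 * b * r * dist x₁ x₂ with hτdef
  set W := unitBallVolume d * r ^ d with hW
  have hω := unitBallVolume_pos d
  have hWpos : 0 < W := by positivity
  have hpos : 0 < h := profileHeight_pos hM hr
  have hΦnn : ∀ t, 0 ≤ t → 0 ≤ Φ t := fun t ht => by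
    rw [← hΦ0]; exact hmono (mem_Ici.2 le_rfl) ht ht
  have hH0 : 0 ≤ H := (hΦnn 0 le_rfl).trans (hH 0 le_rfl hV)
  -- At the centre both profiles are at least 7h/8, so concavity gains (1-θ)(7h/8) = 7τ/2. This
  -- outweighs the loss τ in passing from x₁ to x₂ and leaves 5τ/2.
  set θ := 1 - 4 * τ / h with hθ
  have hθ' : 4 * τ / h ≤ 1 / 2 := by rw [div_le_iff₀ hpos]; linarith
  have hθpos : 0 < θ := by linarith
  have hθ1 : θ < 1 := by have : 0 < 4 * τ / h := by positivity
                         linarith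
  set B := ball (0 : Rn d) r with hB
  have hvolB : (volume : Measure (Rn d)).real B = W := volume_real_ball hr
  have hfin : IsFiniteMeasure ((volume : Measure (Rn d)).restrict B) :=
    ⟨by rw [Measure.restrict_apply_univ]; exact measure_ball_lt_top⟩
  have intΦ : ∀ g : Rn d → ℝ, Measurable g → (∀ y, 0 ≤ g y) → (∀ y, g y ≤ V) →
      IntegrableOn (fun y => Φ (g y)) B := fun g hg g0 gV =>
    Integrable.of_bound (hΦm.comp hg).aestronglyMeasurable H
      (Filter.Eventually.of_forall fun y => by
        rw [Real.norm_eq_abs, abs_of_nonneg (hΦnn _ (g0 y))]; exact hH _ (g0 y) (gV y))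
  have c₁ := hf.concave θ hθpos hθ1 x₁ hx₁
  have c₂ := hf.concave θ hθpos hθ1 x₂ hx₂
  obtain ⟨y₀, hy₀, hc₁, hc₂⟩ := ((hf.frequently_ge hs hM hr hmu hx₂).and_eventually
    ((Measure.ae_ae_of_ae_prod c₁).and (Measure.ae_ae_of_ae_prod c₂))).exists
  rw [← hh] at hy₀
  have hy₀' : h - τ ≤ f x₁ y₀ := by
    have := hf.lip x₂ x₁ y₀
    rw [dist_comm, ← hτdef] at this
    linarith
  set c := (1 - θ) • y₀ with hc
  have hmaxV : ∀ y, max (f x₁ y) (f x₂ y) ≤ V := fun y => max_le (hf.le _ _) (hf.le _ _)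
  have hmax0 : ∀ y, 0 ≤ max (f x₁ y) (f x₂ y) := fun y => (hf.nonneg x₁ y).trans (le_max_left _ _)
  have low : ∀ᵐ y ∂(volume.restrict B), 0 < max (f x₁ y) (f x₂ y) →
      max (f x₁ y) (f x₂ y) + 5 / 2 * τ - 4 * τ / h * max (f x₁ y) (f x₂ y) ≤
        f x₂ (c + θ • y) := by
    filter_upwards [hc₁, hc₂] with y k₁ k₂ hp
    have e : (1 - θ) * (7 / 8 * h) = 7 / 2 * τ := by rw [hθ]; field_simp; ring
    have e2 : θ = 1 - 4 * τ / h := rfl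
    rcases le_total (f x₁ y) (f x₂ y) with hle | hle
    · rw [max_eq_right hle] at hp ⊢
      have k := k₂ (hpos.trans_le hy₀) hp
      have k3 := mul_le_mul_of_nonneg_left hy₀ (sub_nonneg.2 hθ1.le)
      have k4 : (1 - θ) * h = 4 * τ := by rw [hθ]; field_simp; ring
      have k5 : θ * f x₂ y = f x₂ y - 4 * τ / h * f x₂ y := by rw [e2]; ring
      linarith
    · rw [max_eq_left hle] at hp ⊢
      have k := k₁ ((by linarith : 0 < h - τ).trans_le hy₀') hp
      have k3 := mul_le_mul_of_nonneg_left ((by linarith : 7 / 8 * h ≤ h - τ).trans hy₀')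
        (sub_nonneg.2 hθ1.le)
      have k5 : θ * f x₁ y = f x₁ y - 4 * τ / h * f x₁ y := by rw [e2]; ring
      have k6 := hf.lip x₁ x₂ ((1 - θ) • y₀ + θ • y)
      rw [← hτdef] at k6
      linarith
  have hpt : ∀ᵐ y ∂(volume.restrict B), Φ (max (f x₁ y) (f x₂ y)) ≤
      Φ (f x₂ (c + θ • y)) + Λ * (4 * V / h * τ) := by
    filter_upwards [low] with y hy
    have hnn : 0 ≤ Λ * (4 * V / h * τ) := by positivity
    rcases (hmax0 y).eq_or_lt with h0 | h0
    · rw [← h0, hΦ0]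
      exact add_nonneg (hΦnn _ (hf.nonneg _ _)) hnn
    · have hy := hy h0
      set a := max (f x₁ y) (f x₂ y) with ha
      rcases le_total a (f x₂ (c + θ • y)) with hle | hle
      · have := hmono (show a ∈ Ici 0 from h0.le) (hf.nonneg _ _ : _ ∈ Ici (0 : ℝ)) hle
        linarith
      · have ha2 : h / 2 ≤ a := by
          by_contra hlt
          rw [not_le] at hlt
          have : 4 * τ / h * a ≤ 4 * τ / h * (h / 2) := by gcongr
          have e : 4 * τ / h * (h / 2) = 2 * τ := by field_simp; ring
          linarith
        have k := hΛ a _ (hf.nonneg _ _) hle ha2 (hmaxV y)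
        have k2 : a - f x₂ (c + θ • y) ≤ 4 * V / h * τ := by
          have : 4 * τ / h * a ≤ 4 * τ / h * V := by
            have := hmaxV y
            gcongr
          have e : 4 * τ / h * V = 4 * V / h * τ := by ring
          linarith
        have := mul_le_mul_of_nonneg_left k2 hΛ0
        linarith
  have supp0 : ∀ y ∉ B, Φ (f x₂ y) = 0 := fun y hy => by rw [hf.supp x₂ y hy, hΦ0]
  have intG : Integrable (fun y => Φ (f x₂ y)) :=
    (integrableOn_iff_integrable_of_support_subset fun y hy => by
      by_contra hn; exact hy (supp0 y hn)).1 (intΦ _ (hf.meas x₂) (hf.nonneg x₂) (hf.le x₂))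
  have intGc : Integrable fun y => Φ (f x₂ (c + θ • y)) :=
    (intG.comp_add_left c).comp_smul hθpos.ne'
  have I1 : ∫ y in B, Φ (max (f x₁ y) (f x₂ y)) ≤
      (θ ^ d)⁻¹ * (∫ y in B, Φ (f x₂ y)) + Λ * (4 * V / h * τ) * W := by
    calc ∫ y in B, Φ (max (f x₁ y) (f x₂ y))
        ≤ ∫ y in B, (Φ (f x₂ (c + θ • y)) + Λ * (4 * V / h * τ)) :=
          integral_mono_ae (intΦ _ ((hf.meas x₁).max (hf.meas x₂)) hmax0 hmaxV)
            (intGc.integrableOn.add (integrable_const _)) hpt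
      _ = (∫ y in B, Φ (f x₂ (c + θ • y))) + Λ * (4 * V / h * τ) * W := by
          rw [integral_add intGc.integrableOn (integrable_const _), setIntegral_const, hvolB,
            smul_eq_mul, mul_comm W]
      _ ≤ (∫ y, Φ (f x₂ (c + θ • y))) + Λ * (4 * V / h * τ) * W := by
          exact add_le_add (setIntegral_le_integral intGc (Filter.Eventually.of_forall fun y =>
            hΦnn _ (hf.nonneg _ _))) le_rfl
      _ = _ := by
          rw [integral_comp_homothety volume (fun y => Φ (f x₂ y)) c hθpos,
            setIntegral_eq_integral_of_forall_compl_eq_zero supp0, finrank_euclideanSpace,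
            Fintype.card_fin]
  set A := ∫ y in B, Φ (max (f x₁ y) (f x₂ y)) with hA
  have hAle : A ≤ H * W := by
    calc A ≤ ∫ y in B, H := setIntegral_mono (intΦ _ ((hf.meas x₁).max (hf.meas x₂)) hmax0 hmaxV)
          (integrable_const _) fun y => hH _ (hmax0 y) (hmaxV y)
      _ = H * W := by rw [setIntegral_const, hvolB, smul_eq_mul, mul_comm]
  have hA0 : 0 ≤ A := setIntegral_nonneg measurableSet_ball fun y _ => hΦnn _ (hmax0 y)
  have hθd : 0 < θ ^ d := by positivity
  have hθd1 : θ ^ d ≤ 1 := pow_le_one₀ hθpos.le hθ1.le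
  have I2 : θ ^ d * A ≤ (∫ y in B, Φ (f x₂ y)) + Λ * (4 * V / h * τ) * W := by
    have := mul_le_mul_of_nonneg_left I1 hθd.le
    rw [mul_add, ← mul_assoc, mul_inv_cancel₀ hθd.ne', one_mul] at this
    have h2 : θ ^ d * (Λ * (4 * V / h * τ) * W) ≤ Λ * (4 * V / h * τ) * W :=
      mul_le_of_le_one_left (by positivity) hθd1
    linarith
  have bern : 1 - θ ^ d ≤ d * (4 * τ / h) := by
    have := one_add_mul_le_pow (a := θ - 1) (by linarith) d
    rw [add_sub_cancel] at this
    have e2 : θ = 1 - 4 * τ / h := rfl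
    have e3 : (d : ℝ) * (θ - 1) = -(d * (4 * τ / h)) := by rw [e2]; ring
    linarith
  have I3 : (1 - θ ^ d) * A ≤ d * (4 * τ / h) * (H * W) :=
    mul_le_mul bern hAle hA0 (by positivity)
  have e : 4 * W / h * (d * H + V * Λ) * τ =
      d * (4 * τ / h) * (H * W) + Λ * (4 * V / h * τ) * W := by ring
  rw [e]
  linarith

/-- For monotone Φ, |Φ(a) - Φ(c)| is the sum of the two excesses of Φ(max a c), so
`IsProfile.integral_max_sub_le` is used in both orders. The density bound `M` carries the estimate
from Lebesgue measure to `mu`. -/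
theorem IsProfile.integral_abs_sub_le (hf : IsProfile mu s b V r f) (hs : 0 < s) (hb : 0 ≤ b)
    (hM : 0 < M) (hr : 0 < r) (hV : 0 ≤ V) (hmu : VolBetween mu m M r) {x₁ x₂ : Rn d}
    (hx₁ : x₁ ∈ ball (0 : Rn d) (r / 3)) (hx₂ : x₂ ∈ ball (0 : Rn d) (r / 3))
    (hτ : 2 * b * r * dist x₁ x₂ ≤ profileHeight d s M r / 8)
    {Φ : ℝ → ℝ} (hΦm : Measurable Φ) (hmono : MonotoneOn Φ (Ici 0)) (hΦ0 : Φ 0 = 0) {H Λ : ℝ}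
    (hH : ∀ t, 0 ≤ t → t ≤ V → Φ t ≤ H) (hΛ0 : 0 ≤ Λ)
    (hΛ : ∀ t u, 0 ≤ u → u ≤ t → profileHeight d s M r / 2 ≤ t → t ≤ V → Φ t - Φ u ≤ Λ * (t - u)) :
    ∫ y, |Φ (f x₁ y) - Φ (f x₂ y)| ∂mu ≤
      M * (8 * (unitBallVolume d * r ^ d) / profileHeight d s M r * (d * H + V * Λ) *
        (2 * b * r)) * dist x₁ x₂ := by
  have hω := unitBallVolume_pos d
  have hpos : 0 < profileHeight d s M r := profileHeight_pos hM hr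
  have hΦnn : ∀ t, 0 ≤ t → 0 ≤ Φ t := fun t ht => by
    rw [← hΦ0]; exact hmono (mem_Ici.2 le_rfl) ht ht
  have hH0 : 0 ≤ H := (hΦnn 0 le_rfl).trans (hH 0 le_rfl hV)
  have hd0 := dist_nonneg (x := x₁) (y := x₂)
  have hτ0 : 0 ≤ 2 * b * r * dist x₁ x₂ := by positivity
  rcases hτ0.eq_or_lt with h0 | h0
  · have heq : ∀ y, f x₁ y = f x₂ y := fun y => by
      have k1 := hf.lip x₁ x₂ y
      have k2 := hf.lip x₂ x₁ y
      rw [dist_comm] at k2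
      linarith
    simp only [heq, sub_self, abs_zero, integral_zero]
    positivity
  set B := ball (0 : Rn d) r with hB
  have hfin : IsFiniteMeasure ((volume : Measure (Rn d)).restrict B) :=
    ⟨by rw [Measure.restrict_apply_univ]; exact measure_ball_lt_top⟩
  have intΦ : ∀ g : Rn d → ℝ, Measurable g → (∀ y, 0 ≤ g y) → (∀ y, g y ≤ V) →
      IntegrableOn (fun y => Φ (g y)) B := fun g hg g0 gV =>
    Integrable.of_bound (hΦm.comp hg).aestronglyMeasurable H
      (Filter.Eventually.of_forall fun y => by
        rw [Real.norm_eq_abs, abs_of_nonneg (hΦnn _ (g0 y))]; exact hH _ (g0 y) (gV y))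
  have i1 := intΦ _ (hf.meas x₁) (hf.nonneg x₁) (hf.le x₁)
  have i2 := intΦ _ (hf.meas x₂) (hf.nonneg x₂) (hf.le x₂)
  have i3 := intΦ _ ((hf.meas x₁).max (hf.meas x₂))
    (fun y => (hf.nonneg x₁ y).trans (le_max_left _ _)) fun y => max_le (hf.le _ _) (hf.le _ _)
  have k1 := hf.integral_max_sub_le hs hM hr hV hmu hx₁ hx₂ h0 hτ hΦm hmono hΦ0 hH hΛ0 hΛ
  have k2 := hf.integral_max_sub_le hs hM hr hV hmu hx₂ hx₁ (by rwa [dist_comm])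
    (by rwa [dist_comm]) hΦm hmono hΦ0 hH hΛ0 hΛ
  simp only [max_comm (f x₂ _), dist_comm x₂] at k2
  have hvol : ∫ y in B, |Φ (f x₁ y) - Φ (f x₂ y)| ≤
      8 * (unitBallVolume d * r ^ d) / profileHeight d s M r * (d * H + V * Λ) *
        (2 * b * r * dist x₁ x₂) := by
    have e : ∀ y, |Φ (f x₁ y) - Φ (f x₂ y)| =
        (Φ (max (f x₁ y) (f x₂ y)) - Φ (f x₁ y)) + (Φ (max (f x₁ y) (f x₂ y)) - Φ (f x₂ y)) := by
      intro y
      rcases le_total (f x₁ y) (f x₂ y) with hle | hle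
      · have := hmono (hf.nonneg _ _ : _ ∈ Ici (0 : ℝ)) (hf.nonneg _ _ : _ ∈ Ici (0 : ℝ)) hle
        rw [max_eq_right hle, abs_of_nonpos (by linarith)]; ring
      · have := hmono (hf.nonneg _ _ : _ ∈ Ici (0 : ℝ)) (hf.nonneg _ _ : _ ∈ Ici (0 : ℝ)) hle
        rw [max_eq_left hle, abs_of_nonneg (by linarith)]; ring
    simp only [e]
    have j1 : IntegrableOn (fun y => Φ (max (f x₁ y) (f x₂ y)) - Φ (f x₁ y)) B := i3.sub i1
    have j2 : IntegrableOn (fun y => Φ (max (f x₁ y) (f x₂ y)) - Φ (f x₂ y)) B := i3.sub i2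
    rw [integral_add j1 j2, integral_sub i3 i1, integral_sub i3 i2]
    refine (add_le_add k2 k1).trans (le_of_eq (by ring))
  have hsupp : ∀ y ∉ B, |Φ (f x₁ y) - Φ (f x₂ y)| = 0 := fun y hy => by
    rw [hf.supp x₁ y hy, hf.supp x₂ y hy, sub_self, abs_zero]
  rw [← setIntegral_eq_integral_of_forall_compl_eq_zero hsupp]
  have k3 := integral_mono_measure hmu.restrict_le
    (Filter.Eventually.of_forall fun y => abs_nonneg (Φ (f x₁ y) - Φ (f x₂ y)))
    ((i1.sub i2).abs.smul_measure ENNReal.ofReal_ne_top)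
  rw [integral_smul_measure, ENNReal.toReal_ofReal hM.le, smul_eq_mul] at k3
  refine k3.trans ((mul_le_mul_of_nonneg_left hvol hM.le).trans (le_of_eq (by ring)))

end homothety

/-! ### The weight as a function of the profile, and the Lipschitz bound for the mean -/

/-- The power `t^β` on `(0, ∞)`, extended by zero. -/
noncomputable def posPow (β t : ℝ) : ℝ := if 0 < t then t ^ β else 0

theorem posPow_zero (β : ℝ) : posPow β 0 = 0 := if_neg (lt_irrefl _)

theorem posPow_nonneg (β t : ℝ) : 0 ≤ posPow β t := by
  unfold posPow; split_ifs with h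
  · positivity
  · exact le_rfl

theorem measurable_posPow (β : ℝ) : Measurable (posPow β) :=
  Measurable.ite measurableSet_Ioi (by fun_prop) measurable_const

theorem posPow_mono {β : ℝ} (hβ : 0 ≤ β) : MonotoneOn (posPow β) (Ici 0) := by
  intro t ht u hu htu
  rcases (mem_Ici.1 ht).eq_or_lt with h0 | h0
  · rw [← h0, posPow_zero]; exact posPow_nonneg _ _
  · rw [posPow, if_pos h0, posPow, if_pos (h0.trans_le htu)]
    exact Real.rpow_le_rpow h0.le htu hβ

theorem posPow_le {β t V : ℝ} (hβ : 0 ≤ β) (ht : 0 ≤ t) (htV : t ≤ V) : posPow β t ≤ V ^ β := by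
  unfold posPow; split_ifs with h
  · exact Real.rpow_le_rpow ht htV hβ
  · exact Real.rpow_nonneg (ht.trans htV) _

/-- With q = u/t the claim reduces to 1 - q^β ≤ (β+1)(1-q): for β ≤ 1 because q^β ≥ q, for β ≥ 1 by
Bernoulli. The case u = 0, including the jump for β = 0, is covered because t stays away from zero.
-/
theorem posPow_sub_le {β t u V h : ℝ} (hβ : 0 ≤ β) (hu : 0 ≤ u) (hut : u ≤ t) (hh : 0 < h)
    (ht : h / 2 ≤ t) (htV : t ≤ V) :
    posPow β t - posPow β u ≤ (β + 1) * V ^ β * (2 / h) * (t - u) := by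
  have ht0 : 0 < t := by linarith
  have key : posPow β t - posPow β u ≤ (β + 1) * t ^ β * (1 - u / t) := by
    have htβ : 0 < t ^ β := by positivity
    rcases hu.eq_or_lt with h0 | h0
    · rw [← h0, posPow_zero, zero_div, posPow, if_pos ht0]
      nlinarith
    · rw [posPow, if_pos ht0, posPow, if_pos h0]
      have hq : 0 < u / t := by positivity
      have hq1 : u / t ≤ 1 := (div_le_one ht0).2 hut
      have e : u ^ β = t ^ β * (u / t) ^ β := by
        rw [← Real.mul_rpow ht0.le hq.le, mul_div_cancel₀ _ ht0.ne']
      have h1 : 1 - (u / t) ^ β ≤ (β + 1) * (1 - u / t) := by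
        rcases le_total β 1 with hβ1 | hβ1
        · have := Real.rpow_le_rpow_of_exponent_ge hq hq1 hβ1
          rw [Real.rpow_one] at this
          nlinarith
        · have := one_add_mul_self_le_rpow_one_add (s := u / t - 1) (by linarith) hβ1
          rw [add_sub_cancel] at this
          nlinarith
      rw [e]
      nlinarith
  refine key.trans ?_
  have e : 1 - u / t = 1 / t * (t - u) := by field_simp
  have h1 : 1 / t ≤ 2 / h := by
    rw [div_le_div_iff₀ ht0 hh]; linarith
  have h2 := Real.rpow_le_rpow ht0.le htV hβ
  have h3 : 0 ≤ t - u := by linarith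
  have h4 : 0 ≤ V ^ β := (Real.rpow_nonneg ht0.le β).trans h2
  rw [e, ← mul_assoc]
  gcongr

/-- The exponents satisfy (p-1)((p-1)⁻¹ - 1) = 2 - p; for p = 2 both sides are the indicator of the
support. -/
theorem weight_eq_posPow {p z : ℝ} (hp : 1 < p) (hz : 0 ≤ z) :
    weight p z = posPow ((p - 1)⁻¹ - 1) (z ^ (p - 1)) := by
  have hp' : p - 1 ≠ 0 := by linarith
  unfold weight posPow
  rcases hz.eq_or_lt with h | h
  · rw [← h, Real.zero_rpow hp']; simp
  · rw [if_pos h, if_pos (by positivity), ← Real.rpow_mul hz]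
    congr 1
    field_simp
    ring

/-- The identity on `B_r`, cut off outside. -/
noncomputable def cutId (d : ℕ) (r : ℝ) : Rn d → Rn d := (ball (0 : Rn d) r).indicator id

theorem stronglyMeasurable_cutId (d : ℕ) (r : ℝ) : StronglyMeasurable (cutId d r) :=
  stronglyMeasurable_id.indicator measurableSet_ball

theorem norm_cutId_le {d : ℕ} {r : ℝ} (hr : 0 ≤ r) (y : Rn d) : ‖cutId d r y‖ ≤ r := by
  unfold cutId
  by_cases h : y ∈ ball (0 : Rn d) r
  · rw [indicator_of_mem h]; exact (mem_ball_zero_iff.1 h).le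
  · rw [indicator_of_notMem h, norm_zero]; exact hr

section mean

variable {d : ℕ} {mu : Measure (Rn d)} [IsFiniteMeasure mu] {s b V r m M : ℝ}
  {f : Rn d → Rn d → ℝ}

/-- The weighted integral of `F` against the profile. -/
noncomputable def profileIntegral {d : ℕ} {H : Type*} [NormedAddCommGroup H] [NormedSpace ℝ H]
    (mu : Measure (Rn d)) (Φ : ℝ → ℝ) (f : Rn d → Rn d → ℝ) (F : Rn d → H) (x : Rn d) : H :=
  ∫ y, Φ (f x y) • F y ∂mu

/-- The weighted mean of the profile. -/
noncomputable def profileMean {d : ℕ} (mu : Measure (Rn d)) (s r : ℝ) (f : Rn d → Rn d → ℝ)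
    (x : Rn d) : Rn d :=
  (profileIntegral mu (posPow (s⁻¹ - 1)) f (fun _ => (1 : ℝ)) x)⁻¹ •
    profileIntegral mu (posPow (s⁻¹ - 1)) f (cutId d r) x

theorem IsProfile.integrable_smul {H : Type*} [NormedAddCommGroup H] [NormedSpace ℝ H]
    (hf : IsProfile mu s b V r f) {Φ : ℝ → ℝ} (hΦm : Measurable Φ) {B : ℝ}
    (hB : ∀ t, 0 ≤ t → t ≤ V → |Φ t| ≤ B) {F : Rn d → H} (hF : StronglyMeasurable F) {C : ℝ}
    (hC : ∀ y, ‖F y‖ ≤ C) (x : Rn d) : Integrable (fun y => Φ (f x y) • F y) mu := by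
  refine Integrable.of_bound ((hΦm.comp (hf.meas x)).stronglyMeasurable.smul hF).aestronglyMeasurable
    (B * C) (Filter.Eventually.of_forall fun y => ?_)
  rw [norm_smul]
  have h1 := hB _ (hf.nonneg x y) (hf.le x y)
  exact mul_le_mul h1 (hC y) (norm_nonneg _) ((abs_nonneg _).trans h1)

theorem IsProfile.norm_profileIntegral_sub_le {H : Type*} [NormedAddCommGroup H] [NormedSpace ℝ H]
    (hf : IsProfile mu s b V r f) (hs : 0 < s) (hb : 0 ≤ b)
    (hM : 0 < M) (hr : 0 < r) (hV : 0 ≤ V) (hmu : VolBetween mu m M r) {x₁ x₂ : Rn d}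
    (hx₁ : x₁ ∈ ball (0 : Rn d) (r / 3)) (hx₂ : x₂ ∈ ball (0 : Rn d) (r / 3))
    (hτ : 2 * b * r * dist x₁ x₂ ≤ profileHeight d s M r / 8)
    {Φ : ℝ → ℝ} (hΦm : Measurable Φ) (hmono : MonotoneOn Φ (Ici 0)) (hΦ0 : Φ 0 = 0) {B Λ : ℝ}
    (hB : ∀ t, 0 ≤ t → t ≤ V → Φ t ≤ B) (hΛ0 : 0 ≤ Λ)
    (hΛ : ∀ t u, 0 ≤ u → u ≤ t → profileHeight d s M r / 2 ≤ t → t ≤ V → Φ t - Φ u ≤ Λ * (t - u))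
    {F : Rn d → H} (hF : StronglyMeasurable F) {C : ℝ} (hC : ∀ y, ‖F y‖ ≤ C) :
    ‖profileIntegral mu Φ f F x₁ - profileIntegral mu Φ f F x₂‖ ≤
      C * (M * (8 * (unitBallVolume d * r ^ d) / profileHeight d s M r * (d * B + V * Λ) *
        (2 * b * r)) * dist x₁ x₂) := by
  have hΦnn : ∀ t, 0 ≤ t → 0 ≤ Φ t := fun t ht => by
    rw [← hΦ0]; exact hmono (mem_Ici.2 le_rfl) ht ht
  have hB' : ∀ t, 0 ≤ t → t ≤ V → |Φ t| ≤ B := fun t ht htV => by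
    rw [abs_of_nonneg (hΦnn t ht)]; exact hB t ht htV
  have hi := fun x => hf.integrable_smul hΦm hB' hF hC x
  have hi1 := fun x => hf.integrable_smul hΦm hB' (F := fun _ => (1 : ℝ))
    stronglyMeasurable_const (C := 1) (by simp) x
  simp only [smul_eq_mul, mul_one] at hi1
  have hC0 : 0 ≤ C := (norm_nonneg _).trans (hC 0)
  unfold profileIntegral
  rw [← integral_sub (hi x₁) (hi x₂)]
  have h1 := norm_integral_le_of_norm_le (f := fun y => Φ (f x₁ y) • F y - Φ (f x₂ y) • F y)
    (((hi1 x₁).sub (hi1 x₂)).abs.const_mul C) (Filter.Eventually.of_forall fun y => by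
      rw [← sub_smul, norm_smul, mul_comm, Real.norm_eq_abs]
      exact mul_le_mul_of_nonneg_right (hC y) (abs_nonneg _))
  refine h1.trans ?_
  rw [integral_const_mul]
  exact mul_le_mul_of_nonneg_left
    (hf.integral_abs_sub_le hs hb hM hr hV hmu hx₁ hx₂ hτ hΦm hmono hΦ0 hB hΛ0 hΛ) hC0

/-- Since f ≤ V, the unit mass density f^(1/s) = f · f^(1/s-1) is at most V times the weight. -/
theorem IsProfile.one_le_mul_profileIntegral (hf : IsProfile mu s b V r f) (hs : 0 < s)
    (hs1 : s ≤ 1) {x : Rn d} (hx : x ∈ ball (0 : Rn d) (r / 3)) :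
    1 ≤ V * profileIntegral mu (posPow (s⁻¹ - 1)) f (fun _ => (1 : ℝ)) x := by
  have hβ : 0 ≤ s⁻¹ - 1 := by linarith [(one_le_inv₀ hs).2 hs1]
  refine (hf.mass x hx).symm.le.trans ?_
  rw [profileIntegral, ← integral_const_mul]
  have hi := hf.integrable_smul (measurable_posPow (s⁻¹ - 1)) (B := V ^ (s⁻¹ - 1))
    (fun t ht htV => by rw [abs_of_nonneg (posPow_nonneg _ _)]; exact posPow_le hβ ht htV)
    (F := fun _ => (1 : ℝ)) stronglyMeasurable_const (C := 1) (by simp) x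
  refine integral_mono_of_nonneg (Filter.Eventually.of_forall fun y =>
    Real.rpow_nonneg (hf.nonneg _ _) _) (hi.const_mul V) (Filter.Eventually.of_forall fun y => ?_)
  simp only [smul_eq_mul, mul_one]
  rcases (hf.nonneg x y).eq_or_lt with h0 | h0
  · rw [← h0, Real.zero_rpow (inv_pos.2 hs).ne', posPow_zero, mul_zero]
  · rw [posPow, if_pos h0, Real.rpow_sub_one h0.ne', mul_div_assoc', mul_comm V, mul_div_assoc]
    have : 1 ≤ V / f x y := (one_le_div h0).2 (hf.le x y)
    nlinarith [Real.rpow_nonneg h0.le s⁻¹]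

theorem IsProfile.norm_profileIntegral_cutId_le (hf : IsProfile mu s b V r f) (hs : 0 < s)
    (hs1 : s ≤ 1) (hr : 0 < r) (x : Rn d) :
    ‖profileIntegral mu (posPow (s⁻¹ - 1)) f (cutId d r) x‖ ≤
      r * profileIntegral mu (posPow (s⁻¹ - 1)) f (fun _ => (1 : ℝ)) x := by
  have hβ : 0 ≤ s⁻¹ - 1 := by linarith [(one_le_inv₀ hs).2 hs1]
  have hi := hf.integrable_smul (measurable_posPow (s⁻¹ - 1)) (B := V ^ (s⁻¹ - 1))
    (fun t ht htV => by rw [abs_of_nonneg (posPow_nonneg _ _)]; exact posPow_le hβ ht htV)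
    (F := fun _ => (1 : ℝ)) stronglyMeasurable_const (C := 1) (by simp) x
  unfold profileIntegral
  rw [← integral_const_mul]
  refine norm_integral_le_of_norm_le (hi.const_mul r) (Filter.Eventually.of_forall fun y => ?_)
  rw [norm_smul, Real.norm_eq_abs, abs_of_nonneg (posPow_nonneg _ _), smul_eq_mul, mul_one,
    mul_comm]
  exact mul_le_mul_of_nonneg_right (norm_cutId_le hr.le y) (posPow_nonneg _ _)

theorem IsProfile.norm_profileMean_le (hf : IsProfile mu s b V r f) (hs : 0 < s)
    (hs1 : s ≤ 1) (hr : 0 < r) (hV : 0 ≤ V) {x : Rn d} (hx : x ∈ ball (0 : Rn d) (r / 3)) :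
    ‖profileMean mu s r f x‖ ≤ r := by
  have h1 := hf.one_le_mul_profileIntegral hs hs1 hx
  have hD : 0 < profileIntegral mu (posPow (s⁻¹ - 1)) f (fun _ => (1 : ℝ)) x := by
    by_contra hn
    nlinarith
  have h2 := hf.norm_profileIntegral_cutId_le hs hs1 hr x
  rw [profileMean, norm_smul, norm_inv, Real.norm_eq_abs, abs_of_pos hD, inv_mul_le_iff₀ hD,
    mul_comm]
  exact h2

theorem exists_lipschitz_profileMean (d : ℕ) {s b V r M : ℝ} (hs : 0 < s) (hs1 : s ≤ 1)
    (hb : 0 < b) (hM : 0 < M) (hr : 0 < r) (hV : 0 ≤ V) :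
    ∃ K : ℝ≥0, ∀ (m : ℝ) (mu : Measure (Rn d)) [IsFiniteMeasure mu] (f : Rn d → Rn d → ℝ),
      IsProfile mu s b V r f → VolBetween mu m M r →
      LipschitzOnWith K (profileMean mu s r f) (ball 0 (r / 3)) := by
  set β := s⁻¹ - 1 with hβdef
  have hβ : 0 ≤ β := by linarith [(one_le_inv₀ hs).2 hs1]
  set h := profileHeight d s M r with hh
  have hpos : 0 < h := profileHeight_pos hM hr
  have hω := unitBallVolume_pos d
  set Λ := (β + 1) * V ^ β * (2 / h) with hΛ
  set κ := M * (8 * (unitBallVolume d * r ^ d) / h * (d * V ^ β + V * Λ) * (2 * b * r)) with hκ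
  have hΛ0 : 0 ≤ Λ := by positivity
  have hκ0 : 0 ≤ κ := by positivity
  -- The first summand comes from the quotient rule at close points. The second covers distant
  -- points, where 2br |x₁ - x₂| > h/8, by the trivial bound that both means have norm at most `r`.
  set K := 2 * r * V * κ + 2 * r * (2 * b * r) * (8 / h) with hK
  have hK0 : 0 ≤ K := by positivity
  refine ⟨K.toNNReal, fun m mu _ f hf hmu => LipschitzOnWith.of_dist_le_mul fun x₁ hx₁ x₂ hx₂ => ?_⟩
  rw [Real.coe_toNNReal K hK0]
  have T1 := hf.norm_profileMean_le hs hs1 hr hV hx₁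
  have T2 := hf.norm_profileMean_le hs hs1 hr hV hx₂
  have hd := dist_nonneg (x := x₁) (y := x₂)
  rcases le_or_gt (2 * b * r * dist x₁ x₂) (h / 8) with hle | hgt
  · have e := fun {H : Type} [NormedAddCommGroup H] [NormedSpace ℝ H] {F : Rn d → H}
        (hF : StronglyMeasurable F) {C : ℝ} (hC : ∀ y, ‖F y‖ ≤ C) =>
      hf.norm_profileIntegral_sub_le hs hb.le hM hr hV hmu hx₁ hx₂ hle (measurable_posPow β)
        (posPow_mono hβ) (posPow_zero β) (fun t ht htV => posPow_le hβ ht htV) hΛ0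
        (fun t u hu hut ht htV => posPow_sub_le hβ hu hut hpos ht htV) hF hC
    have eD := e (F := fun _ => (1 : ℝ)) stronglyMeasurable_const (C := 1) (by simp)
    have eN := e (stronglyMeasurable_cutId d r) (norm_cutId_le hr.le)
    rw [← hh, ← hκ] at eD eN
    have hD1 := hf.one_le_mul_profileIntegral hs hs1 hx₁
    have hD2 := hf.one_le_mul_profileIntegral hs hs1 hx₂
    set D : Rn d → ℝ := profileIntegral mu (posPow β) f (fun _ => (1 : ℝ)) with hD
    set N : Rn d → Rn d := profileIntegral mu (posPow β) f (cutId d r) with hN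
    have p1 : 0 < D x₁ := by by_contra hn; nlinarith
    have p2 : 0 < D x₂ := by by_contra hn; nlinarith
    have hTN : N x₂ = D x₂ • profileMean mu s r f x₂ := by
      rw [profileMean, smul_smul, mul_inv_cancel₀ p2.ne', one_smul]
    have hdiff : profileMean mu s r f x₁ - profileMean mu s r f x₂ =
        (D x₁)⁻¹ • ((N x₁ - N x₂) + (D x₂ - D x₁) • profileMean mu s r f x₂) := by
      rw [hTN, sub_smul, sub_add_sub_cancel, smul_sub, smul_smul, inv_mul_cancel₀ p1.ne', one_smul]
      rfl
    have hDinv : (D x₁)⁻¹ ≤ V := by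
      rw [inv_le_iff_one_le_mul₀ p1]; exact hD1
    rw [dist_eq_norm, hdiff, norm_smul, norm_inv, Real.norm_eq_abs, abs_of_pos p1]
    rw [norm_sub_rev, one_mul] at eD
    have h3 : ‖(N x₁ - N x₂) + (D x₂ - D x₁) • profileMean mu s r f x₂‖ ≤
        r * (κ * dist x₁ x₂) + κ * dist x₁ x₂ * r := by
      refine (norm_add_le _ _).trans (add_le_add eN ?_)
      rw [norm_smul]
      exact mul_le_mul eD T2 (norm_nonneg _) (by positivity)
    calc (D x₁)⁻¹ * ‖(N x₁ - N x₂) + (D x₂ - D x₁) • profileMean mu s r f x₂‖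
        ≤ V * (r * (κ * dist x₁ x₂) + κ * dist x₁ x₂ * r) :=
          mul_le_mul hDinv h3 (norm_nonneg _) hV
      _ = 2 * r * V * κ * dist x₁ x₂ := by ring
      _ ≤ K * dist x₁ x₂ := by
          refine mul_le_mul_of_nonneg_right ?_ hd
          rw [hK]
          have : 0 ≤ 2 * r * (2 * b * r) * (8 / h) := by positivity
          linarith
  · have h1 : dist (profileMean mu s r f x₁) (profileMean mu s r f x₂) ≤ 2 * r := by
      rw [dist_eq_norm]; exact (norm_sub_le _ _).trans (by linarith)
    refine h1.trans ?_
    have h2 : 1 ≤ (2 * b * r) * (8 / h) * dist x₁ x₂ := by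
      have : (2 * b * r) * (8 / h) * dist x₁ x₂ = 2 * b * r * dist x₁ x₂ / (h / 8) := by
        field_simp
      rw [this, one_le_div (by positivity)]
      exact hgt.le
    have h3 : 2 * r * 1 ≤ 2 * r * ((2 * b * r) * (8 / h) * dist x₁ x₂) := by gcongr
    have h4 : 0 ≤ 2 * r * V * κ * dist x₁ x₂ := by positivity
    have h5 : K * dist x₁ x₂ = 2 * r * V * κ * dist x₁ x₂ +
      2 * r * ((2 * b * r) * (8 / h) * dist x₁ x₂) := by rw [hK]; ring
    linarith

end mean

/-! ### Differentiability of the profile in x for p < 2 -/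

section derivative

variable {d : ℕ} {mu : Measure (Rn d)} {s b V r m M : ℝ}
  {f : Rn d → Rn d → ℝ}

theorem IsProfile.frequently_pos (hf : IsProfile mu s b V r f) (hs : 0 < s) {x : Rn d}
    (hx : x ∈ ball (0 : Rn d) (r / 3)) : ∃ᵐ y ∂mu, 0 < f x y := by
  intro hn
  have h1 := hf.mass x hx
  rw [integral_congr_ae (g := fun _ => (0 : ℝ)) (hn.mono fun y hy => by
    have : f x y = 0 := le_antisymm (not_lt.1 hy) (hf.nonneg _ _)
    simp only [this, Real.zero_rpow (inv_pos.2 hs).ne']), integral_zero] at h1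
  exact zero_ne_one h1

theorem IsProfile.abs_sub_le (hf : IsProfile mu s b V r f) (x x' y : Rn d) :
    |f x y - f x' y| ≤ 2 * b * r * ‖x - x'‖ := by
  have k1 := hf.lip x x' y
  have k2 := hf.lip x' x y
  rw [dist_eq_norm] at k1 k2
  rw [norm_sub_rev] at k2
  rw [abs_le]
  constructor <;> linarith

theorem IsProfile.tendsto (hf : IsProfile mu s b V r f) (x y : Rn d) :
    Filter.Tendsto (fun x => f x y) (nhds x) (nhds (f x y)) := by
  rw [tendsto_iff_norm_sub_tendsto_zero]
  refine squeeze_zero (fun _ => norm_nonneg _) (fun x' => hf.abs_sub_le x' x y) ?_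
  have : Continuous fun x' : Rn d => 2 * b * r * ‖x' - x‖ := by fun_prop
  simpa using this.tendsto x

/-- When all four values are positive, the cycle inequality for (x, x₀) and the one for (x₀, x) are
opposite, hence equalities. A countable dense set of x provides one null set of q for all x. -/
theorem IsProfile.forall_cycle [IsFiniteMeasure mu] (hf : IsProfile mu s b V r f) (hr : 0 < r) {x₀ : Rn d}
    (hx₀ : x₀ ∈ ball (0 : Rn d) (r / 3)) :
    ∀ᵐ q ∂(mu.prod mu), ∀ x ∈ ball (0 : Rn d) (r / 3), 0 < f x q.1 → 0 < f x q.2 →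
      0 < f x₀ q.1 → 0 < f x₀ q.2 →
      f x q.2 - f x₀ q.2 = f x q.1 - f x₀ q.1 + b * inner ℝ (x - x₀) (q.2 - q.1) := by
  obtain ⟨u, hu, hdense⟩ := exists_dense_seq_of_ae (isOpen_ball (x := (0 : Rn d)) (ε := r / 3))
    ⟨0, mem_ball_self (by positivity)⟩ (Q := fun _ => True) (Filter.Eventually.of_forall fun _ =>
      trivial)
  filter_upwards [ae_all_iff.2 fun i => hf.cycle (u i) (hu i).1 x₀ hx₀,
    ae_all_iff.2 fun i => hf.cycle x₀ hx₀ (u i) (hu i).1] with q h1 h2 x hx p1 p2 p3 p4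
  choose i hi using fun n : ℕ => hdense x hx (1 / ((n : ℝ) + 1)) (by positivity)
  have hlim : Filter.Tendsto (fun n => u (i n)) Filter.atTop (nhds x) :=
    tendsto_iff_dist_tendsto_zero.2 (squeeze_zero (fun _ => dist_nonneg)
      (fun n => (hi n).le) tendsto_one_div_add_atTop_nhds_zero_nat)
  have t1 := (hf.tendsto x q.1).comp hlim
  have t2 := (hf.tendsto x q.2).comp hlim
  have hin : Filter.Tendsto (fun n => b * inner ℝ (u (i n) - x₀) (q.2 - q.1)) Filter.atTop
      (nhds (b * inner ℝ (x - x₀) (q.2 - q.1))) :=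
    ((hlim.sub tendsto_const_nhds).inner tendsto_const_nhds).const_mul b
  refine tendsto_nhds_unique_of_eventuallyEq (t2.sub tendsto_const_nhds)
    ((t1.sub tendsto_const_nhds).add hin) ?_
  filter_upwards [t1.eventually_const_lt p1, t2.eventually_const_lt p2] with n n1 n2
  have k1 := h1 (i n) n1 p4
  have k2 := h2 (i n) p3 n2
  have e1 : inner ℝ (u (i n) - x₀) (q.1 - q.2) = -inner ℝ (u (i n) - x₀) (q.2 - q.1) := by
    rw [← inner_neg_right, neg_sub]
  have e2 : inner ℝ (x₀ - u (i n)) (q.1 - q.2) = inner ℝ (u (i n) - x₀) (q.2 - q.1) := by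
    rw [← neg_sub (u (i n)), ← neg_sub q.2, inner_neg_neg]
  rw [e1] at k1
  rw [e2] at k2
  simp only [Function.comp]
  linarith

theorem Real.abs_rpow_sub_rpow_le {γ V a c : ℝ} (hγ : 1 ≤ γ) (ha : a ∈ Icc 0 V)
    (hc : c ∈ Icc 0 V) : |a ^ γ - c ^ γ| ≤ γ * V ^ (γ - 1) * |a - c| := by
  refine Convex.norm_image_sub_le_of_norm_hasDerivWithin_le (s := Icc 0 V) (f := fun t => t ^ γ)
    (f' := fun t => γ * t ^ (γ - 1))
    (fun t _ => (Real.hasDerivAt_rpow_const (Or.inr hγ)).hasDerivWithinAt) (fun t ht => ?_)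
    (convex_Icc 0 V) hc ha
  rw [Real.norm_eq_abs, abs_of_nonneg (mul_nonneg (by linarith) (Real.rpow_nonneg ht.1 _))]
  exact mul_le_mul_of_nonneg_left (Real.rpow_le_rpow ht.1 ht.2 (by linarith)) (by linarith)

/-- On the support, f(x,y) - f(x₀,y) = Δ(x) + b⟨x - x₀, y⟩ with Δ independent of y. Expanding the
constraint ∫ f^γ = 1, γ = 1/s, to first order gives D (Δ(x) + b⟨x - x₀, T(x₀)⟩) = o(|x - x₀|), where
D > 0 is the total weight, so Δ has gradient -bT(x₀). Since γ > 1, t^γ has zero slope at t = 0, and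
points off the support do not contribute. -/
theorem IsProfile.hasFDerivAt [IsFiniteMeasure mu] (hf : IsProfile mu s b V r f) (hs : 0 < s) (hs1 : s < 1)
    (hb : 0 ≤ b) (hr : 0 < r) (hV : 0 ≤ V) {x₀ : Rn d} (hx₀ : x₀ ∈ ball (0 : Rn d) (r / 3)) :
    ∀ᵐ y ∂mu, 0 < f x₀ y →
      HasFDerivAt (fun x => f x y) (b • innerSL ℝ (y - profileMean mu s r f x₀)) x₀ := by
  set γ := s⁻¹ with hγ
  set β := γ - 1 with hβ
  have hγ1 : 1 < γ := (one_lt_inv₀ hs).2 hs1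
  have hβ0 : 0 < β := by linarith
  set U := ball (0 : Rn d) (r / 3) with hU
  have hUn : U ∈ nhds x₀ := isOpen_ball.mem_nhds hx₀
  obtain ⟨y₁, hy₁, hcyc⟩ := ((hf.frequently_pos hs hx₀).and_eventually
    (Measure.ae_ae_of_ae_prod (hf.forall_cycle hr hx₀))).exists
  set Δ : Rn d → ℝ := fun x => f x y₁ - f x₀ y₁ - b * inner ℝ (x - x₀) y₁ with hΔ
  have hev : ∀ᵐ y ∂mu, 0 < f x₀ y →
      ∀ᶠ x in nhds x₀, f x y - f x₀ y = Δ x + b * inner ℝ (x - x₀) y := by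
    filter_upwards [hcyc] with y hy p
    filter_upwards [hUn, (hf.tendsto x₀ y₁).eventually_const_lt hy₁,
      (hf.tendsto x₀ y).eventually_const_lt p] with x hx p1 p2
    have := hy x hx p1 p2 hy₁ p
    rw [inner_sub_right] at this
    simp only [hΔ]
    linarith
  have hΔ0 : Δ x₀ = 0 := by simp [hΔ]
  set D := profileIntegral mu (posPow β) f (fun _ => (1 : ℝ)) x₀ with hD
  set N := profileIntegral mu (posPow β) f (cutId d r) x₀ with hN
  set T := profileMean mu s r f x₀ with hT
  have hD1 : 1 ≤ V * D := hf.one_le_mul_profileIntegral hs hs1.le hx₀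
  have hDpos : 0 < D := by by_contra hn; nlinarith
  have hNT : N = D • T := by
    rw [hT, profileMean, smul_smul, mul_inv_cancel₀ hDpos.ne', one_smul]
  have hpB : ∀ t, 0 ≤ t → t ≤ V → |posPow β t| ≤ V ^ β := fun t ht htV => by
    rw [abs_of_nonneg (posPow_nonneg _ _)]; exact posPow_le hβ0.le ht htV
  have hpeq : ∀ t, 0 ≤ t → posPow β t = t ^ β := fun t ht => by
    rcases ht.eq_or_lt with h0 | h0
    · rw [← h0, posPow_zero, Real.zero_rpow hβ0.ne']
    · rw [posPow, if_pos h0]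
  -- The remainder in the first-order expansion of the mass density. It is o(|x - x₀|) for almost
  -- every y and at most C |x - x₀|, so dominated convergence applies to the quotient.
  set h : Rn d → Rn d → ℝ := fun x y => f x y ^ γ - f x₀ y ^ γ -
    γ * (posPow β (f x₀ y) * (Δ x + b * inner ℝ (x - x₀) (cutId d r y))) with hh
  have hpt : ∀ᵐ y ∂mu, Filter.Tendsto (fun x => h x y / ‖x - x₀‖) (nhds x₀) (nhds 0) := by
    filter_upwards [hev] with y hy
    have hder : HasDerivAt (fun t : ℝ => t ^ γ) (γ * f x₀ y ^ β) (f x₀ y) :=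
      Real.hasDerivAt_rpow_const (Or.inr hγ1.le)
    have h1 := (hasDerivAt_iff_isLittleO.1 hder).comp_tendsto (hf.tendsto x₀ y)
    have h2 : (fun x => f x y - f x₀ y) =O[nhds x₀] fun x => x - x₀ :=
      Asymptotics.IsBigO.of_bound (2 * b * r) (Filter.Eventually.of_forall fun x =>
        hf.abs_sub_le x x₀ y)
    have h3 : (fun x => h x y) =o[nhds x₀] fun x => ‖x - x₀‖ := by
      refine ((h1.trans_isBigO h2).congr' ?_ Filter.EventuallyEq.rfl).norm_right
      rcases (hf.nonneg x₀ y).eq_or_lt with h0 | h0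
      · refine Filter.Eventually.of_forall fun x => ?_
        simp only [hh, Function.comp, ← h0, posPow_zero, Real.zero_rpow hβ0.ne', smul_eq_mul]
        ring
      · filter_upwards [hy h0] with x hx
        have hyB : y ∈ ball (0 : Rn d) r := by
          by_contra hn; exact h0.ne' (hf.supp x₀ y hn)
        have e : cutId d r y = y := indicator_of_mem hyB id
        simp only [hh, Function.comp, smul_eq_mul, e, hpeq _ h0.le, ← hx]
        ring
    refine (Asymptotics.isLittleO_iff_tendsto fun x hx => ?_).1 h3
    have : x = x₀ := sub_eq_zero.1 (norm_eq_zero.1 hx)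
    simp [hh, this, hΔ0]
  have hpm : ∀ x, Measurable fun y => posPow β (f x y) := fun x =>
    (measurable_posPow β).comp (hf.meas x)
  have hcm : Measurable (cutId d r) := (stronglyMeasurable_cutId d r).measurable
  have hhm : ∀ x, Measurable (h x) := fun x => by
    have := hpm x₀
    have := hf.meas x
    have := hf.meas x₀
    simp only [hh]
    fun_prop
  set C := γ * V ^ β * (2 * b * r) + γ * (V ^ β * (2 * b * r + b * ‖y₁‖ + b * r)) with hC
  have hC0 : 0 ≤ C := by positivity
  have hbd : ∀ x y, |h x y / ‖x - x₀‖| ≤ C := by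
    intro x y
    rw [abs_div, abs_norm]
    refine div_le_of_le_mul₀ (norm_nonneg _) hC0 ?_
    have a1 : |f x y ^ γ - f x₀ y ^ γ| ≤ γ * V ^ β * (2 * b * r) * ‖x - x₀‖ := by
      refine (Real.abs_rpow_sub_rpow_le hγ1.le ⟨hf.nonneg x y, hf.le x y⟩
        ⟨hf.nonneg x₀ y, hf.le x₀ y⟩).trans ?_
      rw [mul_assoc (γ * V ^ β)]
      exact mul_le_mul_of_nonneg_left (hf.abs_sub_le x x₀ y) (by positivity)
    have a2 : |Δ x + b * inner ℝ (x - x₀) (cutId d r y)| ≤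
        (2 * b * r + b * ‖y₁‖ + b * r) * ‖x - x₀‖ := by
      have b1 := hf.abs_sub_le x x₀ y₁
      have b2 := abs_real_inner_le_norm (x - x₀) y₁
      have b3 := (abs_real_inner_le_norm (x - x₀) (cutId d r y)).trans
        (mul_le_mul_of_nonneg_left (norm_cutId_le hr.le y) (norm_nonneg _))
      have b2' := mul_le_mul_of_nonneg_left b2 hb
      have b3' := mul_le_mul_of_nonneg_left b3 hb
      rw [← abs_of_nonneg hb, ← abs_mul, abs_of_nonneg hb] at b2' b3'
      have b4 := abs_add_le (f x y₁ - f x₀ y₁ - b * inner ℝ (x - x₀) y₁)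
        (b * inner ℝ (x - x₀) (cutId d r y))
      have b5 := abs_sub (f x y₁ - f x₀ y₁) (b * inner ℝ (x - x₀) y₁)
      simp only [hΔ]
      linarith
    have a3 : |γ * (posPow β (f x₀ y) * (Δ x + b * inner ℝ (x - x₀) (cutId d r y)))| ≤
        γ * (V ^ β * ((2 * b * r + b * ‖y₁‖ + b * r) * ‖x - x₀‖)) := by
      rw [abs_mul, abs_of_pos (by linarith : 0 < γ), abs_mul]
      exact mul_le_mul_of_nonneg_left (mul_le_mul (hpB _ (hf.nonneg _ _) (hf.le _ _)) a2
        (abs_nonneg _) (Real.rpow_nonneg hV _)) (by linarith)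
    have a4 := abs_sub (f x y ^ γ - f x₀ y ^ γ)
      (γ * (posPow β (f x₀ y) * (Δ x + b * inner ℝ (x - x₀) (cutId d r y))))
    calc |h x y| ≤ _ := a4
      _ ≤ γ * V ^ β * (2 * b * r) * ‖x - x₀‖ +
        γ * (V ^ β * ((2 * b * r + b * ‖y₁‖ + b * r) * ‖x - x₀‖)) := add_le_add a1 a3
      _ = C * ‖x - x₀‖ := by rw [hC]; ring
  have hlim := tendsto_integral_filter_of_dominated_convergence (μ := mu) (l := nhds x₀)
    (F := fun x y => h x y / ‖x - x₀‖) (f := fun _ => (0 : ℝ)) (fun _ => C)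
    (Filter.Eventually.of_forall fun x => ((hhm x).div_const _).aestronglyMeasurable)
    (Filter.Eventually.of_forall fun x => Filter.Eventually.of_forall fun y => hbd x y)
    (integrable_const _) hpt
  rw [integral_zero] at hlim
  have ip1 := hf.integrable_smul (measurable_posPow β) hpB (F := fun _ => (1 : ℝ))
    stronglyMeasurable_const (C := 1) (by simp) x₀
  have ipN := hf.integrable_smul (measurable_posPow β) hpB (stronglyMeasurable_cutId d r)
    (norm_cutId_le hr.le) x₀
  have ipow : ∀ x, Integrable (fun y => f x y ^ γ) mu := fun x =>
    Integrable.of_bound ((hf.meas x).pow_const γ).aestronglyMeasurable (V ^ γ)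
      (Filter.Eventually.of_forall fun y => by
        rw [Real.norm_eq_abs, abs_of_nonneg (Real.rpow_nonneg (hf.nonneg _ _) _)]
        exact Real.rpow_le_rpow (hf.nonneg _ _) (hf.le _ _) (by linarith))
  have hint : ∀ x ∈ U, ∫ y, h x y / ‖x - x₀‖ ∂mu =
      -(γ * D) * ((Δ x + b * inner ℝ (x - x₀) T) / ‖x - x₀‖) := by
    intro x hx
    have e1 : ∀ y, h x y = f x y ^ γ - f x₀ y ^ γ - (γ * Δ x * (posPow β (f x₀ y) • (1 : ℝ)) +
        γ * b * inner ℝ (x - x₀) (posPow β (f x₀ y) • cutId d r y)) := by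
      intro y
      rw [inner_smul_right, smul_eq_mul]
      simp only [hh]
      ring
    rw [integral_div]
    simp only [e1]
    have j1 : Integrable (fun y => f x y ^ γ - f x₀ y ^ γ) mu := (ipow x).sub (ipow x₀)
    have j2 : Integrable (fun y => γ * Δ x * (posPow β (f x₀ y) • (1 : ℝ))) mu := ip1.const_mul _
    have j3 : Integrable (fun y => γ * b * inner ℝ (x - x₀) (posPow β (f x₀ y) • cutId d r y)) mu :=
      (ipN.const_inner (x - x₀)).const_mul _
    have j4 : Integrable (fun y => γ * Δ x * (posPow β (f x₀ y) • (1 : ℝ)) +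
      γ * b * inner ℝ (x - x₀) (posPow β (f x₀ y) • cutId d r y)) mu := j2.add j3
    rw [integral_sub j1 j4, integral_sub (ipow x) (ipow x₀), integral_add j2 j3,
      integral_const_mul, integral_const_mul, integral_inner ipN, hf.mass x hx, hf.mass x₀ hx₀]
    have e2 : ∫ y, posPow β (f x₀ y) • (1 : ℝ) ∂mu = D := rfl
    have e3 : ∫ y, posPow β (f x₀ y) • cutId d r y ∂mu = N := rfl
    rw [e2, e3, hNT, inner_smul_right]
    ring
  have hlim2 : Filter.Tendsto (fun x => (Δ x + b * inner ℝ (x - x₀) T) / ‖x - x₀‖) (nhds x₀)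
      (nhds 0) := by
    have hγD : -(γ * D) ≠ 0 := neg_ne_zero.2 (by positivity)
    have h1 := (hlim.congr' (Filter.eventually_of_mem hUn hint)).const_mul (-(γ * D))⁻¹
    simp only [← mul_assoc, inv_mul_cancel₀ hγD, one_mul, mul_zero] at h1
    exact h1
  have hlit : (fun x => Δ x + b * inner ℝ (x - x₀) T) =o[nhds x₀] fun x => ‖x - x₀‖ := by
    refine (Asymptotics.isLittleO_iff_tendsto fun x hx => ?_).2 hlim2
    have : x = x₀ := sub_eq_zero.1 (norm_eq_zero.1 hx)
    simp [this, hΔ0]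
  filter_upwards [hev] with y hy p
  rw [hasFDerivAt_iff_isLittleO]
  refine (hlit.congr' ?_ Filter.EventuallyEq.rfl).of_norm_right
  filter_upwards [hy p] with x hx
  rw [hx, smul_apply, innerSL_apply_apply, smul_eq_mul,
    real_inner_comm (x - x₀) (y - T), inner_sub_right]
  ring

end derivative

/-! ### Truncated weights and continuous differentiability of the mean -/

/-- The difference of two approximants has local Lipschitz constant at most the sum of their errors,
which bounds the difference of derivatives. The derivatives are therefore uniformly Cauchy and their
continuous limit is the derivative of `f`. -/
theorem contDiffOn_one_of_lipschitz_approx {E F : Type*} [NormedAddCommGroup E] [NormedSpace ℝ E]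
    [NormedAddCommGroup F] [NormedSpace ℝ F] [CompleteSpace F] {U : Set E} (hU : IsOpen U)
    {f : E → F} (h : ∀ η : ℝ, 0 < η → ∃ (g : E → F) (g' : E → E →L[ℝ] F),
      (∀ x ∈ U, HasFDerivAt g (g' x) x) ∧ ContinuousOn g' U ∧ (∀ x ∈ U, ‖f x - g x‖ ≤ η) ∧
      ∀ x ∈ U, ∀ᶠ x' in nhds x, ‖(f x' - g x') - (f x - g x)‖ ≤ η * ‖x' - x‖) :
    ContDiffOn ℝ 1 f U := by
  have hη : ∀ n : ℕ, (0 : ℝ) < 1 / ((n : ℝ) + 1) := fun n => by positivity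
  have hη0 := tendsto_one_div_add_atTop_nhds_zero_nat (𝕜 := ℝ)
  choose g g' hd hc hclose hlip using fun n : ℕ => h _ (hη n)
  have hdiff : ∀ i j, ∀ x ∈ U, ‖g' i x - g' j x‖ ≤ 1 / ((i : ℝ) + 1) + 1 / ((j : ℝ) + 1) := by
    intro i j x hx
    refine ((hd i x hx).sub (hd j x hx)).le_of_lip' (by positivity) ?_
    filter_upwards [hlip i x hx, hlip j x hx] with x' h1 h2
    have e : (g i - g j) x' - (g i - g j) x =
        ((f x' - g j x') - (f x - g j x)) - ((f x' - g i x') - (f x - g i x)) := by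
      simp only [Pi.sub_apply]; abel
    rw [e, add_mul, add_comm]
    exact (norm_sub_le _ _).trans (add_le_add h2 h1)
  have hcau : UniformCauchySeqOn g' Filter.atTop U := by
    rw [Metric.uniformCauchySeqOn_iff]
    intro ε hε
    obtain ⟨k, hk⟩ := ((hη0.eventually_lt_const (half_pos hε))).exists
    refine ⟨k, fun i hi j hj x hx => ?_⟩
    rw [dist_eq_norm]
    have hi' : 1 / ((i : ℝ) + 1) ≤ 1 / ((k : ℝ) + 1) := Nat.one_div_le_one_div hi
    have hj' : 1 / ((j : ℝ) + 1) ≤ 1 / ((k : ℝ) + 1) := Nat.one_div_le_one_div hj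
    linarith [hdiff i j x hx]
  have hlim : ∀ x, ∃ L : E →L[ℝ] F, x ∈ U → Filter.Tendsto (fun n => g' n x) Filter.atTop (nhds L) := by
    intro x
    by_cases hx : x ∈ U
    · obtain ⟨L, hL⟩ := cauchySeq_tendsto_of_complete (hcau.cauchySeq hx)
      exact ⟨L, fun _ => hL⟩
    · exact ⟨0, fun h => absurd h hx⟩
  choose f' hf' using hlim
  have hunif := hcau.tendstoUniformlyOn_of_tendsto hf'
  refine contDiffOn_one_of_hasFDerivAt hU (f' := f') (fun x hx => ?_)
    (hunif.continuousOn (Filter.Frequently.of_forall hc))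
  refine hasFDerivAt_of_tendstoUniformlyOn hU hunif hd (fun x hx => ?_) hx
  rw [tendsto_iff_norm_sub_tendsto_zero]
  exact squeeze_zero (fun _ => norm_nonneg _) (fun n => by
    rw [norm_sub_rev]; exact hclose n x hx) hη0

section cutoff

/-- A `C¹` truncation of `t^β` that vanishes up to the level `κ`. -/
noncomputable def cutPow (β κ t : ℝ) : ℝ :=
  if t ≤ κ then 0 else t ^ β - κ ^ β * (1 + β * (1 - κ / t))

/-- The derivative of `cutPow β κ`. -/
noncomputable def cutPowDeriv (β κ t : ℝ) : ℝ :=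
  β * max t κ ^ (β - 1) - κ ^ β * (β * (κ / max t κ ^ 2))

variable {β κ : ℝ}

theorem cutPowDeriv_of_le (hκ : 0 < κ) {t : ℝ} (ht : t ≤ κ) : cutPowDeriv β κ t = 0 := by
  rw [cutPowDeriv, max_eq_right ht, Real.rpow_sub_one hκ.ne']
  field_simp
  ring

theorem continuous_cutPowDeriv (hκ : 0 < κ) : Continuous (cutPowDeriv β κ) := by
  have h : ∀ t, max t κ ≠ 0 := fun t => (lt_max_of_lt_right hκ).ne'
  have hm : Continuous fun t => max t κ := by fun_prop
  unfold cutPowDeriv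
  exact (continuous_const.mul (hm.rpow_const fun t => Or.inl (h t))).sub
    (continuous_const.mul (continuous_const.mul
      (continuous_const.div (hm.pow 2) fun t => pow_ne_zero 2 (h t))))

/-- The subtracted term κ^β (1 + β(1 - κ/t)) has the value and the slope of t^β at t = κ, so the two
branches join in C¹. For β ≥ 0 it is also increasing and at most (1+β) κ^β, which makes the
truncation error monotone and small. -/
theorem hasDerivAt_cutPow (hκ : 0 < κ) (t : ℝ) :
    HasDerivAt (cutPow β κ) (cutPowDeriv β κ t) t := by
  have hL : ∀ u ≤ κ, HasDerivWithinAt (cutPow β κ) (cutPowDeriv β κ u) (Iic κ) u := by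
    intro u hu
    rw [cutPowDeriv_of_le hκ hu]
    exact (hasDerivWithinAt_const u (Iic κ) (0 : ℝ)).congr (fun x hx => if_pos hx) (if_pos hu)
  have hR : ∀ u, κ ≤ u → HasDerivWithinAt (cutPow β κ) (cutPowDeriv β κ u) (Ici κ) u := by
    intro u hu
    have hu0 : u ≠ 0 := (hκ.trans_le hu).ne'
    have h1 : HasDerivAt (fun t => t ^ β - κ ^ β * (1 + β * (1 - κ / t)))
        (cutPowDeriv β κ u) u := by
      rw [cutPowDeriv, max_eq_left hu]
      have h2 : HasDerivAt (fun t => κ / t) (-(κ / u ^ 2)) u := by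
        have := (hasDerivAt_inv hu0).const_mul κ
        simp only [← div_eq_mul_inv] at this
        exact this.congr_deriv (by rw [mul_neg, ← div_eq_mul_inv])
      have h3 := (Real.hasDerivAt_rpow_const (p := β) (Or.inl hu0)).sub
        ((((h2.const_sub 1).const_mul β).const_add 1).const_mul (κ ^ β))
      exact HasDerivAt.congr_deriv h3 (by simp)
    have e : ∀ x ∈ Ici κ, cutPow β κ x = x ^ β - κ ^ β * (1 + β * (1 - κ / x)) := by
      intro x hx
      rcases (mem_Ici.1 hx).eq_or_lt with h0 | h0
      · rw [← h0, cutPow, if_pos le_rfl, div_self hκ.ne']; ring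
      · rw [cutPow, if_neg (not_le.2 h0)]
    exact h1.hasDerivWithinAt.congr e (e u hu)
  rcases lt_trichotomy t κ with h | h | h
  · exact (hL t h.le).hasDerivAt (Iic_mem_nhds h)
  · have := (hL t h.le).union (hR t h.ge)
    rwa [Iic_union_Ici, hasDerivWithinAt_univ] at this
  · exact (hR t h.le).hasDerivAt (Ici_mem_nhds h)

/-- The error of the truncation. -/
noncomputable def cutError (β κ t : ℝ) : ℝ := posPow β t - cutPow β κ t

theorem cutError_of_le {t : ℝ} (ht : t ≤ κ) : cutError β κ t = posPow β t := by
  rw [cutError, cutPow, if_pos ht, sub_zero]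

theorem cutError_of_ge (hκ : 0 < κ) {t : ℝ} (ht : κ ≤ t) :
    cutError β κ t = κ ^ β * (1 + β * (1 - κ / t)) := by
  rcases ht.eq_or_lt with h | h
  · rw [← h, cutError_of_le le_rfl, posPow, if_pos hκ, div_self hκ.ne']; ring
  · rw [cutError, cutPow, if_neg (not_le.2 h), posPow, if_pos (hκ.trans h)]; ring

theorem measurable_cutError (hκ : 0 < κ) : Measurable (cutError β κ) :=
  (measurable_posPow β).sub
    (continuous_iff_continuousAt.2 fun t => (hasDerivAt_cutPow hκ t).continuousAt).measurable

theorem cutError_sub_of_ge (hκ : 0 < κ) {t u : ℝ} (hu : κ ≤ u) (hut : u ≤ t) :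
    cutError β κ t - cutError β κ u = κ ^ β * β * (κ / u) * (1 / t) * (t - u) := by
  have hu0 : 0 < u := hκ.trans_le hu
  have ht0 : 0 < t := hu0.trans_le hut
  rw [cutError_of_ge hκ hu, cutError_of_ge hκ (hu.trans hut)]
  field_simp
  ring

theorem cutError_mono (hβ : 0 ≤ β) (hκ : 0 < κ) : MonotoneOn (cutError β κ) (Ici 0) := by
  have h1 : ∀ u t, κ ≤ u → u ≤ t → cutError β κ u ≤ cutError β κ t := by
    intro u t hu hut
    have := cutError_sub_of_ge (β := β) hκ hu hut
    have hu0 : 0 < u := hκ.trans_le hu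
    have ht0 : 0 < t := hu0.trans_le hut
    have h2 : 0 ≤ t - u := by linarith
    have : 0 ≤ κ ^ β * β * (κ / u) * (1 / t) * (t - u) := by positivity
    linarith
  have h2 : ∀ u t, 0 ≤ u → u ≤ t → t ≤ κ → cutError β κ u ≤ cutError β κ t := by
    intro u t hu hut ht
    rw [cutError_of_le ht, cutError_of_le (hut.trans ht)]
    exact posPow_mono hβ hu (hu.trans hut) hut
  intro u hu t ht hut
  rcases le_total t κ with h | h
  · exact h2 u t hu hut h
  · rcases le_total u κ with h' | h'
    · exact (h2 u κ hu h' le_rfl).trans (h1 κ t le_rfl h)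
    · exact h1 u t h' hut

theorem cutError_zero (hκ : 0 < κ) : cutError β κ 0 = 0 := by
  rw [cutError_of_le hκ.le, posPow_zero]

theorem cutError_nonneg (hβ : 0 ≤ β) (hκ : 0 < κ) {t : ℝ} (ht : 0 ≤ t) : 0 ≤ cutError β κ t := by
  rw [← cutError_zero (β := β) hκ]
  exact cutError_mono hβ hκ (mem_Ici.2 le_rfl) ht ht

theorem cutError_le (hβ : 0 ≤ β) (hκ : 0 < κ) {t : ℝ} (ht : 0 ≤ t) :
    cutError β κ t ≤ (1 + β) * κ ^ β := by
  have hκβ : 0 < κ ^ β := by positivity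
  rcases le_total t κ with h | h
  · rw [cutError_of_le h]
    have := posPow_le hβ ht h
    nlinarith
  · rw [cutError_of_ge hκ h, mul_comm]
    have h0 : 0 < t := hκ.trans_le h
    have : 0 ≤ κ / t := by positivity
    refine mul_le_mul_of_nonneg_right ?_ hκβ.le
    nlinarith

/-- If u ≤ h/4, then t - u ≥ h/4 and the total error (1+β) κ^β is already enough; if u ≥ h/4 ≥ κ,
the explicit formula applies. The constant tends to zero with κ when β > 0. -/
theorem cutError_sub_le (hβ : 0 ≤ β) (hκ : 0 < κ) {t u h : ℝ} (hh : 0 < h) (hκh : κ ≤ h / 4)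
    (hu : 0 ≤ u) (hut : u ≤ t) (ht : h / 2 ≤ t) :
    cutError β κ t - cutError β κ u ≤ (1 + β) * κ ^ β * (4 / h) * (t - u) := by
  have hκβ : 0 < κ ^ β := by positivity
  have htu : 0 ≤ t - u := by linarith
  rcases le_total u (h / 4) with h1 | h1
  · have h2 := cutError_le hβ hκ (hu.trans hut)
    have h3 := cutError_nonneg hβ hκ hu
    have h4 : 1 ≤ 4 / h * (t - u) := by
      have : 4 / h * (h / 4) ≤ 4 / h * (t - u) := by gcongr; linarith
      have e : 4 / h * (h / 4) = 1 := by field_simp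
      linarith
    have h5 : (1 + β) * κ ^ β * 1 ≤ (1 + β) * κ ^ β * (4 / h * (t - u)) := by gcongr
    linarith
  · have hu0 : 0 < u := by linarith
    have ht0 : 0 < t := by linarith
    rw [cutError_sub_of_ge hκ (hκh.trans h1) hut]
    have h2 : κ / u ≤ 1 := (div_le_one hu0).2 (hκh.trans h1)
    have h3 : 1 / t ≤ 4 / h := by rw [div_le_div_iff₀ ht0 hh]; linarith
    calc κ ^ β * β * (κ / u) * (1 / t) * (t - u)
        ≤ κ ^ β * (1 + β) * 1 * (4 / h) * (t - u) := by gcongr; linarith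
      _ = _ := by ring

end cutoff

section smooth

variable {d : ℕ} {mu : Measure (Rn d)} [IsFiniteMeasure mu] {s b V r m M : ℝ}
  {f : Rn d → Rn d → ℝ} {H : Type*} [NormedAddCommGroup H] [NormedSpace ℝ H]

/-- The derivative of the truncated weighted integral. -/
noncomputable def cutIntegralDeriv (mu : Measure (Rn d)) (b r β κ : ℝ) (f : Rn d → Rn d → ℝ)
    (T : Rn d → Rn d) (F : Rn d → H) (x : Rn d) : Rn d →L[ℝ] H :=
  ∫ y, cutPowDeriv β κ (f x y) • (b • (innerSL ℝ (cutId d r y - T x)).smulRight (F y)) ∂mu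

theorem stronglyMeasurable_cutIntegralDeriv {β κ : ℝ} (hκ : 0 < κ) {g : Rn d → ℝ}
    (hg : Measurable g) (b r : ℝ) (T : Rn d) {F : Rn d → H} (hF : StronglyMeasurable F) :
    StronglyMeasurable fun y =>
      cutPowDeriv β κ (g y) • (b • (innerSL ℝ (cutId d r y - T)).smulRight (F y)) := by
  have h1 := (ContinuousLinearMap.smulRightL ℝ (Rn d) H).continuous₂
  have h2 : Continuous fun w : Rn d × H => (innerSL ℝ w.1).smulRight w.2 :=
    h1.comp (((innerSL ℝ (E := Rn d)).continuous.comp continuous_fst).prodMk continuous_snd)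
  have h3 : StronglyMeasurable fun y => (cutId d r y - T, F y) :=
    ((stronglyMeasurable_cutId d r).sub stronglyMeasurable_const).prodMk hF
  exact (((continuous_cutPowDeriv hκ).measurable.comp hg).stronglyMeasurable).smul
    ((h2.comp_stronglyMeasurable h3).const_smul b)

theorem norm_cutIntegralDeriv_integrand_le {β κ B C : ℝ} (hb : 0 ≤ b) (hr : 0 ≤ r)
    {t : ℝ} (hB : |cutPowDeriv β κ t| ≤ B) {T : Rn d} (hT : ‖T‖ ≤ r) {w : H} (hw : ‖w‖ ≤ C)
    (y : Rn d) :
    ‖cutPowDeriv β κ t • (b • (innerSL ℝ (cutId d r y - T)).smulRight w)‖ ≤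
      B * (b * (2 * r * C)) := by
  have h1 : ‖cutId d r y - T‖ ≤ 2 * r := (norm_sub_le _ _).trans (by
    linarith [norm_cutId_le hr y])
  rw [norm_smul, norm_smul, ContinuousLinearMap.norm_smulRight_apply, innerSL_apply_norm,
    Real.norm_eq_abs, Real.norm_eq_abs, abs_of_nonneg hb]
  have hB0 : 0 ≤ B := (abs_nonneg _).trans hB
  gcongr

/-- The profile need not be differentiable at the edge of its support, but the truncated weight
vanishes identically near x₀ for y with f(x₀, y) = 0. Elsewhere the chain rule and dominated
convergence apply. -/
theorem IsProfile.hasFDerivAt_cutIntegral [CompleteSpace H] (hf : IsProfile mu s b V r f)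
    (hs : 0 < s) (hs1 : s < 1) (hb : 0 ≤ b) (hr : 0 < r) (hV : 0 ≤ V) {κ : ℝ} (hκ : 0 < κ)
    {F : Rn d → H} (hF : StronglyMeasurable F) {C : ℝ} (hC : ∀ y, ‖F y‖ ≤ C) {x₀ : Rn d}
    (hx₀ : x₀ ∈ ball (0 : Rn d) (r / 3)) :
    HasFDerivAt (profileIntegral mu (cutPow (s⁻¹ - 1) κ) f F)
      (cutIntegralDeriv mu b r (s⁻¹ - 1) κ f (profileMean mu s r f) F x₀) x₀ := by
  set β := s⁻¹ - 1 with hβ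
  have hcont : Continuous (cutPow β κ) :=
    continuous_iff_continuousAt.2 fun t => (hasDerivAt_cutPow hκ t).continuousAt
  obtain ⟨B, hB⟩ := (isCompact_Icc (a := (0 : ℝ)) (b := V)).exists_bound_of_continuousOn
    hcont.continuousOn
  obtain ⟨B', hB'⟩ := (isCompact_Icc (a := (0 : ℝ)) (b := V)).exists_bound_of_continuousOn
    (continuous_cutPowDeriv (β := β) hκ).continuousOn
  have hC0 : 0 ≤ C := (norm_nonneg _).trans (hC 0)
  have hB'0 : 0 ≤ B' := (norm_nonneg _).trans (hB' 0 (left_mem_Icc.2 hV))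
  have hlip : ∀ x y, |cutPow β κ (f x y) - cutPow β κ (f x₀ y)| ≤ B' * |f x y - f x₀ y| :=
    fun x y => Convex.norm_image_sub_le_of_norm_hasDerivWithin_le
      (fun t _ => (hasDerivAt_cutPow hκ t).hasDerivWithinAt) hB' (convex_Icc 0 V)
      ⟨hf.nonneg x₀ y, hf.le x₀ y⟩ ⟨hf.nonneg x y, hf.le x y⟩
  have hint := fun x => hf.integrable_smul hcont.measurable (B := B)
    (fun t h0 hV => hB t ⟨h0, hV⟩) hF hC x
  refine (hasFDerivAt_integral_of_dominated_loc_of_lip' (s := univ)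
    (F := fun x y => cutPow β κ (f x y) • F y) (bound := fun _ => B' * (2 * b * r) * C)
    Filter.univ_mem (fun x _ => (hint x).1) (hint x₀)
    (stronglyMeasurable_cutIntegralDeriv hκ (hf.meas x₀) b r _ hF).aestronglyMeasurable
    (Filter.Eventually.of_forall fun y x _ => ?_) (integrable_const _) ?_).2
  · rw [← sub_smul, norm_smul, Real.norm_eq_abs]
    calc |cutPow β κ (f x y) - cutPow β κ (f x₀ y)| * ‖F y‖
        ≤ (B' * (2 * b * r * ‖x - x₀‖)) * C :=
          mul_le_mul ((hlip x y).trans (mul_le_mul_of_nonneg_left (hf.abs_sub_le x x₀ y) hB'0))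
            (hC y) (norm_nonneg _) (by positivity)
      _ = _ := by ring
  · filter_upwards [hf.hasFDerivAt hs hs1 hb hr hV hx₀] with y hy
    rcases (hf.nonneg x₀ y).eq_or_lt with h0 | h0
    · rw [← h0, cutPowDeriv_of_le hκ hκ.le, zero_smul]
      refine (hasFDerivAt_const (0 : H) x₀).congr_of_eventuallyEq ?_
      have ht := hf.tendsto x₀ y
      rw [← h0] at ht
      filter_upwards [ht.eventually_lt_const hκ] with x hx
      rw [cutPow, if_pos hx.le, zero_smul]
    · have hyB : y ∈ ball (0 : Rn d) r := by
        by_contra hn; exact h0.ne' (hf.supp x₀ y hn)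
      have e : cutId d r y = y := indicator_of_mem hyB id
      have h1 := ((hasDerivAt_cutPow (β := β) hκ (f x₀ y)).comp_hasFDerivAt x₀ (hy h0)).smul_const
        (F y)
      refine h1.congr_fderiv ?_
      rw [e]
      ext w
      simp only [ContinuousLinearMap.smulRight_apply, smul_apply, smul_eq_mul, smul_smul]

theorem IsProfile.continuousOn_cutIntegralDeriv (hf : IsProfile mu s b V r f)
    (hs : 0 < s) (hs1 : s ≤ 1) (hb : 0 ≤ b) (hr : 0 < r) (hV : 0 ≤ V) {κ : ℝ} (hκ : 0 < κ)
    (hT : ContinuousOn (profileMean mu s r f) (ball 0 (r / 3)))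
    {F : Rn d → H} (hF : StronglyMeasurable F) {C : ℝ} (hC : ∀ y, ‖F y‖ ≤ C) :
    ContinuousOn (cutIntegralDeriv mu b r (s⁻¹ - 1) κ f (profileMean mu s r f) F)
      (ball 0 (r / 3)) := by
  set β := s⁻¹ - 1 with hβ
  obtain ⟨B', hB'⟩ := (isCompact_Icc (a := (0 : ℝ)) (b := V)).exists_bound_of_continuousOn
    (continuous_cutPowDeriv (β := β) hκ).continuousOn
  have h1 := (ContinuousLinearMap.smulRightL ℝ (Rn d) H).continuous₂
  have h2 : Continuous fun w : Rn d × H => (innerSL ℝ w.1).smulRight w.2 :=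
    h1.comp (((innerSL ℝ (E := Rn d)).continuous.comp continuous_fst).prodMk continuous_snd)
  intro x hx
  refine tendsto_integral_filter_of_dominated_convergence (fun _ => B' * (b * (2 * r * C)))
    (Filter.Eventually.of_forall fun x =>
      (stronglyMeasurable_cutIntegralDeriv hκ (hf.meas x) b r _ hF).aestronglyMeasurable)
    ?_ (integrable_const _) (Filter.Eventually.of_forall fun y => ?_)
  · filter_upwards [self_mem_nhdsWithin] with x' hx'
    exact Filter.Eventually.of_forall fun y => norm_cutIntegralDeriv_integrand_le hb hr.le
      (hB' _ ⟨hf.nonneg _ _, hf.le _ _⟩) (hf.norm_profileMean_le hs hs1 hr hV hx') (hC y) y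
  · have t1 : Filter.Tendsto (fun x => cutPowDeriv β κ (f x y)) (nhdsWithin x (ball 0 (r / 3)))
        (nhds (cutPowDeriv β κ (f x y))) :=
      (((continuous_cutPowDeriv hκ).tendsto _).comp (hf.tendsto x y)).mono_left nhdsWithin_le_nhds
    have t2 : Filter.Tendsto (fun x => (cutId d r y - profileMean mu s r f x, F y))
        (nhdsWithin x (ball 0 (r / 3))) (nhds (cutId d r y - profileMean mu s r f x, F y)) :=
      (tendsto_const_nhds.sub (hT x hx)).prodMk_nhds tendsto_const_nhds
    exact t1.smul (((h2.tendsto _).comp t2).const_smul b)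

/-- The truncation error is itself the integral of a monotone function of the profile, so
`IsProfile.norm_profileIntegral_sub_le` bounds its Lipschitz constant by a multiple of κ^β. This
tends to zero because β > 0, which is p < 2. -/
theorem IsProfile.contDiffOn_profileIntegral [CompleteSpace H] (hf : IsProfile mu s b V r f)
    (hs : 0 < s) (hs1 : s < 1) (hb : 0 < b) (hM : 0 < M) (hr : 0 < r) (hV : 0 ≤ V)
    (hmu : VolBetween mu m M r) (hT : ContinuousOn (profileMean mu s r f) (ball 0 (r / 3)))
    {F : Rn d → H} (hF : StronglyMeasurable F) {C : ℝ} (hC : ∀ y, ‖F y‖ ≤ C) :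
    ContDiffOn ℝ 1 (profileIntegral mu (posPow (s⁻¹ - 1)) f F) (ball 0 (r / 3)) := by
  set β := s⁻¹ - 1 with hβdef
  have hβ : 0 < β := by linarith [(one_lt_inv₀ hs).2 hs1]
  set h := profileHeight d s M r with hh
  have hpos : 0 < h := profileHeight_pos hM hr
  have hω := unitBallVolume_pos d
  have hC0 : 0 ≤ C := (norm_nonneg _).trans (hC 0)
  refine contDiffOn_one_of_lipschitz_approx isOpen_ball fun η hη => ?_
  set A := C * (M * (8 * (unitBallVolume d * r ^ d) / h * (d * (1 + β) + V * ((1 + β) * (4 / h))) *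
    (2 * b * r))) with hA
  set A' := mu.real univ * ((1 + β) * C) with hA'
  have hA0 : 0 ≤ A := by positivity
  have hA'0 : 0 ≤ A' := by positivity
  obtain ⟨κ, hκ, hκh, hκη⟩ : ∃ κ : ℝ, 0 < κ ∧ κ ≤ h / 4 ∧ (A + A') * κ ^ β ≤ η := by
    have hlim : Filter.Tendsto (fun κ : ℝ => (A + A') * κ ^ β) (nhdsWithin 0 (Ioi 0)) (nhds 0) := by
      have := ((Real.continuous_rpow_const hβ.le).tendsto 0).const_mul (A + A')
      rw [Real.zero_rpow hβ.ne', mul_zero] at this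
      exact this.mono_left nhdsWithin_le_nhds
    obtain ⟨κ, h1, h2, h3⟩ := ((hlim.eventually_lt_const hη).and
      ((eventually_mem_nhdsWithin (a := (0 : ℝ)) (s := Ioi 0)).and
      ((Filter.Tendsto.eventually_lt_const (show (0 : ℝ) < h / 4 by positivity)
        (Filter.tendsto_id.mono_left nhdsWithin_le_nhds))))).exists
    exact ⟨κ, h2, le_of_lt h3, h1.le⟩
  have hκβ : 0 < κ ^ β := by positivity
  have hcont : Continuous (cutPow β κ) :=
    continuous_iff_continuousAt.2 fun t => (hasDerivAt_cutPow hκ t).continuousAt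
  obtain ⟨B, hB⟩ := (isCompact_Icc (a := (0 : ℝ)) (b := V)).exists_bound_of_continuousOn
    hcont.continuousOn
  have hpB : ∀ t, 0 ≤ t → t ≤ V → |posPow β t| ≤ V ^ β := fun t ht htV => by
    rw [abs_of_nonneg (posPow_nonneg _ _)]; exact posPow_le hβ.le ht htV
  have i1 := fun x => hf.integrable_smul (measurable_posPow β) hpB hF hC x
  have i2 := fun x => hf.integrable_smul hcont.measurable (B := B)
    (fun t h0 hV => hB t ⟨h0, hV⟩) hF hC x
  have herr : ∀ x, profileIntegral mu (posPow β) f F x - profileIntegral mu (cutPow β κ) f F x =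
      profileIntegral mu (cutError β κ) f F x := by
    intro x
    unfold profileIntegral cutError
    rw [← integral_sub (i1 x) (i2 x)]
    simp only [sub_smul]
  refine ⟨profileIntegral mu (cutPow β κ) f F, _,
    fun x hx => hf.hasFDerivAt_cutIntegral hs hs1 hb.le hr hV hκ hF hC hx,
    hf.continuousOn_cutIntegralDeriv hs hs1.le hb.le hr hV hκ hT hF hC, fun x hx => ?_,
    fun x hx => ?_⟩
  · rw [herr, profileIntegral]
    refine (norm_integral_le_of_norm_le_const (C := (1 + β) * κ ^ β * C)
      (Filter.Eventually.of_forall fun y => ?_)).trans ?_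
    · rw [norm_smul, Real.norm_eq_abs, abs_of_nonneg (cutError_nonneg hβ.le hκ (hf.nonneg _ _))]
      exact mul_le_mul (cutError_le hβ.le hκ (hf.nonneg _ _)) (hC y) (norm_nonneg _)
        (by positivity)
    · calc (1 + β) * κ ^ β * C * mu.real univ = A' * κ ^ β := by rw [hA']; ring
        _ ≤ (A + A') * κ ^ β := by gcongr; linarith
        _ ≤ η := hκη
  · have hnear : ∀ᶠ x' in nhds x, 2 * b * r * dist x' x ≤ h / 8 := by
      have hc : Continuous fun x' : Rn d => 2 * b * r * dist x' x := by fun_prop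
      have := hc.tendsto x
      rw [dist_self, mul_zero] at this
      exact (this.eventually_lt_const (by positivity)).mono fun _ h => le_of_lt h
    filter_upwards [hnear, isOpen_ball.mem_nhds hx] with x' hd hx'
    rw [herr, herr]
    have k := hf.norm_profileIntegral_sub_le hs hb.le hM hr hV hmu hx' hx hd
      (measurable_cutError hκ) (cutError_mono hβ.le hκ) (cutError_zero hκ)
      (B := (1 + β) * κ ^ β) (Λ := (1 + β) * κ ^ β * (4 / h))
      (fun t ht _ => cutError_le hβ.le hκ ht) (by positivity)
      (fun t u hu hut ht _ => cutError_sub_le hβ.le hκ hpos hκh hu hut ht) hF hC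
    refine k.trans ?_
    rw [dist_eq_norm, ← hh]
    calc _ = A * κ ^ β * ‖x' - x‖ := by rw [hA]; ring
      _ ≤ (A + A') * κ ^ β * ‖x' - x‖ := by gcongr; linarith
      _ ≤ η * ‖x' - x‖ := by gcongr

theorem IsProfile.contDiffOn_profileMean (hf : IsProfile mu s b V r f)
    (hs : 0 < s) (hs1 : s < 1) (hb : 0 < b) (hM : 0 < M) (hr : 0 < r) (hV : 0 ≤ V)
    (hmu : VolBetween mu m M r) : ContDiffOn ℝ 1 (profileMean mu s r f) (ball 0 (r / 3)) := by
  obtain ⟨K, hK⟩ := exists_lipschitz_profileMean d hs hs1.le hb hM hr hV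
  have hT := (hK m mu f hf hmu).continuousOn
  refine ((hf.contDiffOn_profileIntegral hs hs1 hb hM hr hV hmu hT
    (F := fun _ => (1 : ℝ)) stronglyMeasurable_const (C := 1) (by simp)).inv fun x hx h0 => ?_).smul
    (hf.contDiffOn_profileIntegral hs hs1 hb hM hr hV hmu hT (stronglyMeasurable_cutId d r)
      (norm_cutId_le hr.le))
  have := hf.one_le_mul_profileIntegral hs hs1.le hx
  rw [h0, mul_zero] at this
  linarith

end smooth

/-! ### Fixed-scale regularity and the return to the minimiser -/

theorem IsProfile.regularMean {d : ℕ} {lam mu : Measure (Rn d)} [IsFiniteMeasure mu]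
    {z : Rn d × Rn d → ℝ} (h : IsPlanDensity lam mu z) {p b V r m M : ℝ} (hp : 1 < p) (hp2 : p ≤ 2)
    (hb : 0 < b) (hM : 0 < M) (hr : 0 < r) (hV : 0 ≤ V) (hmu : VolBetween mu m M r)
    {f : Rn d → Rn d → ℝ} (hf : IsProfile mu (p - 1) b V r f)
    (heq : ∀ᵐ x ∂(volume.restrict (ball (0 : Rn d) (r / 3))), ∀ᵐ y ∂mu, z (x, y) ^ (p - 1) = f x y)
    {K : ℝ≥0} (hK : LipschitzOnWith K (profileMean mu (p - 1) r f) (ball 0 (r / 3))) :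
    RegularMean p (r / 3) K mu z := by
  have hs : 0 < p - 1 := by linarith
  have hs1 : p - 1 ≤ 1 := by linarith
  set β := (p - 1)⁻¹ - 1 with hβdef
  have hβ : 0 ≤ β := by linarith [(one_le_inv₀ hs).2 hs1]
  have hpB : ∀ t, 0 ≤ t → t ≤ V → |posPow β t| ≤ V ^ β := fun t ht htV => by
    rw [abs_of_nonneg (posPow_nonneg _ _)]; exact posPow_le hβ ht htV
  have i1 := fun x => hf.integrable_smul (measurable_posPow β) hpB (F := fun _ => (1 : ℝ))
    stronglyMeasurable_const (C := 1) (by simp) x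
  have i2 := fun x => hf.integrable_smul (measurable_posPow β) hpB (stronglyMeasurable_cutId d r)
    (norm_cutId_le hr.le) x
  have key : ∀ᵐ x ∂(volume.restrict (ball (0 : Rn d) (r / 3))), x ∈ ball (0 : Rn d) (r / 3) ∧
      ((fun y => weight p (z (x, y))) =ᵐ[mu] fun y => posPow β (f x y) • (1 : ℝ)) ∧
      ((fun y => weight p (z (x, y)) • y) =ᵐ[mu] fun y => posPow β (f x y) • cutId d r y) := by
    filter_upwards [heq, ae_restrict_mem measurableSet_ball] with x hx hxU
    have e1 : ∀ᵐ y ∂mu, weight p (z (x, y)) = posPow β (f x y) := by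
      filter_upwards [hx] with y hy
      rw [weight_eq_posPow hp (h.nonneg _), hy]
    refine ⟨hxU, ?_, ?_⟩
    · filter_upwards [e1] with y hy
      rw [hy, smul_eq_mul, mul_one]
    · filter_upwards [e1] with y hy
      rw [hy]
      by_cases hyB : y ∈ ball (0 : Rn d) r
      · rw [cutId, indicator_of_mem hyB, id]
      · rw [hf.supp x y hyB, posPow_zero, zero_smul, zero_smul]
  refine ⟨?_, profileMean mu (p - 1) r f, ?_, hK, fun hp2' =>
    hf.contDiffOn_profileMean hs (by linarith) hb hM hr hV hmu⟩
  · filter_upwards [key] with x ⟨hxU, e1, e2⟩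
    refine ⟨(i1 x).congr e1.symm, (i2 x).congr e2.symm, ?_⟩
    rw [integral_congr_ae e1]
    have h1 := hf.one_le_mul_profileIntegral hs hs1 hxU
    change 0 < profileIntegral mu (posPow β) f (fun _ => (1 : ℝ)) x
    by_contra hn
    nlinarith
  · filter_upwards [key] with x ⟨_, e1, e2⟩
    rw [integral_congr_ae e1, integral_congr_ae e2]
    rfl

theorem nearMass_eq (d : ℕ) (m : ℝ) {R : ℝ} : nearMass d m R = nearMass d m 1 * R ^ d := by
  unfold nearMass
  rw [div_pow, div_pow, one_pow]
  ring

theorem energy_le_nearMass {d : ℕ} {m δ R : ℝ} (hR : 0 < R) (hδ : δ ≤ nearMass d m 1 / 96 ^ 2) :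
    δ * R ^ (d + 2) / (R / 96) ^ 2 ≤ nearMass d m R := by
  rw [nearMass_eq]
  have e : δ * R ^ (d + 2) / (R / 96) ^ 2 = δ * 96 ^ 2 * R ^ d := by
    rw [pow_add]; field_simp
  rw [e]
  refine mul_le_mul_of_nonneg_right ?_ (by positivity)
  rwa [le_div_iff₀ (by norm_num)] at hδ

theorem exists_regularMean_exp (d : ℕ) {b m M : ℝ} (hb : 0 < b) (hm : 0 < m) (hM : 0 < M) :
    ∃ δ : ℝ, 0 < δ ∧ ∀ R : ℝ, 1 ≤ R → ∃ K : ℝ≥0, ∀ (lam mu : Measure (Rn d)) [IsFiniteMeasure lam]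
      [IsFiniteMeasure mu] (z : Rn d × Rn d → ℝ), IsPlanDensity lam mu z → ExpCycle b lam mu z →
      VolBetween lam m M R → VolBetween mu m M R → EnergyLe lam mu z R (δ * R ^ (d + 2)) →
      RegularMean 1 (R / 3) K mu z := by
  have hN := nearMass_pos (d := d) hm one_pos
  refine ⟨nearMass d m 1 / 96 ^ 2, by positivity, fun R hR => ?_⟩
  have hR0 : 0 < R := by linarith
  obtain ⟨K, hK, hT⟩ := exists_exp_tail d hb hm hM hR0
  exact ⟨_, fun lam mu _ _ z h hc hl hmu he => h.regularMean_one hb (by positivity) hm hR0 hl hc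
    (hT lam mu z _ h hc hl hmu he (energy_le_nearMass hR0 le_rfl))⟩

/-- A dichotomy allows `δ` to be chosen before R. If bR²/72 > K₁, the density bound at distance at
least R/3 would be negative, so the plan over B_{R/3} is localised and the profile exists. Otherwise
R is bounded, the density is at most a constant free of R, and small energy contradicts
`IsPlanDensity.not_bounded_of_energy_small`. -/
theorem exists_regularMean_pow (d : ℕ) (hd : 1 ≤ d) {p b m M : ℝ} (hp : 1 < p) (hp2 : p ≤ 2)
    (hb : 0 < b) (hm : 0 < m) (hM : 0 < M) :
    ∃ δ : ℝ, 0 < δ ∧ ∀ R : ℝ, 1 ≤ R → ∃ K : ℝ≥0, ∀ (lam mu : Measure (Rn d)) [IsFiniteMeasure lam]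
      [IsFiniteMeasure mu] (z : Rn d × Rn d → ℝ), IsPlanDensity lam mu z →
      PowCycle (p - 1) b lam mu z →
      VolBetween lam m M R → VolBetween mu m M R → EnergyLe lam mu z R (δ * R ^ (d + 2)) →
      RegularMean p (R / 3) K mu z := by
  have hN := nearMass_pos (d := d) hm one_pos
  have hω := unitBallVolume_pos d
  have hs : 0 < p - 1 := by linarith
  have hs1 : p - 1 ≤ 1 := by linarith
  set K₁ := 2 + 2 / nearMass d m 1 with hK₁
  have hK₁0 : 0 < K₁ := by positivity
  -- In the case bR² ≤ 72K₁ the bound K₁ + bR² on z^(p-1) is at most 73K₁.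
  set Z := (73 * K₁) ^ (p - 1)⁻¹ with hZdef
  have hZ0 : 0 < Z := by positivity
  -- As d ≥ 1 and η ≤ 1, η^d ≤ η, so the second entry makes the mass fraction of pairs closer than η
  -- at most 1/2.
  set η := min (1 / 3) (2 * Z * (M * unitBallVolume d))⁻¹ with hηdef
  have hη0 : 0 < η := by positivity
  have hη3 : η ≤ 1 / 3 := min_le_left _ _
  have hηZ : Z * (M * (unitBallVolume d * η ^ d)) ≤ 1 / 2 := by
    have h1 : η ^ d ≤ η := pow_le_of_le_one hη0.le (by linarith) (by omega)
    have h2 : η ≤ (2 * Z * (M * unitBallVolume d))⁻¹ := min_le_right _ _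
    calc Z * (M * (unitBallVolume d * η ^ d))
        ≤ Z * (M * (unitBallVolume d * (2 * Z * (M * unitBallVolume d))⁻¹)) := by
          gcongr; exact h1.trans h2
      _ = 1 / 2 := by field_simp
  -- The first entry provides mass near the diagonal. The second, with R² ≤ 72K₁/b, makes the far
  -- mass δR^(d+2)/η² at most a quarter of the lower bound for the mass over B_{R/3}.
  set δ := min (nearMass d m 1 / 96 ^ 2)
    (m * (unitBallVolume d * (1 / 3) ^ d) / 4 * (η ^ 2 * (b / (72 * K₁)))) with hδdef
  have hδ0 : 0 < δ := by positivity
  refine ⟨δ, hδ0, fun R hR => ?_⟩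
  have hR0 : 0 < R := by linarith
  have hV : 0 ≤ K₁ + b * R ^ 2 := by positivity
  obtain ⟨K, hK⟩ := exists_lipschitz_profileMean d hs hs1 hb hM hR0 hV
  refine ⟨K, fun lam mu _ _ z h hc hl hmu he => ?_⟩
  have hbd := h.pow_density_bounds hs hs1 hb.le hc hm hR0 hl he
    (energy_le_nearMass hR0 (min_le_left _ _))
  have hNR : 2 + 2 / nearMass d m R ≤ K₁ := by
    rw [hK₁, nearMass_eq d m (R := R)]
    have : nearMass d m 1 ≤ nearMass d m 1 * R ^ d :=
      le_mul_of_one_le_right hN.le (one_le_pow₀ hR)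
    gcongr
  rcases le_or_gt (b * (R ^ 2 / 72)) K₁ with hcase | hcase
  · exfalso
    refine h.not_bounded_of_energy_small hm hM.le hR0 hl hmu he hη0 (by linarith) hZ0.le hηZ ?_ ?_
    · have hδ2 : δ ≤ m * (unitBallVolume d * (1 / 3) ^ d) / 4 * (η ^ 2 * (b / (72 * K₁))) :=
        min_le_right _ _
      have hR2 : R ^ 2 * (b / (72 * K₁)) ≤ 1 := by
        rw [mul_div_assoc', div_le_one (by positivity)]; linarith
      rw [div_lt_iff₀ (by positivity), div_pow]
      calc δ * R ^ (d + 2)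
          ≤ m * (unitBallVolume d * (1 / 3) ^ d) / 4 * (η ^ 2 * (b / (72 * K₁))) * R ^ (d + 2) := by
            gcongr
        _ = m * (unitBallVolume d * (1 / 3) ^ d) / 4 * η ^ 2 * R ^ d * (R ^ 2 * (b / (72 * K₁))) := by
            rw [pow_add]; ring
        _ ≤ m * (unitBallVolume d * (1 / 3) ^ d) / 4 * η ^ 2 * R ^ d * 1 := by gcongr
        _ < m * (unitBallVolume d * (1 / 3) ^ d) / 2 * η ^ 2 * R ^ d := by
            have : 0 < m * (unitBallVolume d * (1 / 3) ^ d) * η ^ 2 * R ^ d := by positivity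
            linarith
        _ = _ := by rw [div_pow, one_pow]; ring
    · filter_upwards [hbd] with a ha hx
      rcases (h.nonneg a).eq_or_lt with h0 | h0
      · rw [← h0]; exact hZ0.le
      · have h1 := (ha hx h0).1
        rw [hZdef, Real.le_rpow_inv_iff_of_pos h0.le (by positivity) hs]
        linarith
  · have hloc : ∀ᵐ a ∂(lam.prod mu), a.1 ∈ ball (0 : Rn d) (R / 3) → 0 < z a →
        z a ^ (p - 1) ≤ K₁ + b * R ^ 2 ∧ dist a.2 a.1 < R / 3 := by
      filter_upwards [hbd] with a ha hx h0
      obtain ⟨h1, h2⟩ := ha hx h0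
      refine ⟨by linarith, ?_⟩
      by_contra hn
      have h3 := h2 (not_lt.1 hn)
      have h4 := Real.rpow_pos_of_pos h0 (p - 1)
      linarith
    obtain ⟨f, hf, heq⟩ := h.exists_profile hs hs1 hb.le hm hR0 hV hc hl hmu hloc
    exact hf.regularMean h hp hp2 hb hM hR0 hV hmu heq (hK m mu f hf hmu)

theorem DensityBetween.volBetween {d : ℕ} {ν : Measure (Rn d)} [IsFiniteMeasure ν] {m M r : ℝ}
    (hac : ν ≪ volume) (h : DensityBetween ν m M r) : VolBetween ν m M r := by
  intro A hA hAr
  have h1 := ae_restrict_of_ae_restrict_of_subset hAr h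
  rw [← Measure.setLIntegral_rnDeriv hac A, ← setLIntegral_const, ← setLIntegral_const]
  exact ⟨lintegral_mono_ae (h1.mono fun x hx => hx.1), lintegral_mono_ae (h1.mono fun x hx => hx.2)⟩

theorem energyLe_of_excessEnergy_le {d : ℕ} {lam mu : Measure (Rn d)} [IsFiniteMeasure lam]
    [IsFiniteMeasure mu] {π : Measure (Rn d × Rn d)} {h : ℝ → ℝ} (hc : IsCoupling lam mu π)
    (hfin : HasFiniteCost h lam mu π) {r δ : ℝ} (hr : 0 < r) (he : excessEnergy π r ≤ δ) :
    EnergyLe lam mu (planDensity lam mu π) r (δ * r ^ (d + 2)) := by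
  have := hc.isFiniteMeasure
  have zm := measurable_planDensity lam mu π
  have z0 := planDensity_nonneg lam mu π
  have hint : Integrable (fun q : Rn d × Rn d => ‖q.2 - q.1‖ ^ 2) π := by
    simpa only [norm_sub_rev] using hfin.2.1
  rw [excessEnergy, inv_mul_le_iff₀ (by positivity), mul_comm] at he
  refine le_trans (le_of_eq ?_) (ENNReal.ofReal_le_ofReal he)
  rw [ofReal_integral_eq_lintegral_ofReal hint.integrableOn
    (Filter.Eventually.of_forall fun q => by positivity)]
  have hm : Measurable fun q : Rn d × Rn d => ENNReal.ofReal (‖q.2 - q.1‖ ^ 2) := by fun_prop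
  nth_rw 2 [← withDensity_planDensity hfin.1]
  rw [restrict_withDensity (measurableSet_ball.prod MeasurableSet.univ),
    lintegral_withDensity_eq_lintegral_mul _ zm.ennreal_ofReal hm, ← Measure.prod_restrict,
    Measure.restrict_univ, lintegral_prod _ (zm.ennreal_ofReal.mul hm).aemeasurable]
  refine lintegral_congr fun x => lintegral_congr fun y => ?_
  rw [Pi.mul_apply, ← ENNReal.ofReal_mul (z0 _), mul_comm]

theorem invSecondDeriv_hReg {p : ℝ} (hp : 1 ≤ p) (z : ℝ) :
    invSecondDeriv (hReg p) z = p⁻¹ * weight p z := by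
  unfold invSecondDeriv weight
  split_ifs with hz
  · rcases hp.eq_or_lt with rfl | hp
    · have h1 : ∀ u : ℝ, 0 < u → deriv (hReg 1) u = Real.log u + 1 := fun u hu => by
        rw [hReg_one, Real.deriv_mul_log hu.ne']
      have h2 : deriv (hReg 1) =ᶠ[nhds z] fun u => Real.log u + 1 :=
        (eventually_gt_nhds hz).mono h1
      rw [h2.deriv_eq, deriv_add_const, Real.deriv_log, inv_inv, inv_one, one_mul]
      norm_num
    · have hp1 : p - 1 ≠ 0 := by linarith
      have hp0 : p ≠ 0 := by linarith
      have h1 : ∀ u : ℝ, 0 < u → deriv (hReg p) u = p * u ^ (p - 1) / (p - 1) := fun u hu => by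
        have e : hReg p =ᶠ[nhds u] fun t => (t ^ p - 1) / (p - 1) := by
          filter_upwards [eventually_gt_nhds hu] with t ht
          simp only [hReg_of_one_lt hp, abs_of_pos ht]
        rw [e.deriv_eq]
        exact (((Real.hasDerivAt_rpow_const (Or.inl hu.ne')).sub_const 1).div_const (p - 1)).deriv
      have h2 : deriv (hReg p) =ᶠ[nhds z] fun u => p * u ^ (p - 1) / (p - 1) :=
        (eventually_gt_nhds hz).mono h1
      have h3 := ((((Real.hasDerivAt_rpow_const (p := p - 1) (Or.inl hz.ne')).const_mul p).div_const
        (p - 1))).deriv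
      rw [h2.deriv_eq, h3]
      have e : z ^ (2 - p) = (z ^ (p - 1 - 1))⁻¹ := by
        rw [← Real.rpow_neg hz.le]; ring_nf
      rw [e]
      field_simp
  · rw [mul_zero]

theorem RegularMean.transportMean {d : ℕ} {p ρ : ℝ} (hp : 1 ≤ p) {K : ℝ≥0}
    {lam mu : Measure (Rn d)} {π : Measure (Rn d × Rn d)}
    (h : RegularMean p ρ K mu (planDensity lam mu π)) :
    (∀ᵐ x ∂(volume.restrict (ball (0 : Rn d) ρ)),
      TransportMeanWellDefined (hReg p) lam mu π x) ∧
    ∃ T : Rn d → Rn d,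
      (∀ᵐ x ∂(volume.restrict (ball (0 : Rn d) ρ)), T x = transportMean (hReg p) lam mu π x) ∧
      LipschitzOnWith K T (ball 0 ρ) ∧
      (∀ᵐ x ∂(volume.restrict (ball (0 : Rn d) ρ)),
        DifferentiableAt ℝ T x ∧ ‖fderiv ℝ T x‖ ≤ K) ∧
      (p < 2 → ContDiffOn ℝ 1 T (ball 0 ρ) ∧ ∀ x ∈ ball (0 : Rn d) ρ, ‖fderiv ℝ T x‖ ≤ K) := by
  have hp0 : 0 < p⁻¹ := by positivity
  obtain ⟨h1, T, hT, hL, hC⟩ := h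
  have hnorm : ∀ x ∈ ball (0 : Rn d) ρ, ‖fderiv ℝ T x‖ ≤ K := fun x hx =>
    norm_fderiv_le_of_lipschitzOn ℝ (isOpen_ball.mem_nhds hx) hL
  refine ⟨?_, T, ?_, hL, ?_, fun hp2 => ⟨hC hp2, hnorm⟩⟩
  · filter_upwards [h1] with x ⟨i1, i2, i3⟩
    simp only [TransportMeanWellDefined, invSecondDeriv_hReg hp, ← smul_smul, integral_const_mul]
    exact ⟨i1.const_mul _, i2.smul p⁻¹, mul_pos hp0 i3⟩
  · filter_upwards [hT] with x hx
    simp only [_root_.transportMean, invSecondDeriv_hReg hp, mul_smul, integral_const_mul,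
      integral_smul]
    rw [hx, smul_smul, mul_inv, mul_right_comm, inv_mul_cancel₀ hp0.ne', one_mul]
  · rw [ae_restrict_iff' measurableSet_ball]
    filter_upwards [hL.ae_differentiableWithinAt_of_mem] with x hx hxB
    exact ⟨(hx hxB).differentiableAt (isOpen_ball.mem_nhds hxB), hnorm x hxB⟩

theorem proposition5p1 (d : ℕ) (hd : 1 ≤ d) (p : ℝ) (hp : p ∈ Set.Icc (1 : ℝ) 2) :
    ∃ ε₁ : ℝ, 0 < ε₁ ∧ ∃ C₀ : ℝ, 0 < C₀ ∧
      ∀ m M : ℝ, 0 < m → m ≤ M →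
        ∃ δ : ℝ, 0 < δ ∧ ∀ C : ℝ, C₀ ≤ C → ∃ K : ℝ≥0,
          ∀ ε : ℝ, 0 < ε → ε ≤ ε₁ →
          ∀ r : ℝ, r = C * ε ^ (2 / ((d : ℝ) * (p - 1) + 2)) →
          ∀ (lam mu : Measure (Rn d)) [IsFiniteMeasure lam] [IsFiniteMeasure mu],
            lam ≪ volume → mu ≪ volume →
            DensityBetween lam m M r → DensityBetween mu m M r →
          ∀ π : Measure (Rn d × Rn d), IsRegMinimiser (hReg p) ε lam mu π →
            excessEnergy π r ≤ δ →
            (∀ᵐ x ∂(volume.restrict (ball (0 : Rn d) (r / 3))),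
              TransportMeanWellDefined (hReg p) lam mu π x) ∧
            ∃ T : Rn d → Rn d,
              (∀ᵐ x ∂(volume.restrict (ball (0 : Rn d) (r / 3))),
                T x = transportMean (hReg p) lam mu π x) ∧
              LipschitzOnWith K T (ball 0 (r / 3)) ∧
              (∀ᵐ x ∂(volume.restrict (ball (0 : Rn d) (r / 3))),
                DifferentiableAt ℝ T x ∧ ‖fderiv ℝ T x‖ ≤ K) ∧
              (p < 2 → ContDiffOn ℝ 1 T (ball 0 (r / 3)) ∧
                ∀ x ∈ ball (0 : Rn d) (r / 3), ‖fderiv ℝ T x‖ ≤ K) := by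
  obtain ⟨hp1, hp2⟩ := hp
  -- `C₀ = 1` ensures that the radius after rescaling, which is C, is at least one.
  refine ⟨1, one_pos, 1, one_pos, fun m M hm hmM => ?_⟩
  have hM : 0 < M := hm.trans_le hmM
  have hD : 0 < (d : ℝ) * (p - 1) + 2 := by
    have : 0 ≤ (d : ℝ) * (p - 1) := mul_nonneg (Nat.cast_nonneg d) (by linarith)
    linarith
  -- The exponent in the definition of r is the one for which s^(2 + d(p-1)) = ε², so that rescaling
  -- by s removes ε from the cycle condition.
  have hscale : ∀ ε : ℝ, 0 < ε → ∀ s : ℝ, s = ε ^ (2 / ((d : ℝ) * (p - 1) + 2)) →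
      s ^ 2 * (s ^ d) ^ (p - 1) = ε ^ 2 := by
    rintro ε hε s rfl
    rw [← Real.rpow_natCast, ← Real.rpow_natCast, ← Real.rpow_mul (by positivity),
      ← Real.rpow_mul (by positivity), ← Real.rpow_mul (by positivity), ← Real.rpow_add hε,
      ← Real.rpow_natCast ε 2]
    congr 1
    push_cast
    field_simp
    ring
  rcases hp1.eq_or_lt with rfl | hp1'
  · obtain ⟨δ, hδ, hreg⟩ := exists_regularMean_exp d (b := 2) two_pos hm hM
    refine ⟨δ, hδ, fun C hC => ?_⟩
    obtain ⟨K, hK⟩ := hreg C hC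
    refine ⟨K, fun ε hε _ r hr lam mu _ _ hl hmu hld hmud π hmin he => ?_⟩
    obtain ⟨s, hs⟩ : ∃ s : ℝ, s = ε ^ (2 / ((d : ℝ) * (1 - 1) + 2)) := ⟨_, rfl⟩
    have hs0 : 0 < s := by rw [hs]; positivity
    rw [← hs] at hr
    have hr0 : 0 < r := by rw [hr]; exact mul_pos (by linarith) hs0
    have hrs : r / s = C := by rw [hr, mul_div_cancel_right₀ _ hs0.ne']
    refine RegularMean.transportMean le_rfl (RegularMean.of_rescale hs0 ?_)
    have h1 := isPlanDensity_planDensity hmin.1 hmin.2.1.1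
    have h2 := (hmin.expCycle hε).rescale hs0
    have h3 := (energyLe_of_excessEnergy_le hmin.1 hmin.2.1 hr0 he).rescale hs0
    have h4 := (hld.volBetween hl).rescale hs0
    have h5 := (hmud.volBetween hmu).rescale hs0
    have e1 : 2 / ε ^ 2 * s ^ 2 = 2 := by
      have := hscale ε hε s hs
      rw [sub_self, Real.rpow_zero, mul_one] at this
      rw [this]; field_simp
    rw [e1] at h2
    rw [hrs] at h3 h4 h5
    rw [mul_div_assoc, ← div_pow, hrs] at h3
    rw [div_right_comm, hrs]
    have := isFiniteMeasure_rescale hs0 lam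
    have := isFiniteMeasure_rescale hs0 mu
    exact hK _ _ _ (h1.rescale hs0) h2 h4 h5 h3
  · obtain ⟨δ, hδ, hreg⟩ := exists_regularMean_pow d hd (b := 2 * (p - 1) / p) hp1' hp2
      (div_pos (by linarith) (by linarith)) hm hM
    refine ⟨δ, hδ, fun C hC => ?_⟩
    obtain ⟨K, hK⟩ := hreg C hC
    refine ⟨K, fun ε hε _ r hr lam mu _ _ hl hmu hld hmud π hmin he => ?_⟩
    obtain ⟨s, hs⟩ : ∃ s : ℝ, s = ε ^ (2 / ((d : ℝ) * (p - 1) + 2)) := ⟨_, rfl⟩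
    have hs0 : 0 < s := by rw [hs]; positivity
    rw [← hs] at hr
    have hr0 : 0 < r := by rw [hr]; exact mul_pos (by linarith) hs0
    have hrs : r / s = C := by rw [hr, mul_div_cancel_right₀ _ hs0.ne']
    refine RegularMean.transportMean hp1 (RegularMean.of_rescale hs0 ?_)
    have h1 := isPlanDensity_planDensity hmin.1 hmin.2.1.1
    have h2 := (hmin.powCycle hp1' hε).rescale h1.nonneg hs0
    have h3 := (energyLe_of_excessEnergy_le hmin.1 hmin.2.1 hr0 he).rescale hs0
    have h4 := (hld.volBetween hl).rescale hs0
    have h5 := (hmud.volBetween hmu).rescale hs0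
    have e1 : 2 * (p - 1) / p / ε ^ 2 * s ^ 2 * (s ^ d) ^ (p - 1) = 2 * (p - 1) / p := by
      rw [mul_assoc, hscale ε hε s hs, div_mul_cancel₀ _ (by positivity)]
    rw [e1] at h2
    rw [hrs] at h3 h4 h5
    rw [mul_div_assoc, ← div_pow, hrs] at h3
    rw [div_right_comm, hrs]
    have := isFiniteMeasure_rescale hs0 lam
    have := isFiniteMeasure_rescale hs0 mu
    exact hK _ _ _ (h1.rescale hs0) h2 h4 h5 h3
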